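/- Let $a>0$ and $\omega\in(-a,a)$. Let $\alpha_0=I,\alpha_1,\alpha_2,\alpha_3,\beta$ be the Dirac matrices: $\beta=\mathrm{diag}(1,1,-1,-1)$, and for $k=1,2,3$ the matrix $\alpha_k$ has the Pauli matrix $\sigma_k$ in its two off-diagonal $2\times2$ blocks. Let $g:[0,\infty)\to\mathbb R$, $G(s)=\int_0^s g(t)\,t\,dt$, and $Q,P:\mathbb R^3\to\mathbb R$ satisfy * $(g_1)$ $g(0)=0$, $g\in C^1(0,\infty)$, $g'(s)>0$ for $s>0$, and there are $p\in(2,3)$, $c_1>0$ with $g(s)\le c_1(1+s^{p-2})$ for $s\ge0$; * $(g_2)$ there are $\sigma>2$, $\theta>2$, $c_0>0$ with $c_0s^\sigma\le G(s)\le\frac1\theta g(s)s^2$ for all $s>0$; * $(Q_0)$ $Q$ is locally Lipschitz and bounded, and $Q\ge0$ a.e.; * $(P_0)$ $P$ is locally Lipschitz and bounded, $\inf P>0$, and $\limsup_{|x|\to\infty}P(x)<\sup P$. Let $H_0=i\alpha\cdot\nabla-a\beta$, a self-adjoint operator on $L^2(\mathbb R^3,\mathbb C^4)$ with domain $H^1$.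 Let $E=\mathcal D(|H_0|^{1/2})=H^{1/2}(\mathbb R^3,\mathbb C^4)$ with the inner product $\langle u,v\rangle=\Re(|H_0|^{1/2}u,|H_0|^{1/2}v)_{L^2}$ and norm $\|\cdot\|$, and write $u=u^++u^-$ with $u^\pm=\frac12(1\pm\mathrm{sgn}\,H_0)u$ the components of $u$ in the positive and negative spectral subspaces of $H_0$. For $\varepsilon>0$ and $u\in E$ put $Q_\varepsilon(x)=Q(\varepsilon x)$, $P_\varepsilon(x)=P(\varepsilon x)$, $J_k=(\alpha_ku)\cdot\overline u$, $$A^k_{\varepsilon,u}(x)=\varepsilon^2\int_{\mathbb R^3}\frac{Q_\varepsilon(y)J_k(y)}{|x-y|}\,dy\qquad(k=0,1,2,3),$$ which is the solution of $-\Delta A=4\pi\varepsilon^2Q_\varepsilon J_k$ in $\mathcal D^{1,2}(\mathbb R^3)$, and $$\Phi_\varepsilon(u)=\tfrac12\big(\|u^+\|^2-\|u^-\|^2-\omega|u|_{L^2}^2\big)-\tfrac14\int Q_\varepsilon A^0_{\varepsilon,u}J_0\,dx+\tfrac14\sum_{k=1}^3\int Q_\varepsilon A^k_{\varepsilon,u}J_k\,dx-\int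 P_\varepsilon\,G(|u|)\,dx .$$ A sequence $(u_n)$ in $E$ is a $(C)_c$-sequence (Cerami sequence at level $c$) of $\Phi_\varepsilon$ if $\Phi_\varepsilon(u_n)\to c$ and $(1+\|u_n\|)\,\Phi_\varepsilon'(u_n)\to0$ in the dual of $E$, where $\Phi_\varepsilon'$ is the (real) Fréchet derivative. Then for every $\lambda>0$ there is $\Lambda>0$ such that for all $\varepsilon\in(0,1]$ (so $\Lambda$ is independent of $\varepsilon$), all $c\in[0,\lambda]$ and every $(C)_c$-sequence $(u_n)$ of $\Phi_\varepsilon$, some subsequence $(u_{n_j})$ satisfies $\|u_{n_j}\|\le\Lambda$ for all $j$. -/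

import Mathlib

open MeasureTheory Filter Topology
open scoped FourierTransform

noncomputable section

namespace MaxwellDirac

/-- Physical space `ℝ³` with its Euclidean norm. -/
abbrev R3 := EuclideanSpace ℝ (Fin 3)

/-- The spinor space `ℂ⁴` with its Hermitian norm. -/
abbrev Spinor := EuclideanSpace ℂ (Fin 4)

/-- The Hilbert space `L²(ℝ³, ℂ⁴)`. -/
abbrev L2 := Lp Spinor 2 (volume : Measure R3)

/-! ### Dirac matrices -/

/-- The matrices `α₀ = I` and `α₁, α₂, α₃`, where `αₖ` has the Pauli matrix `σₖ` in both of its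
off-diagonal `2 × 2` blocks. -/
def alpha : Fin 4 → Matrix (Fin 4) (Fin 4) ℂ
  | 0 => 1
  | 1 => !![0, 0, 0, 1; 0, 0, 1, 0; 0, 1, 0, 0; 1, 0, 0, 0]
  | 2 => !![0, 0, 0, -Complex.I; 0, 0, Complex.I, 0; 0, -Complex.I, 0, 0; Complex.I, 0, 0, 0]
  | 3 => !![0, 0, 1, 0; 0, 0, 0, -1; 1, 0, 0, 0; 0, -1, 0, 0]

/-- The matrix `β = diag(1, 1, -1, -1)`. -/
def beta : Matrix (Fin 4) (Fin 4) ℂ :=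
  !![1, 0, 0, 0; 0, 1, 0, 0; 0, 0, -1, 0; 0, 0, 0, -1]

/-! ### The Dirac operator `H₀ = i α·∇ - a β` and the operators built from it

With the normalisation `(𝓕 u)(ξ) = ∫ exp (-2πi x·ξ) u(x) dx`, the operator `i ∂ₖ` is
multiplication by `-2π ξₖ` on the Fourier side, so that `H₀` is multiplication by the Hermitian
matrix `D(ξ) = -2π ∑ₖ ξₖ αₖ - a β`.  Since `D(ξ)² = (a² + 4π²|ξ|²) I`, the absolute value `|H₀|`
is multiplication by the scalar `√(a² + 4π²|ξ|²)`, the operator `|H₀|^{1/2}` is multiplication by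
its square root, and `sgn H₀` is multiplication by `D(ξ) / √(a² + 4π²|ξ|²)`. -/

/-- The matrix `D(ξ)`. -/
def diracMatrix (a : ℝ) (ξ : R3) : Matrix (Fin 4) (Fin 4) ℂ :=
  (∑ k : Fin 3, ((-(2 * Real.pi * ξ k) : ℝ) : ℂ) • alpha k.succ) - (a : ℂ) • beta

/-- The Fourier symbol of `H₀`: the matrix `D(ξ)` acting on `ℂ⁴`. -/
def diracSymbol (a : ℝ) (ξ : R3) : Spinor →L[ℂ] Spinor :=
  Matrix.toEuclideanCLM (𝕜 := ℂ) (diracMatrix a ξ)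

/-- The Fourier symbol of `|H₀|`. -/
def absSymbol (a : ℝ) (ξ : R3) : ℝ := Real.sqrt (a ^ 2 + (2 * Real.pi * ‖ξ‖) ^ 2)

/-- The operator `H₀ = i α·∇ - a β` on functions. -/
def diracOp (a : ℝ) (u : R3 → Spinor) (x : R3) : Spinor :=
  (∑ k : Fin 3, Complex.I • Matrix.toEuclideanCLM (𝕜 := ℂ) (alpha k.succ)
    (fderiv ℝ u x (EuclideanSpace.single k 1))) -
    (a : ℂ) • Matrix.toEuclideanCLM (𝕜 := ℂ) beta (u x)

open scoped SchwartzMap in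
/-- The matrix `D(ξ)` is indeed the symbol of `H₀`. -/
theorem fourier_diracOp (a : ℝ) (u : 𝓢(R3, Spinor)) (ξ : R3) :
    𝓕 (diracOp a u) ξ = diracSymbol a ξ (𝓕 (u : R3 → Spinor) ξ) := by
  have hd : ∀ k : Fin 3, Integrable (fun x : R3 =>
      fderiv ℝ u x (EuclideanSpace.single k (1 : ℝ))) := fun k =>
    (LineDeriv.lineDerivOp (EuclideanSpace.single k (1 : ℝ) : R3) u).integrable
  have hF : ∀ k : Fin 3, 𝓕 (fun x : R3 => fderiv ℝ u x (EuclideanSpace.single k (1 : ℝ))) ξ =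
      (2 * Real.pi * Complex.I * ξ k) • 𝓕 (u : R3 → Spinor) ξ := by
    intro k
    have h := congrArg (fun T : 𝓢(R3, Spinor) => T ξ)
      (SchwartzMap.fourier_lineDerivOp_eq u (EuclideanSpace.single k (1 : ℝ)))
    have ht : (fun x : R3 =>
        inner ℝ x (EuclideanSpace.single k (1 : ℝ) : R3)).HasTemperateGrowth := by fun_prop
    simp only [SchwartzMap.fourier_coe, smul_apply,
      SchwartzMap.smulLeftCLM_apply_apply ht] at h
    rw [mul_smul, Complex.coe_smul]
    have hin : inner ℝ ξ (EuclideanSpace.single k (1 : ℝ) : R3) = ξ k := by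
      simp [EuclideanSpace.inner_single_right]
    rw [hin] at h
    exact h
  have hI : ∀ (c : ℂ) (A : Spinor →L[ℂ] Spinor) (f : R3 → Spinor), Integrable f →
      Integrable (fun x => c • A (f x)) ∧ 𝓕 (fun x => c • A (f x)) ξ = c • A (𝓕 f ξ) := by
    intro c A f hf
    refine ⟨(A.integrable_comp hf).smul c, ?_⟩
    have hf2 : Integrable (fun x => Real.fourierChar (-(inner ℝ x ξ)) • f x) :=
      (Real.fourierIntegral_convergent_iff ξ).2 hf
    rw [Real.fourier_eq, Real.fourier_eq, ← ContinuousLinearMap.integral_comp_comm A hf2,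
      ← integral_smul]
    congr 1
    ext1 x
    simp only [Circle.smul_def, map_smul]
    rw [smul_comm]
  have h1 := fun k : Fin 3 => hI Complex.I (Matrix.toEuclideanCLM (𝕜 := ℂ) (alpha k.succ)) _ (hd k)
  have h2 := hI a (Matrix.toEuclideanCLM (𝕜 := ℂ) beta) _ u.integrable
  have hadd : ∀ f f' : R3 → Spinor, Integrable f → Integrable f' →
      Integrable (fun x => f x + f' x) ∧ 𝓕 (fun x => f x + f' x) ξ = 𝓕 f ξ + 𝓕 f' ξ := by
    intro f f' hf hf'
    refine ⟨hf.add hf', ?_⟩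
    rw [Real.fourier_eq, Real.fourier_eq, Real.fourier_eq,
      ← integral_add ((Real.fourierIntegral_convergent_iff ξ).2 hf)
        ((Real.fourierIntegral_convergent_iff ξ).2 hf')]
    simp only [smul_add]
  have hsub : ∀ f f' : R3 → Spinor, Integrable f → Integrable f' →
      𝓕 (fun x => f x - f' x) ξ = 𝓕 f ξ - 𝓕 f' ξ := by
    intro f f' hf hf'
    rw [Real.fourier_eq, Real.fourier_eq, Real.fourier_eq,
      ← integral_sub ((Real.fourierIntegral_convergent_iff ξ).2 hf)
        ((Real.fourierIntegral_convergent_iff ξ).2 hf')]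
    simp only [smul_sub]
  unfold diracOp
  simp only [Fin.sum_univ_three]
  have h01 := hadd _ _ (h1 0).1 (h1 1).1
  have h012 := hadd _ _ h01.1 (h1 2).1
  rw [hsub _ _ h012.1 h2.1, h012.2, h01.2, (h1 0).2, (h1 1).2, (h1 2).2, h2.2, hF, hF, hF]
  have hI2 : ∀ r : ℂ, Complex.I * (2 * Real.pi * Complex.I * r) = -(2 * Real.pi * r) := fun r => by
    linear_combination (2 * Real.pi * r) * Complex.I_mul_I
  simp only [diracSymbol, diracMatrix, Fin.sum_univ_three, map_sub, map_add, map_smul,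
    sub_apply, add_apply, smul_apply,
    smul_smul, hI2]
  push_cast
  rfl

theorem diracMatrix_mul_self (a : ℝ) (ξ : R3) :
    diracMatrix a ξ * diracMatrix a ξ = ((absSymbol a ξ ^ 2 : ℝ) : ℂ) • 1 := by
  have h : absSymbol a ξ ^ 2 = a ^ 2 + (2 * Real.pi) ^ 2 * (ξ 0 ^ 2 + ξ 1 ^ 2 + ξ 2 ^ 2) := by
    rw [absSymbol, Real.sq_sqrt (by positivity), mul_pow, EuclideanSpace.norm_sq_eq]
    simp [Fin.sum_univ_three]
  rw [h]
  ext i j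
  fin_cases i <;> fin_cases j <;>
    simp [diracMatrix, alpha, beta, Matrix.mul_apply, Fin.sum_univ_four, Fin.sum_univ_three] <;>
    ring_nf <;> simp

theorem diracMatrix_isHermitian (a : ℝ) (ξ : R3) : (diracMatrix a ξ).IsHermitian := by
  ext i j
  fin_cases i <;> fin_cases j <;>
    simp [diracMatrix, alpha, beta, Fin.sum_univ_three]

theorem norm_diracSymbol_apply (a : ℝ) (ξ : R3) (v : Spinor) :
    ‖diracSymbol a ξ v‖ = absSymbol a ξ * ‖v‖ := by
  have h0 : 0 ≤ absSymbol a ξ := Real.sqrt_nonneg _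
  have hstar : star (diracSymbol a ξ) = diracSymbol a ξ := by
    have h := diracMatrix_isHermitian a ξ
    rw [diracSymbol, ← map_star, Matrix.star_eq_conjTranspose, h.eq]
  have hsq : diracSymbol a ξ (diracSymbol a ξ v) = ((absSymbol a ξ ^ 2 : ℝ) : ℂ) • v := by
    rw [← mul_apply_eq_comp, diracSymbol, ← map_mul, diracMatrix_mul_self, map_smul,
      map_one]
    rfl
  have h1 : ‖diracSymbol a ξ v‖ ^ 2 = (absSymbol a ξ * ‖v‖) ^ 2 := by
    rw [← inner_self_eq_norm_sq (𝕜 := ℂ), ← ContinuousLinearMap.adjoint_inner_left,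
      ← ContinuousLinearMap.star_eq_adjoint, hstar, hsq, inner_smul_left, Complex.conj_ofReal,
      inner_self_eq_norm_sq_to_K, mul_pow]
    change (((absSymbol a ξ ^ 2 : ℝ) : ℂ) * ((‖v‖ : ℝ) : ℂ) ^ 2).re = _
    rw [← Complex.ofReal_pow, ← Complex.ofReal_mul, Complex.ofReal_re]
  exact (sq_eq_sq₀ (norm_nonneg _) (by positivity)).1 h1

theorem continuous_absSymbol (a : ℝ) : Continuous (absSymbol a) := by
  unfold absSymbol
  fun_prop

theorem continuous_diracSymbol (a : ℝ) : Continuous (diracSymbol a) := by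
  have h : Continuous (diracMatrix a) := by
    unfold diracMatrix
    fun_prop
  have h2 : Continuous (Matrix.toEuclideanCLM (n := Fin 4) (𝕜 := ℂ)) :=
    LinearMap.continuous_of_finiteDimensional
      ((Matrix.toEuclideanCLM (n := Fin 4) (𝕜 := ℂ)).toAlgEquiv.toLinearMap)
  exact h2.comp h

theorem absSymbol_pos (a : ℝ) {ξ : R3} (hξ : ξ ≠ 0) : 0 < absSymbol a ξ := by
  have := norm_pos_iff.2 hξ
  have := Real.pi_pos
  unfold absSymbol
  positivity

/-- The Fourier side of `|H₀|^{1/2} u`. -/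
def sqrtAbsFourier (a : ℝ) (u : L2) (ξ : R3) : Spinor :=
  ((Real.sqrt (absSymbol a ξ) : ℝ) : ℂ) • (𝓕 u : L2) ξ

theorem sqrtAbsFourier_add (a : ℝ) (u v : L2) :
    sqrtAbsFourier a (u + v) =ᵐ[volume] sqrtAbsFourier a u + sqrtAbsFourier a v := by
  have h : (𝓕 (u + v) : L2) = 𝓕 u + 𝓕 v := FourierTransform.fourier_add u v
  filter_upwards [Lp.coeFn_add (𝓕 u : L2) (𝓕 v)] with ξ hξ
  rw [Pi.add_apply, sqrtAbsFourier, sqrtAbsFourier, sqrtAbsFourier, h, hξ, Pi.add_apply, smul_add]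

theorem sqrtAbsFourier_smul (a : ℝ) (c : ℂ) (u : L2) :
    sqrtAbsFourier a (c • u) =ᵐ[volume] c • sqrtAbsFourier a u := by
  have h : (𝓕 (c • u) : L2) = c • 𝓕 u := FourierTransform.fourier_smul c u
  filter_upwards [Lp.coeFn_smul c (𝓕 u : L2)] with ξ hξ
  rw [Pi.smul_apply, sqrtAbsFourier, sqrtAbsFourier, h, hξ, Pi.smul_apply, smul_comm]

/-! ### The form domain `E = 𝓓(|H₀|^{1/2}) = H^{1/2}` -/

/-- `𝓓(|H₀|^{1/2})` as a subspace of `L²(ℝ³, ℂ⁴)`. -/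
def formDomain (a : ℝ) : Submodule ℂ L2 where
  carrier := {u | MemLp (sqrtAbsFourier a u) 2 (volume : Measure R3)}
  add_mem' {u v} hu hv := (memLp_congr_ae (sqrtAbsFourier_add a u v)).2 (MemLp.add hu hv)
  zero_mem' := by
    have h := sqrtAbsFourier_smul a 0 0
    rw [zero_smul, zero_smul] at h
    exact (memLp_congr_ae h).2 MemLp.zero
  smul_mem' c u hu := (memLp_congr_ae (sqrtAbsFourier_smul a c u)).2 (MemLp.const_smul hu c)

/-- The space `E`.  It is a type of its own, since it carries the norm `‖|H₀|^{1/2} u‖₂` and not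
the `L²` norm. -/
def E (a : ℝ) : Type := formDomain a

instance (a : ℝ) : AddCommGroup (E a) := inferInstanceAs (AddCommGroup (formDomain a))

instance (a : ℝ) : Module ℂ (E a) := inferInstanceAs (Module ℂ (formDomain a))

/-- The inclusion `E ⊆ L²`. -/
def toL2 {a : ℝ} : E a →ₗ[ℂ] L2 := (formDomain a).subtype

theorem memLp_sqrtAbsFourier {a : ℝ} (u : E a) :
    MemLp (sqrtAbsFourier a (toL2 u)) 2 (volume : Measure R3) := u.2

/-- The operator `|H₀|^{1/2} : E → L²`. -/
def sqrtAbsDirac {a : ℝ} : E a →ₗ[ℂ] L2 where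
  toFun u := 𝓕⁻ (MemLp.toLp (sqrtAbsFourier a (toL2 u)) (memLp_sqrtAbsFourier u))
  map_add' u v := by
    rw [← FourierTransform.fourierInv_add]
    refine congrArg _ ((MemLp.toLp_congr _ ((memLp_sqrtAbsFourier u).add (memLp_sqrtAbsFourier v))
      ?_).trans (MemLp.toLp_add _ _))
    rw [map_add]
    exact sqrtAbsFourier_add a (toL2 u) (toL2 v)
  map_smul' c u := by
    rw [RingHom.id_apply, ← FourierTransform.fourierInv_smul]
    refine congrArg _ ((MemLp.toLp_congr _ ((memLp_sqrtAbsFourier u).const_smul c)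
      ?_).trans (MemLp.toLp_const_smul _ _))
    rw [map_smul]
    exact sqrtAbsFourier_smul a c (toL2 u)

theorem sqrtAbsDirac_injective {a : ℝ} : Function.Injective (sqrtAbsDirac (a := a)) := by
  rw [← LinearMap.ker_eq_bot, LinearMap.ker_eq_bot']
  intro u hu
  have h1 : MemLp.toLp (sqrtAbsFourier a (toL2 u)) (memLp_sqrtAbsFourier u) = 0 := by
    have h := congrArg (fun w : L2 => (𝓕 w : L2)) hu
    have hz : (𝓕 (0 : L2) : L2) = 0 := (Lp.fourierTransformₗᵢ R3 Spinor).map_zero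
    simpa [sqrtAbsDirac, hz] using h
  have h2 : sqrtAbsFourier a (toL2 u) =ᵐ[volume] 0 := by
    refine (MemLp.coeFn_toLp (memLp_sqrtAbsFourier u)).symm.trans ?_
    change (MemLp.toLp (sqrtAbsFourier a (toL2 u)) (memLp_sqrtAbsFourier u) : R3 → Spinor) =ᵐ[volume] 0
    rw [h1]
    exact Lp.coeFn_zero _ _ _
  have h3 : (𝓕 (toL2 u) : L2) = 0 := by
    rw [Lp.eq_zero_iff_ae_eq_zero]
    filter_upwards [h2, (volume : Measure R3).ae_ne 0] with ξ hξ h0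
    have hp := Real.sqrt_pos.2 (absSymbol_pos a h0)
    simpa [sqrtAbsFourier, hp.ne'] using hξ
  have h4 : toL2 u = 0 := by
    rw [← norm_eq_zero, ← Lp.norm_fourier_eq, h3, norm_zero]
  exact Subtype.ext h4

instance (a : ℝ) : NormedAddCommGroup (E a) :=
  NormedAddCommGroup.induced (E a) L2 sqrtAbsDirac sqrtAbsDirac_injective

/-- The complex inner product `(|H₀|^{1/2} u, |H₀|^{1/2} v)₂` on `E`. -/
instance (a : ℝ) : InnerProductSpace ℂ (E a) :=
  InnerProductSpace.induced (sqrtAbsDirac (a := a))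

/-- The real inner product `⟨u, v⟩ = Re (|H₀|^{1/2} u, |H₀|^{1/2} v)₂` on `E`. -/
instance (a : ℝ) : InnerProductSpace ℝ (E a) := InnerProductSpace.complexToReal

theorem norm_eq_norm_sqrtAbsDirac {a : ℝ} (u : E a) : ‖u‖ = ‖sqrtAbsDirac u‖ := rfl

theorem inner_eq_re_inner_sqrtAbsDirac {a : ℝ} (u v : E a) :
    inner ℝ u v = (inner ℂ (sqrtAbsDirac u) (sqrtAbsDirac v)).re := rfl

/-! ### The splitting `E = E⁺ ⊕ E⁻` -/

/-- The Fourier side of `(sgn H₀) u`. -/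
def signFourier (a : ℝ) (u : L2) (ξ : R3) : Spinor :=
  (((absSymbol a ξ)⁻¹ : ℝ) : ℂ) • diracSymbol a ξ ((𝓕 u : L2) ξ)

theorem aestronglyMeasurable_signFourier (a : ℝ) (u : L2) :
    AEStronglyMeasurable (signFourier a u) (volume : Measure R3) := by
  have h1 : AEStronglyMeasurable (fun ξ : R3 => diracSymbol a ξ ((𝓕 u : L2) ξ)) volume :=
    (isBoundedBilinearMap_apply (𝕜 := ℂ) (E := Spinor) (F := Spinor)).continuous
      |>.comp_aestronglyMeasurable ((continuous_diracSymbol a).aestronglyMeasurable.prodMk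
        (Lp.aestronglyMeasurable (𝓕 u : L2)))
  have h2 : Measurable fun ξ : R3 => (((absSymbol a ξ)⁻¹ : ℝ) : ℂ) :=
    Complex.measurable_ofReal.comp (continuous_absSymbol a).measurable.inv
  exact h2.aestronglyMeasurable.smul h1

theorem norm_signFourier (a : ℝ) (u : L2) :
    ∀ᵐ ξ ∂(volume : Measure R3), ‖signFourier a u ξ‖ = ‖(𝓕 u : L2) ξ‖ := by
  filter_upwards [(volume : Measure R3).ae_ne 0] with ξ h0
  have hp := absSymbol_pos a h0
  rw [signFourier, norm_smul, norm_diracSymbol_apply, Complex.norm_real, Real.norm_eq_abs,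
    abs_of_pos (inv_pos.2 hp), inv_mul_cancel_left₀ hp.ne']

theorem memLp_signFourier (a : ℝ) (u : L2) :
    MemLp (signFourier a u) 2 (volume : Measure R3) :=
  (memLp_congr_norm (aestronglyMeasurable_signFourier a u) (Lp.aestronglyMeasurable _)
    (norm_signFourier a u)).2 (Lp.memLp (𝓕 u : L2))

/-- The operator `sgn H₀` on `L²`. -/
def signL2 (a : ℝ) (u : L2) : L2 := 𝓕⁻ (MemLp.toLp (signFourier a u) (memLp_signFourier a u))

theorem signL2_mem (a : ℝ) {u : L2} (hu : u ∈ formDomain a) : signL2 a u ∈ formDomain a := by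
  have h1 : (𝓕 (signL2 a u) : L2) =ᵐ[volume] signFourier a u := by
    rw [signL2, FourierTransform.fourier_fourierInv_eq]
    exact MemLp.coeFn_toLp _
  have hm : ∀ w : L2, AEStronglyMeasurable (sqrtAbsFourier a w) (volume : Measure R3) := fun w =>
    (Complex.continuous_ofReal.comp
      (Real.continuous_sqrt.comp (continuous_absSymbol a))).aestronglyMeasurable.smul
      (Lp.aestronglyMeasurable _)
  refine (memLp_congr_norm (hm _) (hm u) ?_).2 hu
  filter_upwards [h1, norm_signFourier a u] with ξ h2 h3
  rw [sqrtAbsFourier, sqrtAbsFourier, norm_smul, norm_smul, h2, h3]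

/-- The operator `sgn H₀` on `E`. -/
def signDirac {a : ℝ} (u : E a) : E a := ⟨signL2 a (toL2 u), signL2_mem a u.2⟩

/-- The component `u⁺ = ½ (1 + sgn H₀) u` of `u` in the positive spectral subspace of `H₀`. -/
def specPos {a : ℝ} (u : E a) : E a := (1 / 2 : ℝ) • (u + signDirac u)

/-- The component `u⁻ = ½ (1 - sgn H₀) u` of `u` in the negative spectral subspace of `H₀`. -/
def specNeg {a : ℝ} (u : E a) : E a := (1 / 2 : ℝ) • (u - signDirac u)

/-! ### The energy functional -/

/-- `J_k = (α_k u) · ū` at a point where the spinor is `w`; it is real as `α_k` is Hermitian. -/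
def current (k : Fin 4) (w : Spinor) : ℝ :=
  (inner ℂ w (Matrix.toEuclideanCLM (𝕜 := ℂ) (alpha k) w)).re

/-- The potential `A^k_{ε,u} = (ε² / |x|) * (Q_ε J_k)`, where `Q_ε(x) = Q(ε x)`: the solution of
`-Δ A = 4π ε² Q_ε J_k` in `𝓓^{1,2}`. -/
def potential (Q : R3 → ℝ) (ε : ℝ) (u : R3 → Spinor) (k : Fin 4) (x : R3) : ℝ :=
  ε ^ 2 * ∫ y, Q (ε • y) * current k (u y) / ‖x - y‖

/-- `Γ_ε(u) = ¼ ∫ Q_ε A⁰_{ε,u} J₀ dx - ¼ ∑_{k=1}^3 ∫ Q_ε A^k_{ε,u} J_k dx`. -/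
def Gam (Q : R3 → ℝ) (ε : ℝ) (u : R3 → Spinor) : ℝ :=
  (1 / 4) * (∫ x, Q (ε • x) * potential Q ε u 0 x * current 0 (u x)) -
    (1 / 4) * ∑ k : Fin 3, ∫ x, Q (ε • x) * potential Q ε u k.succ x * current k.succ (u x)

/-- `G(s) = ∫₀ˢ g(t) t dt`. -/
def primitive (g : ℝ → ℝ) (s : ℝ) : ℝ := ∫ t in (0 : ℝ)..s, g t * t

/-- `Ψ_ε(u) = ∫ P_ε G(|u|) dx`, where `P_ε(x) = P(ε x)`. -/
def Psi (g : ℝ → ℝ) (P : R3 → ℝ) (ε : ℝ) (u : R3 → Spinor) : ℝ :=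
  ∫ x, P (ε • x) * primitive g ‖u x‖

/-- `Φ_ε(u) = ½ (‖u⁺‖² - ‖u⁻‖² - ω |u|₂²) - Γ_ε(u) - Ψ_ε(u)` on `E`. -/
def Phi (a ω : ℝ) (g : ℝ → ℝ) (Q P : R3 → ℝ) (ε : ℝ) (u : E a) : ℝ :=
  (1 / 2) * (‖specPos u‖ ^ 2 - ‖specNeg u‖ ^ 2 - ω * ‖toL2 u‖ ^ 2) -
    Gam Q ε (toL2 u) - Psi g P ε (toL2 u)

/-- `(C)_c`-sequences: `F(u_n) → c` and `(1 + ‖u_n‖) F'(u_n) → 0` in the dual space. -/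
def IsCeramiSeq {X : Type*} [NormedAddCommGroup X] [NormedSpace ℝ X] (F : X → ℝ) (c : ℝ)
    (u : ℕ → X) : Prop :=
  Tendsto (fun n => F (u n)) atTop (𝓝 c) ∧
    Tendsto (fun n => (1 + ‖u n‖) • fderiv ℝ F (u n)) atTop (𝓝 0)

/-! ### Hypotheses on the data -/

/-- Hypothesis `(g₁)`. -/
def HypG1 (g : ℝ → ℝ) : Prop :=
  g 0 = 0 ∧ ContDiffOn ℝ 1 g (Set.Ioi 0) ∧ (∀ s, 0 < s → 0 < deriv g s) ∧
    ∃ p c₁ : ℝ, 2 < p ∧ p < 3 ∧ 0 < c₁ ∧ ∀ s, 0 ≤ s → g s ≤ c₁ * (1 + s ^ (p - 2))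

/-- Hypothesis `(g₂)`. -/
def HypG2 (g : ℝ → ℝ) : Prop :=
  ∃ σ θ c₀ : ℝ, 2 < σ ∧ 2 < θ ∧ 0 < c₀ ∧
    ∀ s, 0 < s → c₀ * s ^ σ ≤ primitive g s ∧ primitive g s ≤ 1 / θ * (g s * s ^ 2)

/-- Hypothesis `(Q₀)`. -/
def HypQ (Q : R3 → ℝ) : Prop :=
  LocallyLipschitz Q ∧ (∃ M : ℝ, ∀ x, |Q x| ≤ M) ∧ ∀ᵐ x ∂(volume : Measure R3), 0 ≤ Q x

/-- Hypothesis `(P₀)`. -/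
def HypP (P : R3 → ℝ) : Prop :=
  LocallyLipschitz P ∧ (∃ M : ℝ, ∀ x, |P x| ≤ M) ∧ 0 < ⨅ x, P x ∧
    limsup P (cocompact R3) < ⨆ x, P x

end MaxwellDirac

end

noncomputable section

namespace MaxwellDirac

open scoped SchwartzMap ENNReal Pointwise

/-! The bound is a direct a priori estimate: every `u` with `Φ_ε(u) ≤ c` and `(1 + ‖u‖) ‖Φ_ε'(u)‖ ≤
1` satisfies `‖u‖ ≤ Λ`, with `Λ` independent of `ε` (`exists_norm_le_of_almost_critical`). The tail
of a Cerami sequence consists of such `u`.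

Write `B(u, v, w, q)` for the four-linear form with `Γ_ε(u) = B(u, u, u, u) / 4`. Its kernel is
nonnegative, and its density `J₀(v) J₀(w) - J(v)·J(w)` on the diagonal is nonnegative because `|J| ≤
J₀`. In `Φ_ε(u) - Φ_ε'(u) u / 2` the quadratic part cancels and two nonnegative terms remain, so
`B(u, u, u, u)`, `∫ g(|u|) |u|²` and, by `(g₂)`, `∫ |u|^σ` are all bounded (`exists_energy_bounds`).

Now test `Φ_ε'(u)` with `w = (sgn H₀) u`, which has the norm of `u`. The quadratic part is at least
`(1 - |ω| / a) ‖u‖²`, and the other two terms must be absorbed by it. In the term of `Ψ_ε`, Young's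
inequality together with the bound for `∫ g(|u|) |u|²` and linear growth of `g` leaves a small
multiple of `‖u‖²` plus a multiple of `‖u‖` (`exists_Psi_deriv_le`). For the Coulomb term, `B(u, u,
·, ·)` is positive semidefinite, so Cauchy–Schwarz bounds `B(u, u, u, w)²` by `B(u, u, u, u) B(u, u,
w, w)`. The first factor is bounded, and the second is `o(‖u‖⁴)`: cutting `u` at height `m ‖u‖`
leaves a lower part with small `L³` norm relative to `‖u‖` and an upper part that is bounded in `L²`
by the control of `∫ |u|^σ` (`exists_lintegral_coulomb_le_mul`). Hence `κ ‖u‖² / 2 ≤ 1 + C ‖u‖` with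
`κ = 1 - |ω| / a`, which bounds `‖u‖`.

The analytic input is the embedding of `E` in `L²` and `L³`, an additive substitute for the
Hardy–Littlewood–Sobolev inequality (`lintegral_coulomb_le`), and Fréchet differentiability of
`Φ_ε`, which gives meaning to `fderiv`. -/

/-! ### Fourier analysis and the Sobolev embedding into `L³`. -/

theorem integral_norm_inv_ball_pos_scale (A : ℝ) (hA : 0 < A) :
    ∫ ξ in Metric.ball (0 : R3) A, ‖ξ‖⁻¹ = A ^ 2 * ∫ ξ in Metric.ball (0 : R3) 1, ‖ξ‖⁻¹ := by
  have h := Measure.setIntegral_comp_smul_of_pos (volume : Measure R3) (fun ξ : R3 => ‖ξ‖⁻¹)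
    (Metric.ball (0 : R3) 1) hA
  have hb : A • Metric.ball (0 : R3) 1 = Metric.ball 0 A := by
    rw [smul_unitBall_of_pos hA]
  rw [hb] at h
  simp only [norm_smul, Real.norm_eq_abs, abs_of_pos hA, mul_inv, finrank_euclideanSpace,
    Fintype.card_fin, integral_const_mul, smul_eq_mul] at h
  field_simp at h
  simp only [one_div] at h
  exact h.symm

/-- The case `j = 1` serves the low-frequency estimate, `j = 2` the truncated Coulomb kernel. -/
theorem integrableOn_norm_inv_pow (j : ℕ) (hj : j < 3) (r : ℝ) :
    IntegrableOn (fun x : R3 => (‖x‖⁻¹) ^ j) (Metric.ball 0 r) := by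
  refine integrableOn_ball_of_norm_le_rpow (C := 1) (α := j) ?_ ?_ ?_ ?_
  · simp
  · simp only [finrank_euclideanSpace, Fintype.card_fin]; exact_mod_cast hj
  · refine ae_of_all _ fun x => ?_
    rw [one_mul, Real.rpow_neg (norm_nonneg _), Real.rpow_natCast, inv_pow, norm_inv, norm_pow,
      norm_norm]
  · exact (measurable_norm.inv.pow_const j).aestronglyMeasurable

/-- The inverse Fourier transform of `f ∈ L¹ ∩ L²` is bounded by `∫ ‖f‖`. -/
theorem norm_fourierInv_le_integral (f : L2) (hf : Integrable f) :
    ∀ᵐ x ∂(volume : Measure R3), ‖(𝓕⁻ f : L2) x‖ ≤ ∫ ξ, ‖f ξ‖ := by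
  have hL : Continuous fun p : R3 × R3 => (-(innerₗ R3)) p.1 p.2 := by
    have h : Continuous fun p : R3 × R3 => -(inner ℝ p.1 p.2) :=
      (continuous_fst.inner continuous_snd).neg
    exact h
  -- With the pairing `-(innerₗ R3)` the inverse transform is itself a `VectorFourier` integral, so
  -- continuity and the duality formula apply to it.
  have hinv : ∀ {F : Type} [NormedAddCommGroup F] [NormedSpace ℂ F] (q : R3 → F) (w : R3),
      𝓕⁻ q w = VectorFourier.fourierIntegral Real.fourierChar volume (-(innerₗ R3)) q w := by
    intro F _ _ q w
    rw [Real.fourierInv_eq, VectorFourier.fourierIntegral]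
    simp
  have hflip : (-(innerₗ R3)).flip = -(innerₗ R3) := by
    ext x y
    simp [real_inner_comm]
  have hcont : Continuous (𝓕⁻ (f : R3 → Spinor)) := by
    rw [show 𝓕⁻ (f : R3 → Spinor) = _ from funext (hinv _)]
    exact VectorFourier.fourierIntegral_continuous Real.continuous_fourierChar hL hf
  -- The `L²` transform and the integral formula agree because both, tested against `φ ∈ C_c^∞`,
  -- move the transform onto `φ`: one as tempered distributions, the other by Fubini.
  have key : (𝓕⁻ f : L2) =ᵐ[volume] 𝓕⁻ (f : R3 → Spinor) := by
    refine ae_eq_of_integral_contDiff_smul_eq ?_ hcont.locallyIntegrable ?_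
    · exact (Lp.memLp (𝓕⁻ f : L2)).locallyIntegrable (by norm_num)
    intro φ hφ hc
    have h1 : ContDiff ℝ ((⊤ : ℕ∞) : WithTop ℕ∞) (fun x => (φ x : ℂ)) :=
      Complex.ofRealCLM.contDiff.comp hφ
    have h2 : HasCompactSupport (fun x => (φ x : ℂ)) := hc.comp_left (g := fun r : ℝ => (r : ℂ)) rfl
    let ψ : 𝓢(R3, ℂ) := h2.toSchwartzMap h1
    have hψ : ∀ x, ψ x = (φ x : ℂ) := fun x => rfl
    have h3 := congrArg (fun T => T ψ) (Lp.fourierInv_toTemperedDistribution_eq f)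
    simp only [TemperedDistribution.fourierInv_apply, Lp.toTemperedDistribution_apply] at h3
    have h4 : ∫ x, (𝓕⁻ (ψ : R3 → ℂ)) x • f x = ∫ x, ψ x • 𝓕⁻ (f : R3 → Spinor) x := by
      have h5 := VectorFourier.integral_fourierIntegral_smul_eq_flip (μ := (volume : Measure R3))
        (ν := (volume : Measure R3)) (L := -(innerₗ R3)) (f := ψ) (g := f)
        Real.continuous_fourierChar hL ψ.integrable hf
      simp_rw [hinv]
      rw [h5, hflip]
    rw [← SchwartzMap.fourierInv_coe] at h4
    simp only [hψ] at h3 h4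
    simp only [Complex.coe_smul] at h3 h4
    rw [← h3]; exact h4
  filter_upwards [key] with x hx
  rw [hx, Real.fourierInv_eq]
  refine (norm_integral_le_integral_norm _).trans (le_of_eq ?_)
  congr 1; ext1 v
  simp [Circle.norm_smul]


theorem lintegral_enorm_sq_fourierInv (f : L2) :
    ∫⁻ x, ‖(𝓕⁻ f : L2) x‖ₑ ^ 2 = ∫⁻ ξ, ‖f ξ‖ₑ ^ 2 := by
  have h : ‖(𝓕⁻ f : L2)‖ = ‖f‖ := (Lp.fourierTransformₗᵢ R3 Spinor).symm.norm_map f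
  have h2 : ∀ g : L2, ∫⁻ x, ‖g x‖ₑ ^ 2 = ‖g‖ₑ ^ 2 := by
    intro g
    rw [Lp.enorm_def, eLpNorm_eq_lintegral_rpow_enorm_toReal (by simp) (by simp)]
    simp only [ENNReal.toReal_ofNat, ENNReal.rpow_ofNat, one_div]
    rw [← ENNReal.rpow_natCast, ← ENNReal.rpow_mul]
    simp
  rw [h2, h2, ← ofReal_norm, h, ofReal_norm]

/-- Splitting `u ∈ L²` at frequency `A`: the part of low frequency is bounded by
`A N (1 + ∫_{|ξ| < 1} |ξ|⁻¹) / 2` where `N² = ∫ |ξ| |û|²`. -/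
theorem exists_frequency_split (u : L2) {A N : ℝ} (hA : 0 < A) (hN : 0 < N)
    (hu : ∫⁻ ξ, ENNReal.ofReal ‖ξ‖ * ‖(𝓕 u : L2) ξ‖ₑ ^ 2 ≤ ENNReal.ofReal (N ^ 2)) :
    ∃ v w : L2, u = v + w ∧
      (∀ᵐ x ∂(volume : Measure R3),
        ‖v x‖ ≤ (1 + ∫ ξ in Metric.ball (0 : R3) 1, ‖ξ‖⁻¹) / 2 * A * N) ∧
      ∫⁻ x, ‖w x‖ₑ ^ 2 = ∫⁻ ξ in {ξ : R3 | A ≤ ‖ξ‖}, ‖(𝓕 u : L2) ξ‖ₑ ^ 2 := by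
  set f : L2 := 𝓕 u with hf
  have hB : MeasurableSet (Metric.ball (0 : R3) A) := measurableSet_ball
  have hv := (Lp.memLp f).indicator hB
  have hw := (Lp.memLp f).indicator hB.compl
  refine ⟨𝓕⁻ (hv.toLp _), 𝓕⁻ (hw.toLp _), ?_, ?_, ?_⟩
  · rw [← FourierTransform.fourierInv_add, ← MemLp.toLp_add]
    have : hv.toLp _ + hw.toLp _ = f := by
      rw [← MemLp.toLp_add]
      conv_rhs => rw [← Lp.toLp_coeFn f (Lp.memLp f)]
      congr 1
      exact Set.indicator_self_add_compl _ _
    rw [← MemLp.toLp_add] at this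
    rw [this, hf, FourierTransform.fourierInv_fourier_eq]
  · have hg : IntegrableOn (fun ξ : R3 => ‖ξ‖ * ‖f ξ‖ ^ 2) (Metric.ball 0 A) := by
      refine Integrable.integrableOn ⟨?_, ?_⟩
      · exact continuous_norm.aestronglyMeasurable.mul ((Lp.aestronglyMeasurable f).norm.pow 2)
      · refine lt_of_le_of_lt (le_of_eq ?_) (hu.trans_lt ENNReal.ofReal_lt_top)
        refine lintegral_congr fun ξ => ?_
        rw [enorm_mul, enorm_pow, enorm_norm, enorm_norm, ofReal_norm]
    have hgN : ∫ ξ in Metric.ball 0 A, ‖ξ‖ * ‖f ξ‖ ^ 2 ≤ N ^ 2 := by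
      rw [integral_eq_lintegral_of_nonneg_ae (ae_of_all _ fun ξ => by positivity)
        hg.aestronglyMeasurable]
      refine ENNReal.toReal_le_of_le_ofReal (by positivity) (le_trans ?_ hu)
      refine (setLIntegral_le_lintegral _ _).trans (lintegral_mono fun ξ => ?_)
      rw [ENNReal.ofReal_mul (norm_nonneg _), ENNReal.ofReal_pow (norm_nonneg _), ofReal_norm (f ξ)]
    have hk := integrableOn_norm_inv_pow 1 (by norm_num) A
    simp only [pow_one] at hk
    -- Young's inequality with weight `A / N`, which makes both terms multiples of `A * N` after
    -- integration over the ball.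
    have hbound : ∀ᵐ ξ ∂(volume : Measure R3).restrict (Metric.ball 0 A),
        ‖f ξ‖ ≤ (A / N) / 2 * (‖ξ‖ * ‖f ξ‖ ^ 2) + (N / A) / 2 * ‖ξ‖⁻¹ := by
      refine ae_restrict_of_ae ?_
      filter_upwards [(volume : Measure R3).ae_ne 0] with ξ h0
      have hp := norm_pos_iff.2 h0
      have : (A / N) / 2 * (‖ξ‖ * ‖f ξ‖ ^ 2) + (N / A) / 2 * ‖ξ‖⁻¹ - ‖f ξ‖
          = (A * ‖ξ‖ * ‖f ξ‖ - N) ^ 2 / (2 * A * N * ‖ξ‖) := by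
        field_simp
        ring
      have h2 : 0 ≤ (A * ‖ξ‖ * ‖f ξ‖ - N) ^ 2 / (2 * A * N * ‖ξ‖) := by positivity
      linarith
    have hsum := (hg.const_mul ((A / N) / 2)).add (hk.const_mul ((N / A) / 2))
    have hfi : IntegrableOn f (Metric.ball 0 A) :=
      hsum.mono' (Lp.aestronglyMeasurable f).restrict hbound
    have hvi : Integrable (hv.toLp _ : L2) :=
      ((integrable_indicator_iff hB).2 hfi).congr hv.coeFn_toLp.symm
    filter_upwards [norm_fourierInv_le_integral _ hvi] with x hx
    refine hx.trans ?_
    have h1 : ∫ ξ, ‖(hv.toLp _ : L2) ξ‖ = ∫ ξ in Metric.ball 0 A, ‖f ξ‖ := by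
      rw [← integral_indicator hB]
      refine integral_congr_ae ?_
      filter_upwards [hv.coeFn_toLp] with ξ hξ
      rw [hξ, norm_indicator_eq_indicator_norm]
    rw [h1]
    refine (integral_mono_ae hfi.norm hsum hbound).trans ?_
    simp only [Pi.add_apply]
    rw [integral_add (hg.const_mul _) (hk.const_mul _), integral_const_mul, integral_const_mul,
      integral_norm_inv_ball_pos_scale A hA]
    have h2 : A / N / 2 * ∫ ξ in Metric.ball 0 A, ‖ξ‖ * ‖f ξ‖ ^ 2 ≤ A / N / 2 * N ^ 2 := by gcongr
    refine (add_le_add_left h2 _).trans (le_of_eq ?_)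
    field_simp
  · rw [lintegral_enorm_sq_fourierInv, ← lintegral_indicator (by measurability)]
    refine lintegral_congr_ae ?_
    filter_upwards [hw.coeFn_toLp] with ξ hξ
    rw [hξ]
    by_cases h : A ≤ ‖ξ‖
    · rw [Set.indicator_of_mem (by simpa using h), Set.indicator_of_mem (by simpa using h)]
    · rw [Set.indicator_of_notMem (by simpa using h), Set.indicator_of_notMem (by simpa using h)]
      simp

/-- The Sobolev embedding `H^{1/2}(ℝ³) ⊆ L³(ℝ³)`. -/
theorem exists_lintegral_enorm_cube_le : ∃ C : ℝ, 0 < C ∧ ∀ (u : L2) (N : ℝ), 0 < N →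
    ∫⁻ ξ, ENNReal.ofReal ‖ξ‖ * ‖(𝓕 u : L2) ξ‖ₑ ^ 2 ≤ ENNReal.ofReal (N ^ 2) →
      ∫⁻ x, ‖u x‖ₑ ^ 3 ≤ ENNReal.ofReal (C * N ^ 3) := by
  set C₀ : ℝ := (1 + ∫ ξ in Metric.ball (0 : R3) 1, ‖ξ‖⁻¹) / 2 with hC₀
  have hC₀pos : 0 < C₀ := by
    have : 0 ≤ ∫ ξ in Metric.ball (0 : R3) 1, ‖ξ‖⁻¹ := integral_nonneg fun _ => by positivity
    positivity
  refine ⟨24 * C₀, by positivity, fun u N hN hu => ?_⟩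
  -- The cut-off frequency depends on the level: `A = t / (2 C₀ N)` makes the low part at most `t /
  -- 2`, so `|u| > t` forces the high part to be at least `t / 2`. Chebyshev's inequality in `L²`
  -- then gives the factor `4`.
  have hmeas : ∀ t ∈ Set.Ioi (0 : ℝ), volume {x : R3 | t < ‖u x‖} * ENNReal.ofReal (t ^ ((3 : ℝ) - 1))
      ≤ 4 * ∫⁻ ξ, {ξ : R3 | t ≤ 2 * C₀ * N * ‖ξ‖}.indicator (fun ξ => ‖(𝓕 u : L2) ξ‖ₑ ^ 2) ξ := by
    intro t ht
    rw [Set.mem_Ioi] at ht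
    obtain ⟨v, w, huvw, hv, hw⟩ := exists_frequency_split u (A := t / (2 * C₀ * N)) (by positivity) hN hu
    have hset : {ξ : R3 | t / (2 * C₀ * N) ≤ ‖ξ‖} = {ξ : R3 | t ≤ 2 * C₀ * N * ‖ξ‖} := by
      ext ξ
      rw [Set.mem_ofPred_eq, Set.mem_ofPred_eq, div_le_iff₀' (by positivity)]
    rw [hset, ← lintegral_indicator (by measurability)] at hw
    rw [← hw]
    have hsub : volume {x : R3 | t < ‖u x‖} ≤ volume {x : R3 | ENNReal.ofReal (t / 2) ^ 2 ≤ ‖w x‖ₑ ^ 2} := by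
      refine measure_mono_ae ?_
      have h := Lp.coeFn_add v w
      rw [← huvw] at h
      filter_upwards [h, hv] with x h1 h2 (h3 : t < ‖u x‖)
      change ENNReal.ofReal (t / 2) ^ 2 ≤ ‖w x‖ₑ ^ 2
      rw [h1, Pi.add_apply] at h3
      have h4 : (1 + ∫ ξ in Metric.ball (0 : R3) 1, ‖ξ‖⁻¹) / 2 * (t / (2 * C₀ * N)) * N = t / 2 := by
        rw [← hC₀]
        field_simp
      rw [h4] at h2
      have h5 : t / 2 ≤ ‖w x‖ := by linarith [norm_add_le (v x) (w x)]
      rw [← ofReal_norm]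
      gcongr
    have hch := mul_meas_ge_le_lintegral₀ (μ := (volume : Measure R3)) (f := fun x => ‖w x‖ₑ ^ 2)
      ((Lp.aestronglyMeasurable w).enorm.pow_const 2) (ENNReal.ofReal (t / 2) ^ 2)
    have ht2 : ENNReal.ofReal (t ^ ((3 : ℝ) - 1)) = 4 * ENNReal.ofReal (t / 2) ^ 2 := by
      rw [← ENNReal.ofReal_pow (by positivity), show (4 : ℝ≥0∞) = ENNReal.ofReal 4 by simp,
        ← ENNReal.ofReal_mul (by norm_num)]
      congr 1
      norm_num
      ring
    rw [ht2, mul_comm, mul_assoc]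
    gcongr
    exact (mul_le_mul_right hsub _).trans hch
  have hlayer := lintegral_rpow_eq_lintegral_meas_lt_mul (volume : Measure R3) (f := fun x => ‖u x‖)
    (ae_of_all _ fun x => norm_nonneg _) (Lp.aestronglyMeasurable u).norm.aemeasurable (p := 3) (by norm_num)
  have hl : ∫⁻ x, ‖u x‖ₑ ^ 3 = ∫⁻ x, ENNReal.ofReal (‖u x‖ ^ (3 : ℝ)) := by
    refine lintegral_congr fun x => ?_
    rw [← ofReal_norm, ← ENNReal.ofReal_pow (norm_nonneg _)]
    norm_cast
  rw [hl, hlayer]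
  -- By Tonelli, each `ξ` is counted for a set of levels `t` of length `2 C₀ N ‖ξ‖`; this reproduces
  -- the weight `‖ξ‖` of the hypothesis.
  have hswap : ∫⁻ t in Set.Ioi (0 : ℝ), ∫⁻ ξ, {ξ : R3 | t ≤ 2 * C₀ * N * ‖ξ‖}.indicator
      (fun ξ => ‖(𝓕 u : L2) ξ‖ₑ ^ 2) ξ ≤ ENNReal.ofReal (2 * C₀ * N ^ 3) := by
    rw [lintegral_lintegral_swap]
    · have hin : ∀ ξ : R3, ∫⁻ t in Set.Ioi (0 : ℝ), {ξ : R3 | t ≤ 2 * C₀ * N * ‖ξ‖}.indicator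
          (fun ξ => ‖(𝓕 u : L2) ξ‖ₑ ^ 2) ξ =
            ENNReal.ofReal (2 * C₀ * N) * (ENNReal.ofReal ‖ξ‖ * ‖(𝓕 u : L2) ξ‖ₑ ^ 2) := by
        intro ξ
        have : ∀ t, {ξ : R3 | t ≤ 2 * C₀ * N * ‖ξ‖}.indicator (fun ξ => ‖(𝓕 u : L2) ξ‖ₑ ^ 2) ξ =
            (Set.Iic (2 * C₀ * N * ‖ξ‖)).indicator (fun _ => ‖(𝓕 u : L2) ξ‖ₑ ^ 2) t := by
          intro t
          simp only [Set.indicator, Set.mem_ofPred_eq, Set.mem_Iic]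
        simp_rw [this]
        rw [lintegral_indicator measurableSet_Iic, lintegral_const, Measure.restrict_restrict measurableSet_Iic,
          Measure.restrict_apply_univ, Set.inter_comm, Set.Ioi_inter_Iic, Real.volume_Ioc, sub_zero,
          ENNReal.ofReal_mul (by positivity)]
        ring
      simp_rw [hin]
      rw [lintegral_const_mul' _ _ ENNReal.ofReal_ne_top]
      refine (mul_le_mul_right hu _).trans (le_of_eq ?_)
      rw [← ENNReal.ofReal_mul (by positivity)]
      congr 1
      ring
    · have h1 : AEMeasurable (fun p : ℝ × R3 => ‖(𝓕 u : L2) p.2‖ₑ ^ 2)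
          ((volume.restrict (Set.Ioi (0 : ℝ))).prod (volume : Measure R3)) :=
        ((Lp.aestronglyMeasurable (𝓕 u : L2)).enorm.pow_const 2).comp_quasiMeasurePreserving
          Measure.quasiMeasurePreserving_snd
      have h2 : MeasurableSet {p : ℝ × R3 | p.1 ≤ 2 * C₀ * N * ‖p.2‖} :=
        measurableSet_le (by fun_prop) (by fun_prop)
      exact h1.indicator h2
  have h3 : ENNReal.ofReal 3 = 3 := by simp
  calc _ ≤ ENNReal.ofReal 3 * ∫⁻ t in Set.Ioi (0 : ℝ), 4 * ∫⁻ ξ, {ξ : R3 | t ≤ 2 * C₀ * N * ‖ξ‖}.indicator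
          (fun ξ => ‖(𝓕 u : L2) ξ‖ₑ ^ 2) ξ := by
        exact mul_le_mul_right (setLIntegral_mono' measurableSet_Ioi hmeas) _
    _ = ENNReal.ofReal 3 * (4 * ∫⁻ t in Set.Ioi (0 : ℝ), ∫⁻ ξ, {ξ : R3 | t ≤ 2 * C₀ * N * ‖ξ‖}.indicator
          (fun ξ => ‖(𝓕 u : L2) ξ‖ₑ ^ 2) ξ) := by rw [lintegral_const_mul' _ _ (by simp)]
    _ ≤ ENNReal.ofReal 3 * (ENNReal.ofReal 4 * ENNReal.ofReal (2 * C₀ * N ^ 3)) := by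
        gcongr
        simp
    _ = _ := by
        rw [← ENNReal.ofReal_mul (by norm_num), ← ENNReal.ofReal_mul (by norm_num)]
        congr 1
        ring

/-! ### The norm of `E` on the Fourier side and its embeddings. -/

theorem lintegral_enorm_sq (g : L2) : ∫⁻ x, ‖g x‖ₑ ^ 2 = ENNReal.ofReal (‖g‖ ^ 2) := by
  rw [ENNReal.ofReal_pow (norm_nonneg _), ofReal_norm, Lp.enorm_def,
    eLpNorm_eq_lintegral_rpow_enorm_toReal (by simp) (by simp)]
  simp only [ENNReal.toReal_ofNat, ENNReal.rpow_ofNat, one_div]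
  rw [← ENNReal.rpow_natCast, ← ENNReal.rpow_mul]
  simp

theorem fourier_sqrtAbsDirac {a : ℝ} (u : E a) :
    (𝓕 (sqrtAbsDirac u) : L2) =ᵐ[volume] sqrtAbsFourier a (toL2 u) := by
  change (𝓕 (𝓕⁻ (MemLp.toLp (sqrtAbsFourier a (toL2 u)) (memLp_sqrtAbsFourier u)) : L2) : L2) =ᵐ[volume] _
  rw [FourierTransform.fourier_fourierInv_eq]
  exact MemLp.coeFn_toLp _

/-- This turns pointwise lower bounds for the symbol (`a` and `‖ξ‖`) into the embeddings of `E` in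
`L²` and `L³`. -/
theorem lintegral_absSymbol_mul {a : ℝ} (u : E a) :
    ∫⁻ ξ, ENNReal.ofReal (absSymbol a ξ) * ‖(𝓕 (toL2 u) : L2) ξ‖ₑ ^ 2 = ENNReal.ofReal (‖u‖ ^ 2) := by
  rw [norm_eq_norm_sqrtAbsDirac, ← Lp.norm_fourier_eq, ← lintegral_enorm_sq]
  refine lintegral_congr_ae ?_
  filter_upwards [fourier_sqrtAbsDirac u] with ξ hξ
  rw [hξ, sqrtAbsFourier, enorm_smul, mul_pow,
    ← ofReal_norm ((Real.sqrt (absSymbol a ξ) : ℝ) : ℂ), Complex.norm_real, Real.norm_of_nonneg (Real.sqrt_nonneg _),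
    ← ENNReal.ofReal_pow (Real.sqrt_nonneg _), Real.sq_sqrt (show 0 ≤ absSymbol a ξ from Real.sqrt_nonneg _)]

theorem le_absSymbol (a : ℝ) (ξ : R3) : a ≤ absSymbol a ξ :=
  Real.le_sqrt_of_sq_le (by nlinarith [sq_nonneg (2 * Real.pi * ‖ξ‖)])

theorem norm_le_absSymbol (a : ℝ) (ξ : R3) : ‖ξ‖ ≤ absSymbol a ξ := by
  refine Real.le_sqrt_of_sq_le ?_
  have h := Real.pi_gt_three
  have h2 : ‖ξ‖ ≤ 2 * Real.pi * ‖ξ‖ := by nlinarith [norm_nonneg ξ]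
  have h3 := pow_le_pow_left₀ (norm_nonneg ξ) h2 2
  nlinarith [sq_nonneg a]

theorem mul_norm_toL2_sq_le {a : ℝ} (ha : 0 ≤ a) (u : E a) : a * ‖toL2 u‖ ^ 2 ≤ ‖u‖ ^ 2 := by
  rw [← ENNReal.ofReal_le_ofReal_iff (by positivity), ENNReal.ofReal_mul ha, ← Lp.norm_fourier_eq,
    ← lintegral_enorm_sq, ← lintegral_absSymbol_mul, ← lintegral_const_mul' _ _ ENNReal.ofReal_ne_top]
  exact lintegral_mono fun ξ => mul_le_mul_left (ENNReal.ofReal_le_ofReal (le_absSymbol a ξ)) _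

theorem toL2_injective {a : ℝ} : Function.Injective (toL2 (a := a)) := Subtype.coe_injective

/-- The Sobolev embedding `E ⊆ L³`. -/
theorem exists_lintegral_toL2_cube_le (a : ℝ) : ∃ C : ℝ, 0 < C ∧ ∀ u : E a,
    ∫⁻ x, ‖toL2 u x‖ₑ ^ 3 ≤ ENNReal.ofReal (C * ‖u‖ ^ 3) := by
  obtain ⟨C, hC, h⟩ := exists_lintegral_enorm_cube_le
  refine ⟨C, hC, fun u => ?_⟩
  rcases eq_or_ne u 0 with rfl | hu
  · simp
  · refine h _ _ (norm_pos_iff.2 hu) ?_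
    rw [← lintegral_absSymbol_mul]
    exact lintegral_mono fun ξ => mul_le_mul_left (ENNReal.ofReal_le_ofReal (norm_le_absSymbol a ξ)) _

/-! ### The operator `sgn H₀` -/

theorem fourier_signL2 (a : ℝ) (u : L2) : (𝓕 (signL2 a u) : L2) =ᵐ[volume] signFourier a u := by
  rw [signL2, FourierTransform.fourier_fourierInv_eq]
  exact MemLp.coeFn_toLp _

theorem ext_fourier {u v : L2} (h : (𝓕 u : L2) =ᵐ[volume] (𝓕 v : L2)) : u = v :=
  (Lp.fourierTransformₗᵢ R3 Spinor).injective (Lp.ext h)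

theorem signL2_add (a : ℝ) (u v : L2) : signL2 a (u + v) = signL2 a u + signL2 a v := by
  refine ext_fourier ?_
  have h : ∀ u v : L2, (𝓕 (u + v) : L2) = 𝓕 u + 𝓕 v := FourierTransform.fourier_add
  filter_upwards [fourier_signL2 a (u + v), fourier_signL2 a u, fourier_signL2 a v,
    Lp.coeFn_add (𝓕 u : L2) (𝓕 v), Lp.coeFn_add (𝓕 (signL2 a u) : L2) (𝓕 (signL2 a v))] with ξ h1 h2 h3 h4 h5
  rw [h1, h, h5, Pi.add_apply, h2, h3, signFourier, signFourier, signFourier, h, h4, Pi.add_apply, map_add,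
    smul_add]

theorem signL2_smul (a : ℝ) (c : ℂ) (u : L2) : signL2 a (c • u) = c • signL2 a u := by
  refine ext_fourier ?_
  have h : ∀ u : L2, (𝓕 (c • u) : L2) = c • 𝓕 u := FourierTransform.fourier_smul c
  filter_upwards [fourier_signL2 a (c • u), fourier_signL2 a u,
    Lp.coeFn_smul c (𝓕 u : L2), Lp.coeFn_smul c (𝓕 (signL2 a u) : L2)] with ξ h1 h2 h3 h4
  rw [h1, h, h4, Pi.smul_apply, h2, signFourier, signFourier, h, h3, Pi.smul_apply, map_smul, smul_comm]

theorem norm_fourier_signL2 (a : ℝ) (u : L2) :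
    ∀ᵐ ξ ∂(volume : Measure R3), ‖(𝓕 (signL2 a u) : L2) ξ‖ = ‖(𝓕 u : L2) ξ‖ := by
  filter_upwards [fourier_signL2 a u, norm_signFourier a u] with ξ h1 h2
  rw [h1, h2]

theorem diracSymbol_diracSymbol (a : ℝ) (ξ : R3) (v : Spinor) :
    diracSymbol a ξ (diracSymbol a ξ v) = ((absSymbol a ξ ^ 2 : ℝ) : ℂ) • v := by
  rw [← mul_apply_eq_comp, diracSymbol, ← map_mul, diracMatrix_mul_self, map_smul, map_one]
  rfl

theorem signL2_signL2 (a : ℝ) (u : L2) : signL2 a (signL2 a u) = u := by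
  refine ext_fourier ?_
  filter_upwards [fourier_signL2 a (signL2 a u), fourier_signL2 a u, (volume : Measure R3).ae_ne 0] with ξ h1 h2 h0
  have hp := (absSymbol_pos a h0).ne'
  rw [h1, signFourier, h2, signFourier, map_smul, diracSymbol_diracSymbol, smul_smul, smul_smul,
    ← Complex.ofReal_mul, ← Complex.ofReal_mul]
  have : (absSymbol a ξ)⁻¹ * (absSymbol a ξ)⁻¹ * absSymbol a ξ ^ 2 = 1 := by field_simp
  rw [this, Complex.ofReal_one, one_smul]

theorem norm_signL2 (a : ℝ) (u : L2) : ‖signL2 a u‖ = ‖u‖ := by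
  rw [← sq_eq_sq₀ (norm_nonneg _) (norm_nonneg _), ← ENNReal.ofReal_eq_ofReal_iff (by positivity) (by positivity),
    ← Lp.norm_fourier_eq (signL2 a u), ← Lp.norm_fourier_eq u, ← lintegral_enorm_sq, ← lintegral_enorm_sq]
  refine lintegral_congr_ae ?_
  filter_upwards [norm_fourier_signL2 a u] with ξ h
  rw [← ofReal_norm, ← ofReal_norm, h]

theorem toL2_signDirac {a : ℝ} (u : E a) : toL2 (signDirac u) = signL2 a (toL2 u) := rfl

theorem signDirac_signDirac {a : ℝ} (u : E a) : signDirac (signDirac u) = u :=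
  toL2_injective (signL2_signL2 a (toL2 u))

theorem norm_signDirac {a : ℝ} (u : E a) : ‖signDirac u‖ = ‖u‖ := by
  rw [← sq_eq_sq₀ (norm_nonneg _) (norm_nonneg _), ← ENNReal.ofReal_eq_ofReal_iff (by positivity) (by positivity),
    ← lintegral_absSymbol_mul, ← lintegral_absSymbol_mul]
  refine lintegral_congr_ae ?_
  filter_upwards [norm_fourier_signL2 a (toL2 u)] with ξ h
  rw [toL2_signDirac, ← ofReal_norm, ← ofReal_norm, h]

theorem real_smul_eq_complex_smul {a : ℝ} (c : ℝ) (u : E a) : c • u = (c : ℂ) • u := rfl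

/-- `sgn H₀` as a real-linear isometry of `E`. -/
def signIsometry (a : ℝ) : E a →ₗᵢ[ℝ] E a where
  toFun := signDirac
  map_add' u v := toL2_injective (by
    rw [map_add, toL2_signDirac, toL2_signDirac, toL2_signDirac, map_add, signL2_add])
  map_smul' c u := toL2_injective (by
    rw [RingHom.id_apply, real_smul_eq_complex_smul, real_smul_eq_complex_smul, map_smul, toL2_signDirac,
      toL2_signDirac, map_smul, signL2_smul])
  norm_map' := norm_signDirac

theorem signIsometry_apply {a : ℝ} (u : E a) : signIsometry a u = signDirac u := rfl

/-- Polarization. The indefinite quadratic part becomes a bounded bilinear form on the diagonal,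
which is easy to differentiate. -/
theorem norm_specPos_sq_sub_norm_specNeg_sq {a : ℝ} (u : E a) :
    ‖specPos u‖ ^ 2 - ‖specNeg u‖ ^ 2 = inner ℝ u (signIsometry a u) := by
  rw [specPos, specNeg, norm_smul, norm_smul, mul_pow, mul_pow, norm_add_sq_real, norm_sub_sq_real,
    signIsometry_apply]
  norm_num
  ring

/-- The inclusion `E ⊆ L²` as a continuous real-linear map. -/
def toL2CLM {a : ℝ} (ha : 0 < a) : E a →L[ℝ] L2 :=
  LinearMap.mkContinuous ((toL2 (a := a)).restrictScalars ℝ) (Real.sqrt a)⁻¹ fun u => by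
    rw [inv_mul_eq_div, le_div_iff₀ (Real.sqrt_pos.2 ha), ← sq_le_sq₀ (by positivity) (norm_nonneg _), mul_pow,
      Real.sq_sqrt ha.le, mul_comm]
    exact mul_norm_toL2_sq_le ha.le u

theorem toL2CLM_apply {a : ℝ} (ha : 0 < a) (u : E a) : toL2CLM ha u = toL2 u := rfl

/-! ### The algebra of the currents -/

/-- The real bilinear form `Re (v, α_k w)` that polarizes `current k`. -/
def currentBilin (k : Fin 4) (v w : Spinor) : ℝ :=
  (inner ℂ v (Matrix.toEuclideanCLM (𝕜 := ℂ) (alpha k) w)).re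

theorem currentBilin_self (k : Fin 4) (w : Spinor) : currentBilin k w w = current k w := rfl

theorem alpha_isHermitian (k : Fin 4) : (alpha k).IsHermitian := by
  ext i j
  fin_cases k <;> fin_cases i <;> fin_cases j <;> simp [alpha]

theorem currentBilin_comm (k : Fin 4) (v w : Spinor) : currentBilin k v w = currentBilin k w v := by
  have hstar : star (Matrix.toEuclideanCLM (𝕜 := ℂ) (alpha k)) = Matrix.toEuclideanCLM (𝕜 := ℂ) (alpha k) := by
    rw [← map_star, Matrix.star_eq_conjTranspose, (alpha_isHermitian k).eq]
  rw [currentBilin, currentBilin, ← ContinuousLinearMap.adjoint_inner_left,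
    ← ContinuousLinearMap.star_eq_adjoint, hstar, ← inner_conj_symm, Complex.conj_re]

theorem currentBilin_add_left (k : Fin 4) (v v' w : Spinor) :
    currentBilin k (v + v') w = currentBilin k v w + currentBilin k v' w := by
  simp [currentBilin]

theorem currentBilin_smul_left (k : Fin 4) (c : ℝ) (v w : Spinor) :
    currentBilin k ((c : ℂ) • v) w = c * currentBilin k v w := by
  simp [currentBilin]

theorem currentBilin_add_right (k : Fin 4) (v w w' : Spinor) :
    currentBilin k v (w + w') = currentBilin k v w + currentBilin k v w' := by
  simp [currentBilin]

theorem currentBilin_smul_right (k : Fin 4) (c : ℝ) (v w : Spinor) :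
    currentBilin k v ((c : ℂ) • w) = c * currentBilin k v w := by
  simp [currentBilin]

theorem currentBilin_zero (v w : Spinor) : currentBilin 0 v w = (inner ℂ v w).re := by
  simp [currentBilin, alpha]

theorem current_zero (v : Spinor) : current 0 v = ‖v‖ ^ 2 := by
  rw [← currentBilin_self, currentBilin_zero, ← RCLike.re_eq_complex_re, inner_self_eq_norm_sq]

theorem continuous_currentBilin (k : Fin 4) :
    Continuous fun p : Spinor × Spinor => currentBilin k p.1 p.2 := by
  unfold currentBilin
  fun_prop

/-- For mass `0` the Dirac symbol at `x` is `-2π ∑ x_k α_k`, and it stretches every spinor by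
exactly `2π ‖x‖`; Cauchy–Schwarz finishes. -/
theorem sum_mul_current_le (x : R3) (w : Spinor) :
    |∑ k : Fin 3, x k * current k.succ w| ≤ ‖x‖ * ‖w‖ ^ 2 := by
  have h1 : (inner ℂ w (diracSymbol 0 x w)).re = -(2 * Real.pi) * ∑ k : Fin 3, x k * current k.succ w := by
    simp only [diracSymbol, diracMatrix, current, Fin.sum_univ_three, map_add, map_sub, map_smul, add_apply,
      sub_apply, smul_apply, inner_add_right, inner_sub_right, inner_smul_right]
    simp
    ring
  have h2 : ‖diracSymbol 0 x w‖ = 2 * Real.pi * ‖x‖ * ‖w‖ := by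
    have h : absSymbol 0 x = 2 * Real.pi * ‖x‖ := by
      rw [absSymbol, zero_pow (by norm_num), zero_add, Real.sqrt_sq (by positivity)]
    rw [norm_diracSymbol_apply, h]
  have h3 : |(inner ℂ w (diracSymbol 0 x w)).re| ≤ ‖w‖ * ‖diracSymbol 0 x w‖ :=
    (Complex.abs_re_le_norm _).trans (norm_inner_le_norm _ _)
  rw [h1, h2, abs_mul, abs_neg, abs_of_pos (by positivity)] at h3
  have hp := Real.pi_pos
  refine le_of_mul_le_mul_left (a := 2 * Real.pi) ?_ (by positivity)
  linarith

/-- `|J| ≤ J₀`. -/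
theorem sum_current_sq_le (v : Spinor) : ∑ k : Fin 3, current k.succ v ^ 2 ≤ ‖v‖ ^ 4 := by
  set x : R3 := WithLp.toLp 2 fun k : Fin 3 => current k.succ v with hx
  -- The vector `x` is the current of `v` itself, so the left side is `‖x‖²` and one factor `‖x‖`
  -- cancels.
  have h := sum_mul_current_le x v
  have h2 : ‖x‖ ^ 2 = ∑ k : Fin 3, current k.succ v ^ 2 := by
    rw [EuclideanSpace.norm_sq_eq]
    simp [hx]
  have h3 : ∑ k : Fin 3, x k * current k.succ v = ‖x‖ ^ 2 := by
    rw [h2]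
    simp [hx, sq]
  rw [h3, abs_of_nonneg (by positivity)] at h
  have h4 : ‖x‖ ≤ ‖v‖ ^ 2 := by
    rcases (norm_nonneg x).eq_or_lt with h0 | h0
    · rw [← h0]
      positivity
    · rw [sq] at h
      exact le_of_mul_le_mul_left h h0
  rw [← h2]
  calc ‖x‖ ^ 2 ≤ (‖v‖ ^ 2) ^ 2 := by gcongr
    _ = ‖v‖ ^ 4 := by ring

/-- The four-linear form `F` for which `Γ_ε(u) = ¼ ∬ ε² Q_ε(x) Q_ε(y) F(u(x), u(x), u(y), u(y)) / |x - y|`. -/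
def currentForm (v v' w w' : Spinor) : ℝ :=
  currentBilin 0 v v' * currentBilin 0 w w' -
    ∑ k : Fin 3, currentBilin k.succ v v' * currentBilin k.succ w w'

/-- The densities dominate: `J(v)·J(w) ≤ |J(v)| |J(w)| ≤ J₀(v) J₀(w)`. This fixes the sign of the
whole Maxwell term. -/
theorem currentForm_nonneg (v w : Spinor) : 0 ≤ currentForm v v w w := by
  set x : R3 := WithLp.toLp 2 fun k : Fin 3 => current k.succ v with hx
  have h := sum_mul_current_le x w
  have h2 : ‖x‖ ^ 2 = ∑ k : Fin 3, current k.succ v ^ 2 := by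
    rw [EuclideanSpace.norm_sq_eq]
    simp [hx]
  have h4 : ‖x‖ ≤ ‖v‖ ^ 2 := by
    rw [← sq_le_sq₀ (norm_nonneg _) (by positivity), h2]
    exact (sum_current_sq_le v).trans (le_of_eq (by ring))
  have h5 : ∑ k : Fin 3, currentBilin k.succ v v * currentBilin k.succ w w ≤ ‖v‖ ^ 2 * ‖w‖ ^ 2 :=
    (le_abs_self _).trans (h.trans (by gcongr))
  rw [currentForm, currentBilin_self, currentBilin_self, current_zero, current_zero]
  linarith

/-- The symmetric form `F(v, v, ·, ·)` is positive semidefinite; evaluate it at `s w - w'`. -/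
theorem currentForm_cauchySchwarz (v w w' : Spinor) (s : ℝ) :
    2 * s * currentForm v v w w' ≤ s ^ 2 * currentForm v v w w + currentForm v v w' w' := by
  have h := currentForm_nonneg v ((s : ℂ) • w + ((-1 : ℝ) : ℂ) • w')
  simp only [currentForm, currentBilin_add_left, currentBilin_add_right, currentBilin_smul_left,
    currentBilin_smul_right, Fin.sum_univ_three, currentBilin_comm _ w' w] at h ⊢
  linarith

theorem exists_abs_currentBilin_le : ∃ N : ℝ, 0 < N ∧ ∀ (k : Fin 4) (v w : Spinor),
    |currentBilin k v w| ≤ N * (‖v‖ * ‖w‖) := by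
  refine ⟨1 + ∑ k : Fin 4, ‖Matrix.toEuclideanCLM (𝕜 := ℂ) (alpha k)‖, by positivity, fun k v w => ?_⟩
  have hk : ‖Matrix.toEuclideanCLM (𝕜 := ℂ) (alpha k)‖ ≤
      1 + ∑ k : Fin 4, ‖Matrix.toEuclideanCLM (𝕜 := ℂ) (alpha k)‖ :=
    (Finset.single_le_sum (f := fun k => ‖Matrix.toEuclideanCLM (𝕜 := ℂ) (alpha k)‖)
      (fun _ _ => norm_nonneg _) (Finset.mem_univ k)).trans (by linarith)
  refine (Complex.abs_re_le_norm _).trans ((norm_inner_le_norm _ _).trans ?_)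
  refine (mul_le_mul_of_nonneg_left ((ContinuousLinearMap.le_opNorm _ _).trans
    (mul_le_mul_of_nonneg_right hk (norm_nonneg _))) (norm_nonneg _)).trans (le_of_eq ?_)
  ring

theorem exists_abs_currentBilin_mul_le : ∃ C : ℝ, 0 < C ∧ ∀ (k : Fin 4) (v v' w w' : Spinor),
    |currentBilin k v v' * currentBilin k w w'| ≤ C * (‖v‖ * ‖v'‖ * ‖w‖ * ‖w'‖) := by
  obtain ⟨N, hN, hb⟩ := exists_abs_currentBilin_le
  refine ⟨N ^ 2, by positivity, fun k v v' w w' => ?_⟩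
  rw [abs_mul]
  refine (mul_le_mul (hb k v v') (hb k w w') (abs_nonneg _) (by positivity)).trans (le_of_eq ?_)
  ring

theorem exists_abs_currentForm_le : ∃ C : ℝ, 0 < C ∧ ∀ v v' w w' : Spinor,
    |currentForm v v' w w'| ≤ C * (‖v‖ * ‖v'‖ * ‖w‖ * ‖w'‖) := by
  obtain ⟨C, hC, hp⟩ := exists_abs_currentBilin_mul_le
  refine ⟨4 * C, by positivity, fun v v' w w' => ?_⟩
  rw [currentForm]
  refine (abs_sub _ _).trans ?_
  refine (add_le_add (hp 0 v v' w w') ((Finset.abs_sum_le_sum_abs _ _).trans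
    (Finset.sum_le_sum fun k _ => hp k.succ v v' w w'))).trans (le_of_eq ?_)
  rw [Finset.sum_const, Finset.card_univ, Fintype.card_fin, nsmul_eq_mul]
  push_cast
  ring

/-! ### Coulomb integrals -/

theorem lintegral_norm_inv_sq_ball_lt_top (R : ℝ) :
    ∫⁻ x in Metric.ball (0 : R3) R, ENNReal.ofReal (‖x‖⁻¹ ^ 2) < ∞ := by
  refine lt_of_le_of_lt (lintegral_mono fun x => ?_) (integrableOn_norm_inv_pow 2 (by norm_num) R).2
  rw [← ofReal_norm, Real.norm_of_nonneg (by positivity)]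

/-- For `d < R`, factor `d⁻¹ r² ρ²` as `(r ρ)^{3/2}` times `(r ρ)^{1/2} d⁻¹` and apply Young with
weight `τ`, then split the remaining `r ρ` with weight `μ`. This leaves a product of cubes and the
kernel `d⁻²`, integrable near `0` in dimension three. For `d ≥ R` the kernel is at most `R⁻¹`. -/
theorem coulomb_pointwise_le {r ρ k τ μ R d : ℝ} (hr : 0 ≤ r) (hρ : 0 ≤ ρ) (hτ : 0 < τ) (hμ : 0 < μ)
    (hR : 0 < R) (hk : k = if d < R then d⁻¹ ^ 2 else 0) :
    d⁻¹ * (r ^ 2 * ρ ^ 2) ≤ τ / 2 * (r ^ 3 * ρ ^ 3) + (4 * τ)⁻¹ * (μ⁻¹ * (r ^ 2 * k) + μ * (ρ ^ 2 * k)) +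
      R⁻¹ * (r ^ 2 * ρ ^ 2) := by
  have h1 : 0 ≤ R⁻¹ * (r ^ 2 * ρ ^ 2) := by positivity
  by_cases h : d < R
  · rw [if_pos h] at hk
    subst hk
    set e := d⁻¹
    have h2 : r * ρ ≤ (μ⁻¹ * r ^ 2 + μ * ρ ^ 2) / 2 := by
      have : (μ⁻¹ * r ^ 2 + μ * ρ ^ 2) / 2 - r * ρ = μ⁻¹ * (r - μ * ρ) ^ 2 / 2 := by
        field_simp
        ring
      have h3 : 0 ≤ μ⁻¹ * (r - μ * ρ) ^ 2 / 2 := by positivity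
      linarith
    have h3 : e * (r ^ 2 * ρ ^ 2) ≤ τ / 2 * (r ^ 3 * ρ ^ 3) + (2 * τ)⁻¹ * (r * ρ * e ^ 2) := by
      have : τ / 2 * (r ^ 3 * ρ ^ 3) + (2 * τ)⁻¹ * (r * ρ * e ^ 2) - e * (r ^ 2 * ρ ^ 2) =
          r * ρ * (τ * r * ρ - e) ^ 2 / (2 * τ) := by
        field_simp
        ring
      have h4 : 0 ≤ r * ρ * (τ * r * ρ - e) ^ 2 / (2 * τ) := by positivity
      linarith
    have h4 : (2 * τ)⁻¹ * (r * ρ * e ^ 2) ≤ (2 * τ)⁻¹ * ((μ⁻¹ * r ^ 2 + μ * ρ ^ 2) / 2 * e ^ 2) := by gcongr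
    have h5 : (2 * τ)⁻¹ * ((μ⁻¹ * r ^ 2 + μ * ρ ^ 2) / 2 * e ^ 2) =
        (4 * τ)⁻¹ * (μ⁻¹ * (r ^ 2 * e ^ 2) + μ * (ρ ^ 2 * e ^ 2)) := by
      field_simp
      ring
    linarith
  · rw [if_neg h] at hk
    subst hk
    have h2 : d⁻¹ ≤ R⁻¹ := inv_anti₀ hR (not_lt.1 h)
    have h3 : 0 ≤ τ / 2 * (r ^ 3 * ρ ^ 3) := by positivity
    have h4 : d⁻¹ * (r ^ 2 * ρ ^ 2) ≤ R⁻¹ * (r ^ 2 * ρ ^ 2) := by gcongr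
    simp only [mul_zero, add_zero]
    linarith

/-- An additive form of Young's inequality for `∬ |f(x)|² |h(y)|² / |x - y|`. -/
theorem lintegral_coulomb_le {F : Type*} [NormedAddCommGroup F] {f h : R3 → F}
    (hf : AEStronglyMeasurable f volume) (hh : AEStronglyMeasurable h volume) {τ μ R : ℝ}
    (hτ : 0 < τ) (hμ : 0 < μ) (hR : 0 < R) :
    ∫⁻ z : R3 × R3, ENNReal.ofReal ‖z.1 - z.2‖⁻¹ * (‖f z.1‖ₑ ^ 2 * ‖h z.2‖ₑ ^ 2) ≤
      ENNReal.ofReal (τ / 2) * ((∫⁻ x, ‖f x‖ₑ ^ 3) * ∫⁻ x, ‖h x‖ₑ ^ 3) +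
      ENNReal.ofReal (4 * τ)⁻¹ * (ENNReal.ofReal μ⁻¹ * ((∫⁻ x, ‖f x‖ₑ ^ 2) *
          ∫⁻ x in Metric.ball (0 : R3) R, ENNReal.ofReal (‖x‖⁻¹ ^ 2)) +
        ENNReal.ofReal μ * ((∫⁻ x, ‖h x‖ₑ ^ 2) *
          ∫⁻ x in Metric.ball (0 : R3) R, ENNReal.ofReal (‖x‖⁻¹ ^ 2))) +
      ENNReal.ofReal R⁻¹ * ((∫⁻ x, ‖f x‖ₑ ^ 2) * ∫⁻ x, ‖h x‖ₑ ^ 2) := by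
  set k : R3 → ℝ := fun x => if ‖x‖ < R then ‖x‖⁻¹ ^ 2 else 0 with hk
  have hkm : Measurable fun x : R3 => ENNReal.ofReal (k x) :=
    (Measurable.ite (measurableSet_lt measurable_norm measurable_const) (by fun_prop) measurable_const).ennreal_ofReal
  have hkint : ∫⁻ x : R3, ENNReal.ofReal (k x) =
      ∫⁻ x in Metric.ball (0 : R3) R, ENNReal.ofReal (‖x‖⁻¹ ^ 2) := by
    rw [← lintegral_indicator measurableSet_ball]
    refine lintegral_congr fun x => ?_
    by_cases h : ‖x‖ < R
    · rw [Set.indicator_of_mem (by simpa using h), hk]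
      simp [h]
    · rw [Set.indicator_of_notMem (by simpa using h), hk]
      simp [h]
  have hfj : ∀ j : ℕ, AEMeasurable (fun x => ‖f x‖ₑ ^ j) volume := fun j => hf.enorm.pow_const j
  have hhj : ∀ j : ℕ, AEMeasurable (fun x => ‖h x‖ₑ ^ j) volume := fun j => hh.enorm.pow_const j
  have hf1 : ∀ j : ℕ, AEMeasurable (fun z : R3 × R3 => ‖f z.1‖ₑ ^ j) volume := fun j =>
    (hfj j).comp_quasiMeasurePreserving Measure.quasiMeasurePreserving_fst
  have hh2 : ∀ j : ℕ, AEMeasurable (fun z : R3 × R3 => ‖h z.2‖ₑ ^ j) volume := fun j =>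
    (hhj j).comp_quasiMeasurePreserving Measure.quasiMeasurePreserving_snd
  have hkz : Measurable fun z : R3 × R3 => ENNReal.ofReal (k (z.1 - z.2)) := hkm.comp (by fun_prop)
  have hfkm : AEMeasurable (fun z : R3 × R3 => ‖f z.1‖ₑ ^ 2 * ENNReal.ofReal (k (z.1 - z.2))) volume :=
    (hf1 2).mul hkz.aemeasurable
  have hhkm : AEMeasurable (fun z : R3 × R3 => ‖h z.2‖ₑ ^ 2 * ENNReal.ofReal (k (z.1 - z.2))) volume :=
    (hh2 2).mul hkz.aemeasurable
  have hfh : ∀ i j : ℕ, AEMeasurable (fun z : R3 × R3 => ‖f z.1‖ₑ ^ i * ‖h z.2‖ₑ ^ j) volume := fun i j =>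
    (hf1 i).mul (hh2 j)
  have hprod : ∀ i j : ℕ, ∫⁻ z : R3 × R3, ‖f z.1‖ₑ ^ i * ‖h z.2‖ₑ ^ j = (∫⁻ x, ‖f x‖ₑ ^ i) * ∫⁻ x, ‖h x‖ₑ ^ j :=
    fun i j => lintegral_prod_mul (hfj i) (hhj j)
  have hfk : ∫⁻ z : R3 × R3, ‖f z.1‖ₑ ^ 2 * ENNReal.ofReal (k (z.1 - z.2)) =
      (∫⁻ x, ‖f x‖ₑ ^ 2) * ∫⁻ x in Metric.ball (0 : R3) R, ENNReal.ofReal (‖x‖⁻¹ ^ 2) := by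
    rw [Measure.volume_eq_prod, lintegral_prod _ hfkm, ← hkint,
      ← lintegral_mul_const'' _ (hfj 2)]
    refine lintegral_congr fun x => ?_
    dsimp only
    rw [lintegral_const_mul' _ _ (ENNReal.pow_ne_top enorm_ne_top), lintegral_sub_left_eq_self (fun y => ENNReal.ofReal (k y)) x]
  have hhk : ∫⁻ z : R3 × R3, ‖h z.2‖ₑ ^ 2 * ENNReal.ofReal (k (z.1 - z.2)) =
      (∫⁻ x, ‖h x‖ₑ ^ 2) * ∫⁻ x in Metric.ball (0 : R3) R, ENNReal.ofReal (‖x‖⁻¹ ^ 2) := by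
    rw [Measure.volume_eq_prod, lintegral_prod_symm _ hhkm, ← hkint,
      ← lintegral_mul_const'' _ (hhj 2)]
    refine lintegral_congr fun x => ?_
    dsimp only
    rw [lintegral_const_mul' _ _ (ENNReal.pow_ne_top enorm_ne_top),
      lintegral_sub_right_eq_self (fun y => ENNReal.ofReal (k y)) x]
  rw [← hprod 3 3, ← hprod 2 2, ← hfk, ← hhk, ← lintegral_const_mul' _ _ ENNReal.ofReal_ne_top,
    ← lintegral_const_mul' _ _ ENNReal.ofReal_ne_top, ← lintegral_const_mul' _ _ ENNReal.ofReal_ne_top,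
    ← lintegral_const_mul' _ _ ENNReal.ofReal_ne_top,
    ← lintegral_add_left' (hfkm.const_mul _),
    ← lintegral_const_mul' _ _ ENNReal.ofReal_ne_top,
    ← lintegral_add_left' ((hfh 3 3).const_mul _),
    ← lintegral_add_right' _ ((hfh 2 2).const_mul _)]
  refine lintegral_mono fun z => ?_
  have hp := coulomb_pointwise_le (norm_nonneg (f z.1)) (norm_nonneg (h z.2)) hτ hμ hR (d := ‖z.1 - z.2‖) rfl
  have hk0 : 0 ≤ k (z.1 - z.2) := by
    simp only [hk]
    split_ifs <;> positivity
  change _ ≤ τ / 2 * (‖f z.1‖ ^ 3 * ‖h z.2‖ ^ 3) + (4 * τ)⁻¹ * (μ⁻¹ * (‖f z.1‖ ^ 2 * k (z.1 - z.2)) +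
    μ * (‖h z.2‖ ^ 2 * k (z.1 - z.2))) + R⁻¹ * (‖f z.1‖ ^ 2 * ‖h z.2‖ ^ 2) at hp
  have hp2 := ENNReal.ofReal_le_ofReal hp
  rw [ENNReal.ofReal_add (by positivity) (by positivity), ENNReal.ofReal_add (by positivity) (by positivity),
    ENNReal.ofReal_mul (p := (4 * τ)⁻¹) (by positivity), ENNReal.ofReal_add (by positivity) (by positivity),
    ENNReal.ofReal_mul (p := μ) (by positivity), ENNReal.ofReal_mul (p := μ⁻¹) (by positivity),
    ENNReal.ofReal_mul (p := R⁻¹) (by positivity), ENNReal.ofReal_mul (p := τ / 2) (by positivity),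
    ENNReal.ofReal_mul (p := ‖z.1 - z.2‖⁻¹) (by positivity)] at hp2
  repeat rw [ENNReal.ofReal_mul (by positivity)] at hp2
  simpa only [ENNReal.ofReal_pow (norm_nonneg _), ofReal_norm] using hp2

theorem lintegral_toL2_sq_le {a : ℝ} (ha : 0 < a) (u : E a) :
    ∫⁻ x, ‖toL2 u x‖ₑ ^ 2 ≤ ENNReal.ofReal (a⁻¹ * ‖u‖ ^ 2) := by
  rw [lintegral_enorm_sq]
  refine ENNReal.ofReal_le_ofReal ?_
  rw [inv_mul_eq_div, le_div_iff₀' ha]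
  exact mul_norm_toL2_sq_le ha.le u

theorem mul_le_weighted_sq {s p p' r r' : ℝ} (hs : 0 < s) :
    p * p' * r * r' ≤ s / 2 * (p ^ 2 * r ^ 2) + s⁻¹ / 2 * (p' ^ 2 * r' ^ 2) := by
  have h2 : s / 2 * (p ^ 2 * r ^ 2) + s⁻¹ / 2 * (p' ^ 2 * r' ^ 2) - p * p' * r * r' =
      s⁻¹ / 2 * (s * (p * r) - p' * r') ^ 2 := by
    field_simp
    ring
  have h3 : 0 ≤ s⁻¹ / 2 * (s * (p * r) - p' * r') ^ 2 := by positivity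
  linarith

theorem ofReal_mul_le_weighted_sq {s d p p' r r' : ℝ} (hs : 0 < s) (hd : 0 ≤ d) (hp : 0 ≤ p) (hp' : 0 ≤ p')
    (hr : 0 ≤ r) (hr' : 0 ≤ r') :
    ENNReal.ofReal d * ENNReal.ofReal (p * p' * r * r') ≤
      ENNReal.ofReal (s / 2) * (ENNReal.ofReal d * (ENNReal.ofReal p ^ 2 * ENNReal.ofReal r ^ 2)) +
      ENNReal.ofReal (s⁻¹ / 2) * (ENNReal.ofReal d * (ENNReal.ofReal p' ^ 2 * ENNReal.ofReal r' ^ 2)) := by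
  rw [← ENNReal.ofReal_pow hp, ← ENNReal.ofReal_pow hp', ← ENNReal.ofReal_pow hr, ← ENNReal.ofReal_pow hr']
  repeat rw [← ENNReal.ofReal_mul (by positivity)]
  rw [← ENNReal.ofReal_add (by positivity) (by positivity)]
  refine ENNReal.ofReal_le_ofReal ((mul_le_mul_of_nonneg_left (mul_le_weighted_sq hs) hd).trans (le_of_eq ?_))
  ring

theorem ofReal_weighted_sq_eq {C p p' r r' : ℝ} (hC : 0 < C) (hp : 0 < p) (hp' : 0 < p')
    (hr : 0 < r) (hr' : 0 < r') :
    ENNReal.ofReal (p' * r' / (p * r) / 2) * ENNReal.ofReal (C * (p ^ 2 * r ^ 2)) +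
      ENNReal.ofReal ((p' * r' / (p * r))⁻¹ / 2) * ENNReal.ofReal (C * (p' ^ 2 * r' ^ 2)) =
      ENNReal.ofReal (C * (p * p' * r * r')) := by
  rw [← ENNReal.ofReal_mul (by positivity), ← ENNReal.ofReal_mul (by positivity),
    ← ENNReal.ofReal_add (by positivity) (by positivity)]
  congr 1
  field_simp
  ring

theorem ae_prod_fst {p : R3 → Prop} (h : ∀ᵐ x ∂(volume : Measure R3), p x) :
    ∀ᵐ z : R3 × R3, p z.1 := Measure.quasiMeasurePreserving_fst.ae h

theorem aestronglyMeasurable_fst (f : L2) :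
    AEStronglyMeasurable (fun z : R3 × R3 => f z.1) (volume : Measure (R3 × R3)) :=
  (Lp.aestronglyMeasurable f).comp_quasiMeasurePreserving Measure.quasiMeasurePreserving_fst

theorem aestronglyMeasurable_snd (f : L2) :
    AEStronglyMeasurable (fun z : R3 × R3 => f z.2) (volume : Measure (R3 × R3)) :=
  (Lp.aestronglyMeasurable f).comp_quasiMeasurePreserving Measure.quasiMeasurePreserving_snd

/-- `∬ |u(x)|² |v(y)|² / |x - y| ≤ C ‖u‖² ‖v‖²` on `E`. -/
theorem exists_lintegral_coulomb_sq_le {a : ℝ} (ha : 0 < a) : ∃ C : ℝ, 0 < C ∧ ∀ u v : E a,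
    ∫⁻ z : R3 × R3, ENNReal.ofReal ‖z.1 - z.2‖⁻¹ * (‖toL2 u z.1‖ₑ ^ 2 * ‖toL2 v z.2‖ₑ ^ 2) ≤
      ENNReal.ofReal (C * (‖u‖ ^ 2 * ‖v‖ ^ 2)) := by
  obtain ⟨S, hS, hcube⟩ := exists_lintegral_toL2_cube_le a
  obtain ⟨K, hK, hKeq⟩ : ∃ K : ℝ, 0 ≤ K ∧
      ∫⁻ x in Metric.ball (0 : R3) 1, ENNReal.ofReal (‖x‖⁻¹ ^ 2) = ENNReal.ofReal K :=
    ⟨_, ENNReal.toReal_nonneg, (ENNReal.ofReal_toReal (lintegral_norm_inv_sq_ball_lt_top 1).ne).symm⟩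
  refine ⟨S ^ 2 / 2 + (4 : ℝ)⁻¹ * (2 * a⁻¹ * K) + a⁻¹ * a⁻¹, by positivity, fun u v => ?_⟩
  rcases eq_or_ne u 0 with rfl | hu
  · simp
  rcases eq_or_ne v 0 with rfl | hv
  · simp
  have hu' := norm_pos_iff.2 hu
  have hv' := norm_pos_iff.2 hv
  -- The choices of `τ` and `μ` make every term homogeneous of degree two in `‖u‖` and in `‖v‖`.
  refine (lintegral_coulomb_le (Lp.aestronglyMeasurable (toL2 u)) (Lp.aestronglyMeasurable (toL2 v))
    (τ := (‖u‖ * ‖v‖)⁻¹) (μ := ‖u‖ / ‖v‖) (R := 1) (by positivity) (by positivity) one_pos).trans ?_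
  rw [hKeq]
  have hu2 := lintegral_toL2_sq_le ha u
  have hv2 := lintegral_toL2_sq_le ha v
  have hu3 := hcube u
  have hv3 := hcube v
  calc _ ≤ ENNReal.ofReal ((‖u‖ * ‖v‖)⁻¹ / 2) * (ENNReal.ofReal (S * ‖u‖ ^ 3) * ENNReal.ofReal (S * ‖v‖ ^ 3)) +
      ENNReal.ofReal (4 * (‖u‖ * ‖v‖)⁻¹)⁻¹ * (ENNReal.ofReal (‖u‖ / ‖v‖)⁻¹ * (ENNReal.ofReal (a⁻¹ * ‖u‖ ^ 2) *
          ENNReal.ofReal K) +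
        ENNReal.ofReal (‖u‖ / ‖v‖) * (ENNReal.ofReal (a⁻¹ * ‖v‖ ^ 2) * ENNReal.ofReal K)) +
      ENNReal.ofReal (1 : ℝ)⁻¹ * (ENNReal.ofReal (a⁻¹ * ‖u‖ ^ 2) * ENNReal.ofReal (a⁻¹ * ‖v‖ ^ 2)) := by
        gcongr
    _ = _ := by
        repeat rw [← ENNReal.ofReal_mul (by positivity)]
        rw [← ENNReal.ofReal_add (by positivity) (by positivity), ← ENNReal.ofReal_mul (by positivity),
          ← ENNReal.ofReal_add (by positivity) (by positivity),
          ← ENNReal.ofReal_add (by positivity) (by positivity)]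
        congr 1
        field_simp
        ring

/-- `∬ |u(x)| |v(x)| |w(y)| |q(y)| / |x - y| ≤ C ‖u‖ ‖v‖ ‖w‖ ‖q‖` on `E`. -/
theorem exists_lintegral_coulomb_le {a : ℝ} (ha : 0 < a) : ∃ C : ℝ, 0 < C ∧ ∀ u v w q : E a,
    ∫⁻ z : R3 × R3, ENNReal.ofReal ‖z.1 - z.2‖⁻¹ *
      ENNReal.ofReal (‖toL2 u z.1‖ * ‖toL2 v z.1‖ * ‖toL2 w z.2‖ * ‖toL2 q z.2‖) ≤
      ENNReal.ofReal (C * (‖u‖ * ‖v‖ * ‖w‖ * ‖q‖)) := by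
  obtain ⟨C, hC, h⟩ := exists_lintegral_coulomb_sq_le ha
  refine ⟨C, hC, fun u v w q => ?_⟩
  by_cases h0 : ‖u‖ = 0 ∨ ‖v‖ = 0 ∨ ‖w‖ = 0 ∨ ‖q‖ = 0
  · simp only [norm_eq_zero] at h0
    rcases h0 with rfl | rfl | rfl | rfl <;> simp
  push Not at h0
  have hu : 0 < ‖u‖ := (norm_nonneg _).lt_of_ne' h0.1
  have hv : 0 < ‖v‖ := (norm_nonneg _).lt_of_ne' h0.2.1
  have hw : 0 < ‖w‖ := (norm_nonneg _).lt_of_ne' h0.2.2.1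
  have hq : 0 < ‖q‖ := (norm_nonneg _).lt_of_ne' h0.2.2.2
  -- This weight balances the pairs `(u, w)` and `(v, q)` in Young's inequality, so the bound
  -- becomes multilinear.
  obtain ⟨s, hs⟩ : ∃ s : ℝ, s = ‖v‖ * ‖q‖ / (‖u‖ * ‖w‖) := ⟨_, rfl⟩
  have hs0 : 0 < s := by rw [hs]; positivity
  have hm : ∀ f g : E a, AEMeasurable (fun z : R3 × R3 => ENNReal.ofReal ‖z.1 - z.2‖⁻¹ *
      (‖toL2 f z.1‖ₑ ^ 2 * ‖toL2 g z.2‖ₑ ^ 2)) volume := fun f g =>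
    (Measurable.ennreal_ofReal (by fun_prop)).aemeasurable.mul
      (((aestronglyMeasurable_fst (toL2 f)).enorm.pow_const 2).mul
        ((aestronglyMeasurable_snd (toL2 g)).enorm.pow_const 2))
  calc _ ≤ ∫⁻ z : R3 × R3, (ENNReal.ofReal (s / 2) * (ENNReal.ofReal ‖z.1 - z.2‖⁻¹ *
        (‖toL2 u z.1‖ₑ ^ 2 * ‖toL2 w z.2‖ₑ ^ 2)) + ENNReal.ofReal (s⁻¹ / 2) * (ENNReal.ofReal ‖z.1 - z.2‖⁻¹ *
        (‖toL2 v z.1‖ₑ ^ 2 * ‖toL2 q z.2‖ₑ ^ 2))) := by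
        refine lintegral_mono fun z => ?_
        simp only [← ofReal_norm]
        exact ofReal_mul_le_weighted_sq hs0 (inv_nonneg.2 (norm_nonneg _)) (norm_nonneg _) (norm_nonneg _)
          (norm_nonneg _) (norm_nonneg _)
    _ ≤ ENNReal.ofReal (s / 2) * ENNReal.ofReal (C * (‖u‖ ^ 2 * ‖w‖ ^ 2)) +
        ENNReal.ofReal (s⁻¹ / 2) * ENNReal.ofReal (C * (‖v‖ ^ 2 * ‖q‖ ^ 2)) := by
        rw [lintegral_add_left' ((hm u w).const_mul _), lintegral_const_mul' _ _ ENNReal.ofReal_ne_top,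
          lintegral_const_mul' _ _ ENNReal.ofReal_ne_top]
        gcongr
        · exact h u w
        · exact h v q
    _ = _ := by
        rw [hs]
        exact ofReal_weighted_sq_eq hC hu hv hw hq

/-! ### The Coulomb form on `E` and the functional `Γ_ε`. -/

/-- The kernel `ε² Q_ε(x) Q_ε(y) / |x - y|`. -/
def coulombKernel (Q : R3 → ℝ) (ε : ℝ) (z : R3 × R3) : ℝ :=
  ε ^ 2 * (Q (ε • z.1) * Q (ε • z.2)) * ‖z.1 - z.2‖⁻¹

theorem coulombKernel_swap (Q : R3 → ℝ) (ε : ℝ) (z : R3 × R3) :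
    coulombKernel Q ε z.swap = coulombKernel Q ε z := by
  rw [coulombKernel, coulombKernel, Prod.fst_swap, Prod.snd_swap, norm_sub_rev, mul_comm (Q (ε • z.2))]

theorem measurable_coulombKernel {Q : R3 → ℝ} (hQ : Continuous Q) (ε : ℝ) : Measurable (coulombKernel Q ε) := by
  unfold coulombKernel
  fun_prop

/-- Here `ε ≤ 1` absorbs the factor `ε²`; this makes the Coulomb constants uniform in `ε`. -/
theorem abs_coulombKernel_le {Q : R3 → ℝ} {M : ℝ} (hM : ∀ x, |Q x| ≤ M) {ε : ℝ} (hε : ε ∈ Set.Ioc (0 : ℝ) 1)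
    (z : R3 × R3) : |coulombKernel Q ε z| ≤ M ^ 2 * ‖z.1 - z.2‖⁻¹ := by
  have hM0 : 0 ≤ M := (abs_nonneg _).trans (hM 0)
  rw [coulombKernel, abs_mul, abs_mul, abs_mul, abs_of_nonneg (sq_nonneg ε),
    abs_of_nonneg (inv_nonneg.2 (norm_nonneg (z.1 - z.2)))]
  gcongr
  have h1 : ε ^ 2 ≤ 1 := pow_le_one₀ hε.1.le hε.2
  have h2 := mul_le_mul (hM (ε • z.1)) (hM (ε • z.2)) (abs_nonneg _) hM0
  calc _ ≤ 1 * (M * M) := by gcongr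
    _ = M ^ 2 := by ring

/-- Integrability of `ε² Q_ε(x) Q_ε(y) φ(x, y) / |x - y|` for `|φ(x, y)| ≤ D |u(x)| |v(x)| |w(y)| |q(y)|`. -/
theorem exists_integrable_coulombKernel_mul {a : ℝ} (ha : 0 < a) {Q : R3 → ℝ} (hQ : HypQ Q) :
    ∃ C : ℝ, 0 < C ∧ ∀ ε ∈ Set.Ioc (0 : ℝ) 1, ∀ (u v w q : E a) (D : ℝ) (φ : R3 × R3 → ℝ), 0 ≤ D →
      AEStronglyMeasurable φ volume →
      (∀ z, |φ z| ≤ D * (‖toL2 u z.1‖ * ‖toL2 v z.1‖ * ‖toL2 w z.2‖ * ‖toL2 q z.2‖)) →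
      Integrable (fun z => coulombKernel Q ε z * φ z) ∧
        |∫ z, coulombKernel Q ε z * φ z| ≤ C * D * (‖u‖ * ‖v‖ * ‖w‖ * ‖q‖) := by
  obtain ⟨C, hC, h⟩ := exists_lintegral_coulomb_le ha
  obtain ⟨hQc, ⟨M, hM⟩, -⟩ := hQ
  have hM0 : 0 ≤ M := (abs_nonneg _).trans (hM 0)
  refine ⟨(M ^ 2 + 1) * C, by positivity, fun ε hε u v w q D φ hD hφ hb => ?_⟩
  have hm : AEStronglyMeasurable (fun z => coulombKernel Q ε z * φ z) volume :=
    (measurable_coulombKernel hQc.continuous ε).aestronglyMeasurable.mul hφ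
  have hle : ∫⁻ z, ‖coulombKernel Q ε z * φ z‖ₑ ≤
      ENNReal.ofReal ((M ^ 2 + 1) * C * D * (‖u‖ * ‖v‖ * ‖w‖ * ‖q‖)) := by
    calc _ ≤ ∫⁻ z : R3 × R3, ENNReal.ofReal ((M ^ 2 + 1) * D) * (ENNReal.ofReal ‖z.1 - z.2‖⁻¹ *
          ENNReal.ofReal (‖toL2 u z.1‖ * ‖toL2 v z.1‖ * ‖toL2 w z.2‖ * ‖toL2 q z.2‖)) := by
          refine lintegral_mono fun z => ?_
          rw [← ENNReal.ofReal_mul (by positivity), ← ENNReal.ofReal_mul (by positivity), ← ofReal_norm,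
            Real.norm_eq_abs, abs_mul]
          refine ENNReal.ofReal_le_ofReal ?_
          have h1 : |coulombKernel Q ε z| ≤ (M ^ 2 + 1) * ‖z.1 - z.2‖⁻¹ :=
            (abs_coulombKernel_le hM hε z).trans (by gcongr; linarith)
          refine (mul_le_mul h1 (hb z) (abs_nonneg _) (by positivity)).trans (le_of_eq ?_)
          ring
      _ ≤ ENNReal.ofReal ((M ^ 2 + 1) * D) * ENNReal.ofReal (C * (‖u‖ * ‖v‖ * ‖w‖ * ‖q‖)) := by
          rw [lintegral_const_mul' _ _ ENNReal.ofReal_ne_top]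
          gcongr
          exact h u v w q
      _ = _ := by
          rw [← ENNReal.ofReal_mul (by positivity)]
          congr 1
          ring
  refine ⟨⟨hm, hle.trans_lt ENNReal.ofReal_lt_top⟩, ?_⟩
  rw [← Real.norm_eq_abs]
  refine (norm_integral_le_lintegral_norm _).trans ?_
  refine ENNReal.toReal_le_of_le_ofReal (by positivity) ?_
  simpa only [ofReal_norm] using hle

/-- `∬ ε² Q_ε(x) Q_ε(y) F(u(x), v(x), w(y), q(y)) / |x - y|`. -/
def coulombForm (Q : R3 → ℝ) (ε : ℝ) (u v w q : R3 → Spinor) : ℝ :=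
  ∫ z : R3 × R3, coulombKernel Q ε z * currentForm (u z.1) (v z.1) (w z.2) (q z.2)

theorem aestronglyMeasurable_currentBilin {X : Type*} [MeasurableSpace X] {ν : Measure X} (k : Fin 4)
    {f g : X → Spinor} (hf : AEStronglyMeasurable f ν) (hg : AEStronglyMeasurable g ν) :
    AEStronglyMeasurable (fun x => currentBilin k (f x) (g x)) ν :=
  Continuous.comp_aestronglyMeasurable (f := fun x => (f x, g x))
    (g := fun p : Spinor × Spinor => currentBilin k p.1 p.2) (continuous_currentBilin k) (hf.prodMk hg)

theorem aestronglyMeasurable_currentBilin_mul (k : Fin 4) (u v w q : L2) :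
    AEStronglyMeasurable (fun z : R3 × R3 => currentBilin k (u z.1) (v z.1) * currentBilin k (w z.2) (q z.2))
      volume :=
  (aestronglyMeasurable_currentBilin k (aestronglyMeasurable_fst u) (aestronglyMeasurable_fst v)).mul
    (aestronglyMeasurable_currentBilin k (aestronglyMeasurable_snd w) (aestronglyMeasurable_snd q))

theorem aestronglyMeasurable_currentForm (u v w q : L2) :
    AEStronglyMeasurable (fun z : R3 × R3 => currentForm (u z.1) (v z.1) (w z.2) (q z.2)) volume := by
  refine (aestronglyMeasurable_currentBilin_mul 0 u v w q).sub ?_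
  exact Finset.aestronglyMeasurable_fun_sum _ fun k _ => aestronglyMeasurable_currentBilin_mul k.succ u v w q

theorem exists_abs_coulombForm_le {a : ℝ} (ha : 0 < a) {Q : R3 → ℝ} (hQ : HypQ Q) :
    ∃ C : ℝ, 0 < C ∧ ∀ ε ∈ Set.Ioc (0 : ℝ) 1, ∀ u v w q : E a,
      Integrable (fun z : R3 × R3 => coulombKernel Q ε z *
        currentForm (toL2 u z.1) (toL2 v z.1) (toL2 w z.2) (toL2 q z.2)) ∧
      |coulombForm Q ε (toL2 u) (toL2 v) (toL2 w) (toL2 q)| ≤ C * (‖u‖ * ‖v‖ * ‖w‖ * ‖q‖) := by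
  obtain ⟨C, hC, h⟩ := exists_integrable_coulombKernel_mul ha hQ
  obtain ⟨D, hD, hb⟩ := exists_abs_currentForm_le
  exact ⟨C * D, by positivity, fun ε hε u v w q => h ε hε u v w q D _ hD.le
    (aestronglyMeasurable_currentForm (toL2 u) (toL2 v) (toL2 w) (toL2 q)) fun z => hb _ _ _ _⟩

theorem coulombForm_swap_left (Q : R3 → ℝ) (ε : ℝ) (u v w q : R3 → Spinor) :
    coulombForm Q ε u v w q = coulombForm Q ε v u w q := by
  simp only [coulombForm, currentForm, currentBilin_comm _ (u _) (v _)]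

theorem coulombForm_swap_right (Q : R3 → ℝ) (ε : ℝ) (u v w q : R3 → Spinor) :
    coulombForm Q ε u v w q = coulombForm Q ε u v q w := by
  simp only [coulombForm, currentForm, currentBilin_comm _ (w _) (q _)]

theorem coulombForm_swap (Q : R3 → ℝ) (ε : ℝ) (u v w q : R3 → Spinor) :
    coulombForm Q ε u v w q = coulombForm Q ε w q u v := by
  rw [coulombForm, coulombForm, Measure.volume_eq_prod, ← integral_prod_swap]
  refine integral_congr_ae (ae_of_all _ fun z => ?_)
  simp only [coulombKernel_swap, currentForm, Prod.fst_swap, Prod.snd_swap, mul_comm (currentBilin _ (w _) _)]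

/-- Fubini for each of the four currents separately, justified by absolute integrability of the
corresponding double integral. -/
theorem Gam_eq_coulombForm {a : ℝ} (ha : 0 < a) {Q : R3 → ℝ} (hQ : HypQ Q) {ε : ℝ}
    (hε : ε ∈ Set.Ioc (0 : ℝ) 1) (u : E a) :
    Gam Q ε (toL2 u) = 1 / 4 * coulombForm Q ε (toL2 u) (toL2 u) (toL2 u) (toL2 u) := by
  obtain ⟨C, hC, h⟩ := exists_integrable_coulombKernel_mul ha hQ
  obtain ⟨D, hD, hb⟩ := exists_abs_currentBilin_mul_le
  have hint : ∀ k : Fin 4, Integrable (fun z : R3 × R3 => coulombKernel Q ε z *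
      (currentBilin k (toL2 u z.1) (toL2 u z.1) * currentBilin k (toL2 u z.2) (toL2 u z.2))) := fun k =>
    (h ε hε u u u u D _ hD.le (aestronglyMeasurable_currentBilin_mul k (toL2 u) (toL2 u) (toL2 u) (toL2 u))
      fun z => hb k _ _ _ _).1
  have hk : ∀ k : Fin 4, ∫ x, Q (ε • x) * potential Q ε (toL2 u) k x * current k (toL2 u x) =
      ∫ z : R3 × R3, coulombKernel Q ε z *
      (currentBilin k (toL2 u z.1) (toL2 u z.1) * currentBilin k (toL2 u z.2) (toL2 u z.2)) := by
    intro k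
    rw [Measure.volume_eq_prod, integral_prod _ (hint k)]
    refine integral_congr_ae (ae_of_all _ fun x => ?_)
    simp only [potential]
    rw [← integral_const_mul, ← integral_const_mul, ← integral_mul_const]
    refine integral_congr_ae (ae_of_all _ fun y => ?_)
    simp only [coulombKernel, currentBilin_self]
    ring
  rw [Gam, hk]
  simp only [hk]
  rw [coulombForm, ← mul_sub, ← integral_finsetSum _ fun k _ => hint _, ← integral_sub (hint 0)
    (integrable_finsetSum _ fun k _ => hint _)]
  congr 2
  ext1 z
  rw [currentForm, mul_sub, Finset.mul_sum]

/-- `coulombForm` as a continuous four-linear form on `E`. -/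
theorem exists_coulombMultilinear {a : ℝ} (ha : 0 < a) {Q : R3 → ℝ} (hQ : HypQ Q) {ε : ℝ}
    (hε : ε ∈ Set.Ioc (0 : ℝ) 1) :
    ∃ B : ContinuousMultilinearMap ℝ (fun _ : Fin 4 => E a) ℝ, ∀ m : Fin 4 → E a,
      B m = coulombForm Q ε (toL2 (m 0)) (toL2 (m 1)) (toL2 (m 2)) (toL2 (m 3)) := by
  obtain ⟨C, hC, h⟩ := exists_abs_coulombForm_le ha hQ
  have hadd : ∀ u u' v w q : E a, coulombForm Q ε (toL2 (u + u')) (toL2 v) (toL2 w) (toL2 q) =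
      coulombForm Q ε (toL2 u) (toL2 v) (toL2 w) (toL2 q) +
        coulombForm Q ε (toL2 u') (toL2 v) (toL2 w) (toL2 q) := by
    intro u u' v w q
    rw [coulombForm, coulombForm, coulombForm, ← integral_add (h ε hε u v w q).1 (h ε hε u' v w q).1, map_add]
    refine integral_congr_ae ?_
    filter_upwards [ae_prod_fst (Lp.coeFn_add (toL2 u) (toL2 u'))] with z hz
    simp only [hz, Pi.add_apply, currentForm, currentBilin_add_left, Fin.sum_univ_three]
    ring
  have hsmul : ∀ (c : ℝ) (u v w q : E a), coulombForm Q ε (toL2 (c • u)) (toL2 v) (toL2 w) (toL2 q) =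
      c * coulombForm Q ε (toL2 u) (toL2 v) (toL2 w) (toL2 q) := by
    intro c u v w q
    rw [coulombForm, coulombForm, ← integral_const_mul, real_smul_eq_complex_smul, map_smul]
    refine integral_congr_ae ?_
    filter_upwards [ae_prod_fst (Lp.coeFn_smul (c : ℂ) (toL2 u))] with z hz
    simp only [hz, Pi.smul_apply, currentForm, currentBilin_smul_left, Fin.sum_univ_three]
    ring
  let B : MultilinearMap ℝ (fun _ : Fin 4 => E a) ℝ :=
    { toFun := fun m => coulombForm Q ε (toL2 (m 0)) (toL2 (m 1)) (toL2 (m 2)) (toL2 (m 3))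
      map_update_add' := by
        intro inst m i x y
        -- The decidability instance is arbitrary here; fixing it lets `Function.update` compute.
        -- The symmetries of the form then bring the active slot to the first place.
        obtain rfl : inst = instDecidableEqFin 4 := Subsingleton.elim _ _
        fin_cases i
        · simpa [Function.update] using hadd x y (m 1) (m 2) (m 3)
        · simpa [Function.update, coulombForm_swap_left Q ε (toL2 (m 0))] using hadd x y (m 0) (m 2) (m 3)
        · simpa [Function.update, coulombForm_swap Q ε (toL2 (m 0))] using hadd x y (m 3) (m 0) (m 1)
        · simpa [Function.update, coulombForm_swap Q ε (toL2 (m 0)), coulombForm_swap_left Q ε (toL2 (m 2))]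
            using hadd x y (m 2) (m 0) (m 1)
      map_update_smul' := by
        intro inst m i c x
        obtain rfl : inst = instDecidableEqFin 4 := Subsingleton.elim _ _
        fin_cases i
        · simpa [Function.update] using hsmul c x (m 1) (m 2) (m 3)
        · simpa [Function.update, coulombForm_swap_left Q ε (toL2 (m 0))] using hsmul c x (m 0) (m 2) (m 3)
        · simpa [Function.update, coulombForm_swap Q ε (toL2 (m 0))] using hsmul c x (m 3) (m 0) (m 1)
        · simpa [Function.update, coulombForm_swap Q ε (toL2 (m 0)), coulombForm_swap_left Q ε (toL2 (m 2))]
            using hsmul c x (m 2) (m 0) (m 1) }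
  refine ⟨B.mkContinuous C fun m => ?_, fun m => rfl⟩
  have := (h ε hε (m 0) (m 1) (m 2) (m 3)).2
  rw [Fin.prod_univ_four]
  exact this

/-- Chain rule for a four-linear form along the diagonal: by the symmetries the four partial
derivatives coincide, which cancels the factor `1 / 4`. -/
theorem exists_hasFDerivAt_Gam {a : ℝ} (ha : 0 < a) {Q : R3 → ℝ} (hQ : HypQ Q) {ε : ℝ}
    (hε : ε ∈ Set.Ioc (0 : ℝ) 1) (u : E a) :
    ∃ L : E a →L[ℝ] ℝ, HasFDerivAt (fun v : E a => Gam Q ε (toL2 v)) L u ∧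
      ∀ h, L h = coulombForm Q ε (toL2 u) (toL2 u) (toL2 u) (toL2 h) := by
  obtain ⟨B, hB⟩ := exists_coulombMultilinear ha hQ hε
  have hd : HasFDerivAt (fun v : E a => fun _ : Fin 4 => v)
      (ContinuousLinearMap.pi fun _ : Fin 4 => ContinuousLinearMap.id ℝ (E a)) u :=
    hasFDerivAt_pi.2 fun _ => hasFDerivAt_id u
  have h1 := ((B.hasFDerivAt (fun _ => u)).comp u hd).const_smul (1 / 4 : ℝ)
  refine ⟨_, h1.congr_of_eventuallyEq (Eventually.of_forall fun v => ?_), fun h => ?_⟩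
  · change Gam Q ε (toL2 v) = 1 / 4 * B fun _ => v
    rw [Gam_eq_coulombForm ha hQ hε, hB]
  · simp only [smul_apply, ContinuousLinearMap.comp_apply, ContinuousLinearMap.pi_apply,
      ContinuousMultilinearMap.linearDeriv_apply, Fin.sum_univ_four, hB]
    simp only [ContinuousLinearMap.id_apply, Function.update, smul_eq_mul]
    have e1 := coulombForm_swap Q ε (toL2 h) (toL2 u) (toL2 u) (toL2 u)
    have e2 := coulombForm_swap_left Q ε (toL2 u) (toL2 h) (toL2 u) (toL2 u)
    have e3 := coulombForm_swap_right Q ε (toL2 u) (toL2 u) (toL2 h) (toL2 u)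
    simp
    linarith

/-! ### The nonlinearity -/

theorem HypG2.pos {g : ℝ → ℝ} (hg : HypG2 g) {s : ℝ} (hs : 0 < s) : 0 < g s := by
  obtain ⟨σ, θ, c₀, -, hθ, hc, h⟩ := hg
  have h1 : 0 < c₀ * s ^ σ := mul_pos hc (Real.rpow_pos_of_pos hs _)
  have h2 := h1.trans_le ((h s hs).1.trans (h s hs).2)
  have h3 : 0 < g s * s ^ 2 := (pos_iff_pos_of_mul_pos h2).1 (by positivity)
  exact (pos_iff_pos_of_mul_pos h3).2 (by positivity)

theorem HypG1.monotoneOn {g : ℝ → ℝ} (hg : HypG1 g) (hg' : HypG2 g) : MonotoneOn g (Set.Ici 0) := by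
  have h : StrictMonoOn g (Set.Ioi 0) := strictMonoOn_of_deriv_pos (convex_Ioi 0) hg.2.1.continuousOn
    fun s hs => hg.2.2.1 s (by simpa using hs)
  intro s hs t ht hst
  rcases (Set.mem_Ici.1 hs).eq_or_lt with rfl | hs'
  · rw [hg.1]
    rcases (Set.mem_Ici.1 ht).eq_or_lt with rfl | ht'
    · rw [hg.1]
    · exact (hg'.pos ht').le
  · exact h.monotoneOn hs' (hs'.trans_le hst) hst

theorem HypG1.nonneg {g : ℝ → ℝ} (hg : HypG1 g) (hg' : HypG2 g) {s : ℝ} (hs : 0 ≤ s) : 0 ≤ g s := by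
  rw [← hg.1]
  exact hg.monotoneOn hg' Set.self_mem_Ici hs hs

theorem MonotoneOn.intervalIntegrable_mul_self {g : ℝ → ℝ} (hg : MonotoneOn g (Set.Ici 0)) {s t : ℝ}
    (hs : 0 ≤ s) (ht : 0 ≤ t) : IntervalIntegrable (fun x => g x * x) volume s t :=
  (hg.mono fun _ hx => (le_inf hs ht).trans hx.1).intervalIntegrable.mul_continuousOn continuousOn_id

theorem primitive_sub {g : ℝ → ℝ} (hg : MonotoneOn g (Set.Ici 0)) {s t : ℝ} (hs : 0 ≤ s) (ht : 0 ≤ t) :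
    primitive g t - primitive g s = ∫ x in s..t, g x * x :=
  intervalIntegral.integral_interval_sub_left (MonotoneOn.intervalIntegrable_mul_self hg le_rfl ht)
    (MonotoneOn.intervalIntegrable_mul_self hg le_rfl hs)

/-- The derivative `g(x) x` of `G` is nondecreasing on `[0, ∞)`, so `G` is convex there and lies
above its tangents. -/
theorem mul_sub_le_primitive_sub {g : ℝ → ℝ} (hg : MonotoneOn g (Set.Ici 0)) (hg0 : 0 ≤ g 0) {s t : ℝ}
    (hs : 0 ≤ s) (ht : 0 ≤ t) : g s * s * (t - s) ≤ primitive g t - primitive g s := by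
  have hpos : ∀ {x : ℝ}, 0 ≤ x → 0 ≤ g x := fun {x} hx => hg0.trans (hg Set.self_mem_Ici hx hx)
  rw [primitive_sub hg hs ht]
  rcases le_total s t with hst | hst
  · have h := intervalIntegral.integral_mono_on (f := fun _ => g s * s) hst intervalIntegrable_const
      (MonotoneOn.intervalIntegrable_mul_self hg hs ht) fun x hx =>
        mul_le_mul (hg hs (hs.trans hx.1) hx.1) hx.1 hs (hpos (hs.trans hx.1))
    rw [intervalIntegral.integral_const, smul_eq_mul] at h
    linarith
  · have h := intervalIntegral.integral_mono_on (g := fun _ => g s * s) hst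
      (MonotoneOn.intervalIntegrable_mul_self hg ht hs) intervalIntegrable_const fun x hx =>
        mul_le_mul (hg (ht.trans hx.1) hs hx.2) hx.2 (ht.trans hx.1) (hpos hs)
    rw [intervalIntegral.integral_const, smul_eq_mul] at h
    rw [intervalIntegral.integral_symm]
    linarith

theorem primitive_zero (g : ℝ → ℝ) : primitive g 0 = 0 := intervalIntegral.integral_same

theorem mul_sq_le_primitive {g : ℝ → ℝ} {γ : ℝ} (hg : MonotoneOn g (Set.Ici 0)) (hγ : ∀ s, 0 < s → γ ≤ g s)
    {s : ℝ} (hs : 0 < s) : γ * (s ^ 2 / 2) ≤ primitive g s := by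
  have h := intervalIntegral.integral_mono_on_of_le_Ioo (f := fun x => γ * x) (g := fun x => g x * x) hs.le
    (Continuous.intervalIntegrable (by fun_prop) _ _)
    (MonotoneOn.intervalIntegrable_mul_self hg le_rfl hs.le) fun x hx =>
      mul_le_mul_of_nonneg_right (hγ x hx.1) hx.1.le
  rw [intervalIntegral.integral_const_mul, integral_id] at h
  rw [primitive]
  linarith

/-- Under `(g₂)` the function `g` vanishes continuously at `0`. -/
theorem HypG1.exists_le_of_le {g : ℝ → ℝ} (hg : HypG1 g) (hg' : HypG2 g) {η : ℝ} (hη : 0 < η) :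
    ∃ δ : ℝ, 0 < δ ∧ ∀ s, 0 ≤ s → s ≤ δ → g s ≤ η := by
  have hmono := hg.monotoneOn hg'
  suffices h : ∃ δ, 0 < δ ∧ g δ ≤ η by
    obtain ⟨δ, hδ, h⟩ := h
    exact ⟨δ, hδ, fun s hs hsδ => (hmono hs hδ.le hsδ).trans h⟩
  by_contra! hcon
  obtain ⟨σ, θ, c₀, -, hθ, -, h⟩ := id hg'
  set γ := sInf (g '' Set.Ioi 0) with hγ
  have hbdd : BddBelow (g '' Set.Ioi 0) := ⟨0, by rintro _ ⟨s, hs, rfl⟩; exact (hg'.pos hs).le⟩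
  have hne : (g '' Set.Ioi (0 : ℝ)).Nonempty := ⟨g 1, 1, Set.mem_Ioi.2 one_pos, rfl⟩
  have hγη : η ≤ γ := le_csInf hne (by rintro _ ⟨s, hs, rfl⟩; exact (hcon s hs).le)
  have hγle : ∀ s, 0 < s → γ ≤ g s := fun s hs => csInf_le hbdd ⟨s, hs, rfl⟩
  -- A positive infimum improves itself: `γ s² / 2 ≤ G(s) ≤ g(s) s² / θ` gives `g ≥ γ θ / 2`
  -- everywhere, and `θ / 2 > 1`.
  have hge : γ * (θ / 2) ≤ γ := by
    refine le_csInf hne ?_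
    rintro _ ⟨s, hs, rfl⟩
    have h1 := (mul_sq_le_primitive hmono hγle hs).trans (h s hs).2
    have hs2 : 0 < s ^ 2 := pow_pos hs 2
    have h2 : 1 / θ * (g s * s ^ 2) = g s * s ^ 2 / θ := by ring
    rw [h2, le_div_iff₀ (by linarith)] at h1
    nlinarith
  nlinarith

theorem HypG1.continuousOn {g : ℝ → ℝ} (hg : HypG1 g) (hg' : HypG2 g) : ContinuousOn g (Set.Ici 0) := by
  intro s hs
  rcases (Set.mem_Ici.1 hs).eq_or_lt with rfl | hs'
  · rw [ContinuousWithinAt, hg.1, Metric.tendsto_nhdsWithin_nhds]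
    intro η hη
    obtain ⟨δ, hδ, h⟩ := hg.exists_le_of_le hg' (half_pos hη)
    refine ⟨δ, hδ, fun {s} hs hsδ => ?_⟩
    rw [dist_zero_right, Real.norm_eq_abs, abs_of_nonneg hs] at hsδ
    rw [dist_zero_right, Real.norm_eq_abs, abs_of_nonneg (hg.nonneg hg' hs)]
    linarith [h s hs hsδ.le]
  · exact (hg.2.1.continuousOn.continuousAt (Ioi_mem_nhds hs')).continuousWithinAt

theorem HypG1.exists_le_linear {g : ℝ → ℝ} (hg : HypG1 g) :
    ∃ C : ℝ, 0 < C ∧ ∀ s, 0 ≤ s → g s ≤ C * (1 + s) := by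
  obtain ⟨p, c, hp, hp3, hc, h⟩ := hg.2.2.2
  refine ⟨2 * c, by positivity, fun s hs => (h s hs).trans ?_⟩
  have h1 : s ^ (p - 2) ≤ 1 + s := by
    rcases le_total s 1 with h1 | h1
    · linarith [Real.rpow_le_one hs h1 (by linarith : 0 ≤ p - 2)]
    · have := Real.rpow_le_rpow_of_exponent_le h1 (by linarith : p - 2 ≤ 1)
      rw [Real.rpow_one] at this
      linarith
  nlinarith

/-- Subcriticality: `p < 3` makes `s^(p-2)` sublinear at infinity. -/
theorem HypG1.exists_le_mul {g : ℝ → ℝ} (hg : HypG1 g) {η : ℝ} (hη : 0 < η) :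
    ∃ M : ℝ, 0 < M ∧ ∀ s, M ≤ s → g s ≤ η * s := by
  obtain ⟨p, c, hp, hp3, hc, h⟩ := hg.2.2.2
  have h1 : (fun s : ℝ => c * (1 + s ^ (p - 2))) =o[atTop] fun s => s := by
    refine Asymptotics.IsLittleO.const_mul_left (Asymptotics.IsLittleO.add ?_ ?_) c
    · exact Asymptotics.isLittleO_const_id_atTop 1
    · refine Asymptotics.isLittleO_of_tendsto' ?_ ?_
      · filter_upwards [eventually_gt_atTop 0] with s hs h0
        exact absurd h0 hs.ne'
      · refine (tendsto_rpow_neg_atTop (by linarith : 0 < 3 - p)).congr' ?_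
        filter_upwards [eventually_gt_atTop 0] with s hs
        rw [← Real.rpow_sub_one hs.ne']
        congr 1
        ring
  obtain ⟨M, hM⟩ := eventually_atTop.1 (h1.bound hη)
  refine ⟨max M 1, by positivity, fun s hs => ?_⟩
  have hs0 : 0 ≤ s := by linarith [le_max_right M 1]
  have := hM s ((le_max_left M 1).trans hs)
  rw [Real.norm_eq_abs, Real.norm_eq_abs, abs_of_nonneg hs0] at this
  exact (h s hs0).trans ((le_abs_self _).trans this)

/-- The gradient `g(|z|) z` of `G(|z|)`. -/
def nonlin (g : ℝ → ℝ) (z : Spinor) : Spinor := ((g ‖z‖ : ℝ) : ℂ) • z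

theorem norm_nonlin {g : ℝ → ℝ} (hg : HypG1 g) (hg' : HypG2 g) (z : Spinor) :
    ‖nonlin g z‖ = g ‖z‖ * ‖z‖ := by
  rw [nonlin, norm_smul, Complex.norm_real, Real.norm_of_nonneg (hg.nonneg hg' (norm_nonneg z))]

theorem re_inner_nonlin (g : ℝ → ℝ) (z h : Spinor) :
    (inner ℂ (nonlin g z) h).re = g ‖z‖ * (inner ℂ z h).re := by
  rw [nonlin, inner_smul_left, Complex.conj_ofReal, Complex.re_ofReal_mul]

theorem continuous_nonlin {g : ℝ → ℝ} (hg : HypG1 g) (hg' : HypG2 g) : Continuous (nonlin g) := by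
  have h : Continuous fun z : Spinor => g ‖z‖ :=
    (hg.continuousOn hg').comp_continuous continuous_norm fun z => norm_nonneg z
  exact (Complex.continuous_ofReal.comp h).smul continuous_id

/-- The subgradient inequality for `G(|·|)` on spinors: convexity of `G`, Cauchy–Schwarz and `g ≥
0`. Used at both ends of a segment, it controls the Taylor remainder by the increment of the
gradient. -/
theorem mul_re_inner_le_primitive_sub {g : ℝ → ℝ} (hg : HypG1 g) (hg' : HypG2 g) (z w : Spinor) :
    g ‖z‖ * ((inner ℂ z w).re - ‖z‖ ^ 2) ≤ primitive g ‖w‖ - primitive g ‖z‖ := by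
  refine le_trans ?_ (mul_sub_le_primitive_sub (hg.monotoneOn hg') hg.1.ge (norm_nonneg z) (norm_nonneg w))
  have h1 : (inner ℂ z w).re ≤ ‖z‖ * ‖w‖ := (Complex.re_le_norm _).trans (norm_inner_le_norm _ _)
  have h2 := hg.nonneg hg' (norm_nonneg z)
  nlinarith

theorem re_inner_self (z : Spinor) : (inner ℂ z z).re = ‖z‖ ^ 2 := by
  rw [← RCLike.re_eq_complex_re, inner_self_eq_norm_sq]

/-- `G(|z + h|) - G(|z|) - Re (g(|z|) z, h)` lies between `0` and `|g(|z + h|)(z + h) - g(|z|) z| |h|`. -/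
theorem abs_primitive_add_sub_le {g : ℝ → ℝ} (hg : HypG1 g) (hg' : HypG2 g) (z h : Spinor) :
    |primitive g ‖z + h‖ - primitive g ‖z‖ - g ‖z‖ * (inner ℂ z h).re| ≤
      ‖nonlin g (z + h) - nonlin g z‖ * ‖h‖ := by
  have h1 := mul_re_inner_le_primitive_sub hg hg' z (z + h)
  have h2 := mul_re_inner_le_primitive_sub hg hg' (z + h) z
  rw [inner_add_right, Complex.add_re, re_inner_self] at h1
  have h3 : (inner ℂ (z + h) z).re = ‖z + h‖ ^ 2 - (inner ℂ (z + h) h).re := by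
    rw [← re_inner_self, inner_add_right (z + h), Complex.add_re]
    ring
  rw [h3] at h2
  have h4 : g ‖z + h‖ * (inner ℂ (z + h) h).re - g ‖z‖ * (inner ℂ z h).re ≤
      ‖nonlin g (z + h) - nonlin g z‖ * ‖h‖ := by
    rw [← re_inner_nonlin, ← re_inner_nonlin, ← Complex.sub_re, ← inner_sub_left]
    exact (Complex.re_le_norm _).trans (norm_inner_le_norm _ _)
  rw [abs_of_nonneg (by linarith)]
  linarith

/-- The map `g(|z|) z` is `o(|z|)` at `0`, `o(|z|²)` at infinity and uniformly continuous on compact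
sets in between, so its increments for small `h` cost only `η`. Increments with `|h|` bounded below
are charged to the second term. The powers match integrability in `L²` and `L³`. -/
theorem exists_norm_nonlin_sub_le {g : ℝ → ℝ} (hg : HypG1 g) (hg' : HypG2 g) {η : ℝ} (hη : 0 < η) :
    ∃ C : ℝ, 0 < C ∧ ∀ z h : Spinor, ‖nonlin g (z + h) - nonlin g z‖ ≤
      3 * η * (‖z‖ + ‖z‖ ^ 2) + C * (‖h‖ + ‖h‖ ^ 2) := by
  obtain ⟨δ, hδ, hsmall⟩ := hg.exists_le_of_le hg' hη
  obtain ⟨M, hM, hlarge⟩ := hg.exists_le_mul hη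
  have hcomp : IsCompact (Metric.closedBall (0 : Spinor) (M + 2)) := isCompact_closedBall _ _
  obtain ⟨d₀, hd₀, hunif⟩ := Metric.uniformContinuousOn_iff.1
    (hcomp.uniformContinuousOn_of_continuous (continuous_nonlin hg hg').continuousOn) (η * (δ / 2)) (by positivity)
  have hd : 0 < min d₀ (min (δ / 2) 1) := by positivity
  set d := min d₀ (min (δ / 2) 1) with hddef
  have hdd₀ : d ≤ d₀ := min_le_left _ _
  have hdδ : d ≤ δ / 2 := (min_le_right _ _).trans (min_le_left _ _)
  have hd1 : d ≤ 1 := (min_le_right _ _).trans (min_le_right _ _)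
  have hgM := hg.nonneg hg' hM.le
  have hall : ∀ y : Spinor, ‖nonlin g y‖ ≤ η * ‖y‖ ^ 2 + g M * M := by
    intro y
    rw [norm_nonlin hg hg']
    have hy := norm_nonneg y
    rcases le_total ‖y‖ M with h | h
    · have h2 : g ‖y‖ * ‖y‖ ≤ g M * M := mul_le_mul (hg.monotoneOn hg' hy hM.le h) h hy hgM
      have : 0 ≤ η * ‖y‖ ^ 2 := by positivity
      linarith
    · have h2 := mul_le_mul_of_nonneg_right (hlarge _ h) hy
      have : 0 ≤ g M * M := by positivity
      linarith
  -- When `‖h‖ ≥ d`, the two copies of the constant `g M * M` from `hall` are paid for by `2 * (g M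
  -- * M) / d * ‖h‖`.
  refine ⟨2 * η + 2 * (g M * M) / d, by positivity, fun z h => ?_⟩
  have hz := norm_nonneg z
  have hh := norm_nonneg h
  have hzh : ‖z + h‖ ≤ ‖z‖ + ‖h‖ := norm_add_le z h
  have hzh2 : ‖z + h‖ ^ 2 ≤ 2 * ‖z‖ ^ 2 + 2 * ‖h‖ ^ 2 := by
    have := pow_le_pow_left₀ (norm_nonneg (z + h)) hzh 2
    nlinarith [sq_nonneg (‖z‖ - ‖h‖)]
  have hηz : 0 ≤ η * ‖z‖ := by positivity
  have hηz2 : 0 ≤ η * ‖z‖ ^ 2 := by positivity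
  have hηh : 0 ≤ η * ‖h‖ := by positivity
  have hηh2 : 0 ≤ η * ‖h‖ ^ 2 := by positivity
  have hq : 0 ≤ 2 * (g M * M) / d := by positivity
  have hq1 : 0 ≤ 2 * (g M * M) / d * ‖h‖ := by positivity
  have hq2 : 0 ≤ 2 * (g M * M) / d * ‖h‖ ^ 2 := by positivity
  have htri := norm_sub_le (nonlin g (z + h)) (nonlin g z)
  rcases le_or_gt d ‖h‖ with hdh | hdh
  · have h1 : 2 * (g M * M) ≤ 2 * (g M * M) / d * ‖h‖ := by
      rw [div_mul_eq_mul_div, le_div_iff₀ hd]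
      exact mul_le_mul_of_nonneg_left hdh (by positivity)
    have h2 := mul_le_mul_of_nonneg_left hzh2 hη.le
    linarith [hall z, hall (z + h)]
  rcases le_or_gt ‖z‖ (δ / 2) with hzs | hzs
  · have h1 : ∀ y : Spinor, ‖y‖ ≤ δ → ‖nonlin g y‖ ≤ η * ‖y‖ := fun y hy => by
      rw [norm_nonlin hg hg']
      exact mul_le_mul_of_nonneg_right (hsmall _ (norm_nonneg y) hy) (norm_nonneg y)
    have h2 := mul_le_mul_of_nonneg_left hzh hη.le
    linarith [h1 z (by linarith), h1 (z + h) (by linarith)]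
  rcases le_or_gt (M + 1) ‖z‖ with hzl | hzl
  · have h1 : ∀ y : Spinor, M ≤ ‖y‖ → ‖nonlin g y‖ ≤ η * ‖y‖ ^ 2 := fun y hy => by
      rw [norm_nonlin hg hg', sq, ← mul_assoc]
      exact mul_le_mul_of_nonneg_right (hlarge _ hy) (norm_nonneg y)
    have h2 := mul_le_mul_of_nonneg_left hzh2 hη.le
    have h3 : ‖z‖ - ‖h‖ ≤ ‖z + h‖ := by
      have := norm_sub_norm_le z (-h)
      rwa [norm_neg, sub_neg_eq_add] at this
    linarith [h1 z (by linarith), h1 (z + h) (by linarith)]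
  · have h1 := hunif (z + h) (by rw [mem_closedBall_zero_iff]; linarith) z
      (by rw [mem_closedBall_zero_iff]; linarith) (by rw [dist_eq_norm, add_sub_cancel_left]; linarith)
    rw [dist_eq_norm] at h1
    have h2 := mul_le_mul_of_nonneg_left hzs.le hη.le
    linarith

theorem HypG2.primitive_nonneg {g : ℝ → ℝ} (hg' : HypG2 g) {s : ℝ} (hs : 0 ≤ s) : 0 ≤ primitive g s := by
  rcases hs.eq_or_lt with rfl | hs
  · rw [primitive_zero]
  · obtain ⟨σ, θ, c₀, -, -, hc, h⟩ := hg'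
    exact (by positivity : 0 ≤ c₀ * s ^ σ).trans (h s hs).1

theorem HypG2.two_mul_primitive_le {g : ℝ → ℝ} (hg' : HypG2 g) {s : ℝ} (hs : 0 ≤ s) :
    2 * primitive g s ≤ g s * s ^ 2 := by
  rcases hs.eq_or_lt with rfl | hs
  · simp [primitive_zero]
  · have hp := hg'.primitive_nonneg hs.le
    obtain ⟨σ, θ, c₀, -, hθ, hc, h⟩ := hg'
    have h1 := (h s hs).2
    have h2 : 1 / θ * (g s * s ^ 2) = g s * s ^ 2 / θ := by ring
    rw [h2, le_div_iff₀ (by linarith)] at h1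
    nlinarith

theorem continuous_primitive_norm {g : ℝ → ℝ} (hg : HypG1 g) (hg' : HypG2 g) :
    Continuous fun z : Spinor => primitive g ‖z‖ := by
  have hc : Continuous fun t : ℝ => g |t| :=
    (hg.continuousOn hg').comp_continuous continuous_abs fun t => abs_nonneg t
  have h : ∀ s, 0 ≤ s → primitive g s = ∫ t in (0 : ℝ)..s, g |t| * t := by
    intro s hs
    rw [primitive]
    refine intervalIntegral.integral_congr fun t ht => ?_
    rw [Set.uIcc_of_le hs] at ht
    simp only [abs_of_nonneg ht.1]
  simp_rw [fun z : Spinor => h ‖z‖ (norm_nonneg z)]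
  exact (intervalIntegral.continuous_primitive
    (fun a b => (hc.mul continuous_id).intervalIntegrable a b) 0).comp continuous_norm

/-! ### The functional `Ψ_ε` -/

theorem mul_le_weighted {s p r : ℝ} (hs : 0 < s) : p * r ≤ s * p ^ 2 + s⁻¹ * r ^ 2 := by
  have h : s * p ^ 2 + s⁻¹ * r ^ 2 - p * r = s⁻¹ * ((s * p - r) ^ 2 / 2 + (s * p) ^ 2 / 2 + r ^ 2 / 2) := by
    field_simp
    ring
  have h2 : 0 ≤ s⁻¹ * ((s * p - r) ^ 2 / 2 + (s * p) ^ 2 / 2 + r ^ 2 / 2) := by positivity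
  linarith

theorem sq_mul_le_weighted {s p r : ℝ} (hs : 0 < s) (hp : 0 ≤ p) (hr : 0 ≤ r) :
    p ^ 2 * r ≤ s * p ^ 3 + (s⁻¹) ^ 2 * r ^ 3 := by
  have h1 : 0 ≤ s * p ^ 3 := by positivity
  have h2 : 0 ≤ (s⁻¹) ^ 2 * r ^ 3 := by positivity
  rcases le_total r (s * p) with h | h
  · have := mul_le_mul_of_nonneg_left h (sq_nonneg p)
    nlinarith
  · have h3 : p ≤ s⁻¹ * r := by
      rw [inv_mul_eq_div, le_div_iff₀' hs]
      exact h
    have h4 := mul_le_mul_of_nonneg_right (pow_le_pow_left₀ hp h3 2) hr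
    have h5 : (s⁻¹ * r) ^ 2 * r = (s⁻¹) ^ 2 * r ^ 3 := by ring
    linarith

theorem integrable_and_integral_le_of_lintegral_le {X : Type*} [MeasurableSpace X] {ν : Measure X} {f : X → ℝ} {C : ℝ}
    (hf : AEStronglyMeasurable f ν) (hf0 : ∀ x, 0 ≤ f x) (hC : 0 ≤ C)
    (h : ∫⁻ x, ENNReal.ofReal (f x) ∂ν ≤ ENNReal.ofReal C) : Integrable f ν ∧ ∫ x, f x ∂ν ≤ C := by
  refine ⟨⟨hf, ?_⟩, ?_⟩
  · rw [hasFiniteIntegral_iff_ofReal (ae_of_all _ hf0)]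
    exact h.trans_lt ENNReal.ofReal_lt_top
  · rw [integral_eq_lintegral_of_nonneg_ae (ae_of_all _ hf0) hf]
    exact ENNReal.toReal_le_of_le_ofReal hC h

theorem exists_integral_sq_cube_le {a : ℝ} (ha : 0 < a) : ∃ C : ℝ, 0 < C ∧ ∀ u : E a,
    (Integrable (fun x => ‖toL2 u x‖ ^ 2) ∧ ∫ x, ‖toL2 u x‖ ^ 2 ≤ C * ‖u‖ ^ 2) ∧
    (Integrable (fun x => ‖toL2 u x‖ ^ 3) ∧ ∫ x, ‖toL2 u x‖ ^ 3 ≤ C * ‖u‖ ^ 3) := by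
  obtain ⟨S, hS, h⟩ := exists_lintegral_toL2_cube_le a
  refine ⟨S + a⁻¹, by positivity, fun u => ⟨?_, ?_⟩⟩
  · refine integrable_and_integral_le_of_lintegral_le ((Lp.aestronglyMeasurable (toL2 u)).norm.pow 2)
      (fun x => by positivity) (by positivity) ?_
    simp only [ENNReal.ofReal_pow (norm_nonneg _), ofReal_norm]
    exact (lintegral_toL2_sq_le ha u).trans (ENNReal.ofReal_le_ofReal (by gcongr; linarith))
  · refine integrable_and_integral_le_of_lintegral_le ((Lp.aestronglyMeasurable (toL2 u)).norm.pow 3)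
      (fun x => by positivity) (by positivity) ?_
    simp only [ENNReal.ofReal_pow (norm_nonneg _), ofReal_norm]
    exact (h u).trans (ENNReal.ofReal_le_ofReal (by gcongr; linarith [inv_pos.2 ha]))

theorem exists_integral_mul_le {a : ℝ} (ha : 0 < a) : ∃ C : ℝ, 0 < C ∧ ∀ u h : E a,
    (Integrable (fun x => ‖toL2 u x‖ * ‖toL2 h x‖) ∧ ∫ x, ‖toL2 u x‖ * ‖toL2 h x‖ ≤ C * (‖u‖ * ‖h‖)) ∧
    (Integrable (fun x => ‖toL2 u x‖ ^ 2 * ‖toL2 h x‖) ∧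
      ∫ x, ‖toL2 u x‖ ^ 2 * ‖toL2 h x‖ ≤ C * (‖u‖ ^ 2 * ‖h‖)) := by
  obtain ⟨C, hC, hb⟩ := exists_integral_sq_cube_le ha
  refine ⟨2 * C, by positivity, fun u h => ?_⟩
  rcases eq_or_ne u 0 with rfl | hu
  · simp
  rcases eq_or_ne h 0 with rfl | hh
  · simp
  have hu' := norm_pos_iff.2 hu
  have hh' := norm_pos_iff.2 hh
  obtain ⟨⟨hu2, hu2'⟩, hu3, hu3'⟩ := hb u
  obtain ⟨⟨hh2, hh2'⟩, hh3, hh3'⟩ := hb h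
  -- Young's inequality with this weight makes both bounds linear in `‖h‖`.
  have hs : 0 < ‖h‖ / ‖u‖ := by positivity
  have hmu := (Lp.aestronglyMeasurable (toL2 u)).norm
  have hmh := (Lp.aestronglyMeasurable (toL2 h)).norm
  have hi1 := (hu2.const_mul (‖h‖ / ‖u‖)).add (hh2.const_mul (‖h‖ / ‖u‖)⁻¹)
  have hi2 := (hu3.const_mul (‖h‖ / ‖u‖)).add (hh3.const_mul ((‖h‖ / ‖u‖)⁻¹ ^ 2))
  have hb1 : ∀ x, ‖toL2 u x‖ * ‖toL2 h x‖ ≤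
      ‖h‖ / ‖u‖ * ‖toL2 u x‖ ^ 2 + (‖h‖ / ‖u‖)⁻¹ * ‖toL2 h x‖ ^ 2 := fun x => mul_le_weighted hs
  have hb2 : ∀ x, ‖toL2 u x‖ ^ 2 * ‖toL2 h x‖ ≤
      ‖h‖ / ‖u‖ * ‖toL2 u x‖ ^ 3 + (‖h‖ / ‖u‖)⁻¹ ^ 2 * ‖toL2 h x‖ ^ 3 := fun x =>
    sq_mul_le_weighted hs (norm_nonneg _) (norm_nonneg _)
  have hI1 : Integrable (fun x => ‖toL2 u x‖ * ‖toL2 h x‖) :=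
    hi1.mono' (hmu.mul hmh) (ae_of_all _ fun x => by
      rw [Real.norm_of_nonneg (by positivity)]
      exact hb1 x)
  have hI2 : Integrable (fun x => ‖toL2 u x‖ ^ 2 * ‖toL2 h x‖) :=
    hi2.mono' ((hmu.pow 2).mul hmh) (ae_of_all _ fun x => by
      rw [Real.norm_of_nonneg (by positivity)]
      exact hb2 x)
  refine ⟨⟨hI1, (integral_mono hI1 hi1 hb1).trans ?_⟩, hI2, (integral_mono hI2 hi2 hb2).trans ?_⟩
  · simp only [Pi.add_apply]
    rw [integral_add (hu2.const_mul _) (hh2.const_mul _), integral_const_mul, integral_const_mul]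
    calc _ ≤ ‖h‖ / ‖u‖ * (C * ‖u‖ ^ 2) + (‖h‖ / ‖u‖)⁻¹ * (C * ‖h‖ ^ 2) := by gcongr
      _ = _ := by
        field_simp
        ring
  · simp only [Pi.add_apply]
    rw [integral_add (hu3.const_mul _) (hh3.const_mul _), integral_const_mul, integral_const_mul]
    calc _ ≤ ‖h‖ / ‖u‖ * (C * ‖u‖ ^ 3) + (‖h‖ / ‖u‖)⁻¹ ^ 2 * (C * ‖h‖ ^ 3) := by gcongr
      _ = _ := by
        field_simp
        ring

theorem integrable_weight_mul {P : R3 → ℝ} (hP : HypP P) (ε : ℝ) {f b : R3 → ℝ}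
    (hf : AEStronglyMeasurable f volume) (hb : Integrable b) (hfb : ∀ x, |f x| ≤ b x) {M : ℝ}
    (hM : ∀ x, |P x| ≤ M) :
    Integrable (fun x => P (ε • x) * f x) ∧ |∫ x, P (ε • x) * f x| ≤ M * ∫ x, b x := by
  have hM0 : 0 ≤ M := (abs_nonneg _).trans (hM 0)
  have hPc : Continuous fun x : R3 => P (ε • x) := hP.1.continuous.comp (continuous_const_smul ε)
  have hle : ∀ x, ‖P (ε • x) * f x‖ ≤ M * b x := fun x => by
    rw [Real.norm_eq_abs, abs_mul]
    exact mul_le_mul (hM _) (hfb x) (abs_nonneg _) hM0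
  refine ⟨(hb.const_mul M).mono' (hPc.aestronglyMeasurable.mul hf) (ae_of_all _ hle), ?_⟩
  rw [← integral_const_mul, ← Real.norm_eq_abs]
  exact norm_integral_le_of_norm_le (hb.const_mul M) (ae_of_all _ hle)

theorem aestronglyMeasurable_g_norm {g : ℝ → ℝ} (hg : HypG1 g) (hg' : HypG2 g) (u : L2) :
    AEStronglyMeasurable (fun x => g ‖u x‖) (volume : Measure R3) := by
  have h : Continuous fun z : Spinor => g ‖z‖ :=
    (hg.continuousOn hg').comp_continuous continuous_norm fun z => norm_nonneg z
  exact h.comp_aestronglyMeasurable (Lp.aestronglyMeasurable u)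

theorem aestronglyMeasurable_re_inner (u h : L2) :
    AEStronglyMeasurable (fun x => (inner ℂ (u x) (h x)).re) (volume : Measure R3) :=
  Complex.continuous_re.comp_aestronglyMeasurable
    ((Lp.aestronglyMeasurable u).inner (Lp.aestronglyMeasurable h))

theorem abs_g_mul_re_inner_le {g : ℝ → ℝ} (hg : HypG1 g) (hg' : HypG2 g) {C : ℝ}
    (hC : ∀ s, 0 ≤ s → g s ≤ C * (1 + s)) (z h : Spinor) :
    |g ‖z‖ * (inner ℂ z h).re| ≤ C * (‖z‖ * ‖h‖ + ‖z‖ ^ 2 * ‖h‖) := by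
  rw [abs_mul, abs_of_nonneg (hg.nonneg hg' (norm_nonneg z))]
  have h1 : |(inner ℂ z h).re| ≤ ‖z‖ * ‖h‖ := (Complex.abs_re_le_norm _).trans (norm_inner_le_norm _ _)
  have h2 := hC _ (norm_nonneg z)
  refine (mul_le_mul h2 h1 (abs_nonneg _) ((hg.nonneg hg' (norm_nonneg z)).trans h2)).trans (le_of_eq ?_)
  ring

theorem exists_integrable_Psi_deriv {a : ℝ} (ha : 0 < a) {g : ℝ → ℝ} (hg : HypG1 g) (hg' : HypG2 g)
    {P : R3 → ℝ} (hP : HypP P) : ∃ C : ℝ, 0 < C ∧ ∀ (ε : ℝ) (u h : E a),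
      Integrable (fun x => P (ε • x) * (g ‖toL2 u x‖ * (inner ℂ (toL2 u x) (toL2 h x)).re)) ∧
      |∫ x, P (ε • x) * (g ‖toL2 u x‖ * (inner ℂ (toL2 u x) (toL2 h x)).re)| ≤
        C * (‖u‖ + ‖u‖ ^ 2) * ‖h‖ := by
  obtain ⟨D, hD, hgD⟩ := hg.exists_le_linear
  obtain ⟨S, hS, hint⟩ := exists_integral_mul_le ha
  obtain ⟨M, hM⟩ := hP.2.1
  have hM0 : 0 ≤ M := (abs_nonneg _).trans (hM 0)
  refine ⟨(M + 1) * D * S, by positivity, fun ε u h => ?_⟩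
  obtain ⟨⟨h1, h1'⟩, h2, h2'⟩ := hint u h
  obtain ⟨h3, h4⟩ := integrable_weight_mul hP ε
    ((aestronglyMeasurable_g_norm hg hg' (toL2 u)).mul (aestronglyMeasurable_re_inner (toL2 u) (toL2 h)))
    ((h1.add h2).const_mul D) (fun x => abs_g_mul_re_inner_le hg hg' hgD (toL2 u x) (toL2 h x)) hM
  refine ⟨h3, h4.trans ?_⟩
  simp only [Pi.add_apply]
  rw [integral_const_mul, integral_add h1 h2]
  calc _ ≤ (M + 1) * (D * (S * (‖u‖ * ‖h‖) + S * (‖u‖ ^ 2 * ‖h‖))) := by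
        gcongr
        linarith
    _ = _ := by ring

/-- The derivative of `Ψ_ε` at `u`. -/
theorem exists_Psi_deriv {a : ℝ} (ha : 0 < a) {g : ℝ → ℝ} (hg : HypG1 g) (hg' : HypG2 g)
    {P : R3 → ℝ} (hP : HypP P) (ε : ℝ) (u : E a) : ∃ L : E a →L[ℝ] ℝ, ∀ h,
      L h = ∫ x, P (ε • x) * (g ‖toL2 u x‖ * (inner ℂ (toL2 u x) (toL2 h x)).re) := by
  obtain ⟨C, hC, hint⟩ := exists_integrable_Psi_deriv ha hg hg' hP
  let L : E a →ₗ[ℝ] ℝ :=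
    { toFun := fun h => ∫ x, P (ε • x) * (g ‖toL2 u x‖ * (inner ℂ (toL2 u x) (toL2 h x)).re)
      map_add' := fun h k => by
        rw [← integral_add (hint ε u h).1 (hint ε u k).1, map_add]
        refine integral_congr_ae ?_
        filter_upwards [Lp.coeFn_add (toL2 h) (toL2 k)] with x hx
        rw [hx, Pi.add_apply, inner_add_right, Complex.add_re]
        ring
      map_smul' := fun c h => by
        rw [RingHom.id_apply, smul_eq_mul, ← integral_const_mul, real_smul_eq_complex_smul, map_smul]
        refine integral_congr_ae ?_
        filter_upwards [Lp.coeFn_smul (c : ℂ) (toL2 h)] with x hx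
        rw [hx, Pi.smul_apply, inner_smul_right, Complex.re_ofReal_mul]
        ring }
  exact ⟨L.mkContinuous _ fun h => (hint ε u h).2, fun h => rfl⟩

theorem HypG2.exists_primitive_le {g : ℝ → ℝ} (hg : HypG1 g) (hg' : HypG2 g) : ∃ C : ℝ, 0 < C ∧
    ∀ s, 0 ≤ s → g s * s ^ 2 ≤ C * (s ^ 2 + s ^ 3) ∧ primitive g s ≤ C * (s ^ 2 + s ^ 3) := by
  obtain ⟨D, hD, h⟩ := hg.exists_le_linear
  refine ⟨D, hD, fun s hs => ?_⟩
  have h1 := mul_le_mul_of_nonneg_right (h s hs) (sq_nonneg s)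
  have h2 := hg'.two_mul_primitive_le hs
  have h3 := hg'.primitive_nonneg hs
  constructor <;> nlinarith

theorem integrable_primitive {a : ℝ} (ha : 0 < a) {g : ℝ → ℝ} (hg : HypG1 g) (hg' : HypG2 g) (u : E a) :
    Integrable (fun x => g ‖toL2 u x‖ * ‖toL2 u x‖ ^ 2) ∧ Integrable fun x => primitive g ‖toL2 u x‖ := by
  obtain ⟨C, hC, hb⟩ := exists_integral_sq_cube_le ha
  obtain ⟨D, hD, hgD⟩ := HypG2.exists_primitive_le hg hg'
  have hi := ((hb u).1.1.add (hb u).2.1).const_mul D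
  refine ⟨hi.mono' ((aestronglyMeasurable_g_norm hg hg' (toL2 u)).mul
    ((Lp.aestronglyMeasurable (toL2 u)).norm.pow 2)) (ae_of_all _ fun x => ?_),
    hi.mono' ((continuous_primitive_norm hg hg').comp_aestronglyMeasurable (Lp.aestronglyMeasurable (toL2 u)))
    (ae_of_all _ fun x => ?_)⟩
  · rw [Real.norm_of_nonneg (mul_nonneg (hg.nonneg hg' (norm_nonneg _)) (sq_nonneg _))]
    exact (hgD _ (norm_nonneg _)).1
  · rw [Real.norm_of_nonneg (hg'.primitive_nonneg (norm_nonneg _))]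
    exact (hgD _ (norm_nonneg _)).2

theorem integrable_mul_primitive {a : ℝ} (ha : 0 < a) {g : ℝ → ℝ} (hg : HypG1 g) (hg' : HypG2 g)
    {P : R3 → ℝ} (hP : HypP P) (ε : ℝ) (u : E a) :
    Integrable (fun x => P (ε • x) * (g ‖toL2 u x‖ * ‖toL2 u x‖ ^ 2)) ∧
      Integrable fun x => P (ε • x) * primitive g ‖toL2 u x‖ := by
  obtain ⟨M, hM⟩ := hP.2.1
  obtain ⟨h1, h2⟩ := integrable_primitive ha hg hg' u
  refine ⟨(integrable_weight_mul hP ε h1.aestronglyMeasurable h1.norm (fun x => le_rfl) hM).1,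
    (integrable_weight_mul hP ε h2.aestronglyMeasurable h2.norm (fun x => le_rfl) hM).1⟩

theorem Psi_remainder_aux {M S c D N I t r : ℝ} (hM : 0 ≤ M) (hS : 0 < S) (hc : 0 < c) (hD : 0 < D)
    (ht : 0 ≤ t) (hr : 0 ≤ r) (hN : N = (M + 1) * (3 * S * (t + t ^ 2 + 1)))
    (hI : I ≤ 3 * (c / N) * (S * (t * r) + S * (t ^ 2 * r)) + D * (S * (r * r) + S * (r ^ 2 * r))) :
    M * I ≤ (c + (M + 1) * (D * S) * (r + r ^ 2)) * r := by
  have hN0 : 0 < N := by rw [hN]; positivity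
  calc M * I ≤ M * (3 * (c / N) * (S * (t * r) + S * (t ^ 2 * r)) + D * (S * (r * r) + S * (r ^ 2 * r))) := by
        gcongr
    _ ≤ (M + 1) * (3 * (c / N) * (S * (t * r) + S * (t ^ 2 * r)) + D * (S * (r * r) + S * (r ^ 2 * r))) := by
        refine mul_le_mul_of_nonneg_right (by linarith) (by positivity)
    _ = (c / N * ((M + 1) * (3 * S * (t + t ^ 2)))) * r + (M + 1) * (D * S) * (r + r ^ 2) * r := by ring
    _ ≤ (c / N * N) * r + (M + 1) * (D * S) * (r + r ^ 2) * r := by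
        have h : (M + 1) * (3 * S * (t + t ^ 2)) ≤ N := by
          rw [hN]
          exact mul_le_mul_of_nonneg_left (mul_le_mul_of_nonneg_left (by linarith) (by positivity)) (by positivity)
        gcongr
    _ = _ := by
        rw [div_mul_cancel₀ _ hN0.ne']
        ring

-- Since `c` is arbitrary and `D` does not depend on `h`, this is Fréchet differentiability of `Ψ_ε`
-- in quantitative form.
set_option maxHeartbeats 1000000 in
theorem exists_abs_Psi_remainder_le {a : ℝ} (ha : 0 < a) {g : ℝ → ℝ} (hg : HypG1 g) (hg' : HypG2 g)
    {P : R3 → ℝ} (hP : HypP P) (ε : ℝ) (u : E a) {c : ℝ} (hc : 0 < c) : ∃ D : ℝ, 0 < D ∧ ∀ h : E a,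
      |Psi g P ε (toL2 (u + h)) - Psi g P ε (toL2 u) -
        ∫ x, P (ε • x) * (g ‖toL2 u x‖ * (inner ℂ (toL2 u x) (toL2 h x)).re)| ≤
        (c + D * (‖h‖ + ‖h‖ ^ 2)) * ‖h‖ := by
  obtain ⟨M, hM⟩ := hP.2.1
  have hM0 : 0 ≤ M := (abs_nonneg _).trans (hM 0)
  obtain ⟨S, hS, hint⟩ := exists_integral_mul_le ha
  obtain ⟨C, hC, hderiv⟩ := exists_integrable_Psi_deriv ha hg hg' hP
  -- With `η = c / N` the part of the remainder carrying `η` integrates to at most `c ‖h‖`. The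
  -- summands `1` keep `N` positive.
  obtain ⟨N, hN⟩ : ∃ N : ℝ, N = (M + 1) * (3 * S * (‖u‖ + ‖u‖ ^ 2 + 1)) := ⟨_, rfl⟩
  have hN0 : 0 < N := by rw [hN]; positivity
  obtain ⟨D, hD, hrem⟩ := exists_norm_nonlin_sub_le hg hg' (η := c / N) (by positivity)
  refine ⟨(M + 1) * (D * S), by positivity, fun h => ?_⟩
  obtain ⟨⟨h1, h1'⟩, h2, h2'⟩ := hint u h
  obtain ⟨⟨k1, k1'⟩, k2, k2'⟩ := hint h h
  have hi1 := (integrable_mul_primitive ha hg hg' hP ε (u + h)).2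
  have hi2 := (integrable_mul_primitive ha hg hg' hP ε u).2
  have hi3 := (hderiv ε u h).1
  have hi12 : Integrable (fun x => P (ε • x) * primitive g ‖toL2 (u + h) x‖ -
      P (ε • x) * primitive g ‖toL2 u x‖) := hi1.sub hi2
  rw [Psi, Psi, ← integral_sub hi1 hi2, ← integral_sub hi12 hi3]
  set b : R3 → ℝ := fun x => 3 * (c / N) * (‖toL2 u x‖ * ‖toL2 h x‖ + ‖toL2 u x‖ ^ 2 * ‖toL2 h x‖) +
    D * (‖toL2 h x‖ * ‖toL2 h x‖ + ‖toL2 h x‖ ^ 2 * ‖toL2 h x‖) with hb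
  have h12 : Integrable (fun x => ‖toL2 u x‖ * ‖toL2 h x‖ + ‖toL2 u x‖ ^ 2 * ‖toL2 h x‖) := h1.add h2
  have k12 : Integrable (fun x => ‖toL2 h x‖ * ‖toL2 h x‖ + ‖toL2 h x‖ ^ 2 * ‖toL2 h x‖) := k1.add k2
  have hbi : Integrable b := (h12.const_mul _).add (k12.const_mul _)
  have hle : ∀ᵐ x ∂(volume : Measure R3), ‖P (ε • x) * primitive g ‖toL2 (u + h) x‖ -
      P (ε • x) * primitive g ‖toL2 u x‖ -
      P (ε • x) * (g ‖toL2 u x‖ * (inner ℂ (toL2 u x) (toL2 h x)).re)‖ ≤ M * b x := by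
    have hadd := Lp.coeFn_add (toL2 u) (toL2 h)
    rw [← map_add] at hadd
    filter_upwards [hadd] with x hx
    rw [hx, Pi.add_apply, ← mul_sub, ← mul_sub, norm_mul, Real.norm_eq_abs, Real.norm_eq_abs]
    refine mul_le_mul (hM _) ((abs_primitive_add_sub_le hg hg' _ _).trans ?_) (abs_nonneg _) hM0
    refine (mul_le_mul_of_nonneg_right (hrem _ _) (norm_nonneg _)).trans (le_of_eq ?_)
    simp only [hb]
    ring
  rw [← Real.norm_eq_abs]
  refine (norm_integral_le_of_norm_le (hbi.const_mul M) hle).trans ?_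
  rw [integral_const_mul]
  have hbint : ∫ x, b x ≤ 3 * (c / N) * (S * (‖u‖ * ‖h‖) + S * (‖u‖ ^ 2 * ‖h‖)) +
      D * (S * (‖h‖ * ‖h‖) + S * (‖h‖ ^ 2 * ‖h‖)) := by
    simp only [hb]
    rw [integral_add (h12.const_mul _) (k12.const_mul _), integral_const_mul, integral_const_mul,
      integral_add h1 h2, integral_add k1 k2]
    gcongr
  exact Psi_remainder_aux hM0 hS hc hD (norm_nonneg u) (norm_nonneg h) hN hbint

theorem exists_hasFDerivAt_Psi {a : ℝ} (ha : 0 < a) {g : ℝ → ℝ} (hg : HypG1 g) (hg' : HypG2 g)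
    {P : R3 → ℝ} (hP : HypP P) (ε : ℝ) (u : E a) :
    ∃ L : E a →L[ℝ] ℝ, HasFDerivAt (fun v : E a => Psi g P ε (toL2 v)) L u ∧ ∀ h,
      L h = ∫ x, P (ε • x) * (g ‖toL2 u x‖ * (inner ℂ (toL2 u x) (toL2 h x)).re) := by
  obtain ⟨L, hL⟩ := exists_Psi_deriv ha hg hg' hP ε u
  refine ⟨L, ?_, hL⟩
  rw [hasFDerivAt_iff_isLittleO_nhds_zero, Asymptotics.isLittleO_iff]
  intro c hc
  obtain ⟨D, hD, hb⟩ := exists_abs_Psi_remainder_le ha hg hg' hP ε u (half_pos hc)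
  have hlim : Tendsto (fun h : E a => D * (‖h‖ + ‖h‖ ^ 2)) (𝓝 0) (𝓝 0) := by
    have h : Continuous fun h : E a => D * (‖h‖ + ‖h‖ ^ 2) := by fun_prop
    simpa using h.tendsto 0
  filter_upwards [hlim.eventually_lt_const (half_pos hc)] with h hh
  rw [hL, Real.norm_eq_abs]
  refine (hb h).trans ?_
  gcongr
  linarith

/-! ### The derivative of the energy functional -/

/-- Here `R` is the real `L²` pairing with `u`; only its value at `u` and the Cauchy–Schwarz bound
are needed later. -/
theorem exists_hasFDerivAt_quadratic {a : ℝ} (ha : 0 < a) (ω : ℝ) (u : E a) :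
    ∃ (L : E a →L[ℝ] ℝ) (R : E a → ℝ),
      HasFDerivAt (fun v : E a => (1 / 2) * (‖specPos v‖ ^ 2 - ‖specNeg v‖ ^ 2 - ω * ‖toL2 v‖ ^ 2)) L u ∧
      (∀ h, L h = (1 / 2) * (inner ℝ u (signIsometry a h) + inner ℝ h (signIsometry a u)) - ω * R h) ∧
      R u = ‖toL2 u‖ ^ 2 ∧ ∀ h, |R h| ≤ ‖toL2 u‖ * ‖toL2 h‖ := by
  have h1 : HasFDerivAt (fun v : E a => (inner ℝ v (signIsometry a v) : ℝ)) _ u :=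
    (hasFDerivAt_id u).inner ℝ (signIsometry a).toContinuousLinearMap.hasFDerivAt
  have h2 : HasFDerivAt (fun v : E a => ‖toL2CLM ha v‖ ^ 2) _ u := (toL2CLM ha).hasFDerivAt.norm_sq
  refine ⟨_, fun h => inner ℝ (toL2CLM ha u) (toL2CLM ha h),
    ((h1.sub (h2.const_mul ω)).const_mul (1 / 2)).congr_of_eventuallyEq
      (Eventually.of_forall fun v => ?_), fun h => ?_, ?_, fun h => abs_real_inner_le_norm _ _⟩
  · change _ = 1 / 2 * (inner ℝ v (signIsometry a v) - ω * ‖toL2CLM ha v‖ ^ 2)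
    rw [← norm_specPos_sq_sub_norm_specNeg_sq, toL2CLM_apply]
  · simp
    ring
  · exact real_inner_self_eq_norm_sq _

/-- The derivative of `Φ_ε` in the directions `u` and `(sgn H₀) u`. -/
theorem Phi_derivative {a : ℝ} (ha : 0 < a) (ω : ℝ) {g : ℝ → ℝ} (hg : HypG1 g) (hg' : HypG2 g)
    {Q P : R3 → ℝ} (hQ : HypQ Q) (hP : HypP P) {ε : ℝ} (hε : ε ∈ Set.Ioc (0 : ℝ) 1) (u : E a) :
    Phi a ω g Q P ε u - 1 / 2 * fderiv ℝ (Phi a ω g Q P ε) u u =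
        1 / 4 * coulombForm Q ε (toL2 u) (toL2 u) (toL2 u) (toL2 u) +
          (1 / 2 * (∫ x, P (ε • x) * (g ‖toL2 u x‖ * ‖toL2 u x‖ ^ 2)) - Psi g P ε (toL2 u)) ∧
      ‖u‖ ^ 2 - |ω| * ‖toL2 u‖ ^ 2 - coulombForm Q ε (toL2 u) (toL2 u) (toL2 u) (toL2 (signDirac u)) -
          ∫ x, P (ε • x) * (g ‖toL2 u x‖ * (inner ℂ (toL2 u x) (toL2 (signDirac u) x)).re) ≤
        fderiv ℝ (Phi a ω g Q P ε) u (signDirac u) := by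
  obtain ⟨L₁, R, h1, hL₁, hRu, hR⟩ := exists_hasFDerivAt_quadratic ha ω u
  obtain ⟨L₂, h2, hL₂⟩ := exists_hasFDerivAt_Gam ha hQ hε u
  obtain ⟨L₃, h3, hL₃⟩ := exists_hasFDerivAt_Psi ha hg hg' hP ε u
  have hfd : fderiv ℝ (Phi a ω g Q P ε) u = L₁ - L₂ - L₃ := ((h1.sub h2).sub h3).fderiv
  constructor
  · rw [hfd, sub_apply, sub_apply, hL₁, hL₂, hL₃, hRu, Phi, Gam_eq_coulombForm ha hQ hε,
      norm_specPos_sq_sub_norm_specNeg_sq]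
    simp only [re_inner_self]
    ring
  · rw [hfd, sub_apply, sub_apply, hL₁, hL₂, hL₃]
    -- As `sgn H₀` is an isometric involution, both halves of the derivative of the quadratic form
    -- contribute `‖u‖²`.
    have e1 : signIsometry a (signDirac u) = u := signDirac_signDirac u
    have e2 : inner ℝ (signDirac u) (signIsometry a u) = ‖u‖ ^ 2 := by
      rw [signIsometry_apply, real_inner_self_eq_norm_sq, norm_signDirac]
    have e3 : |R (signDirac u)| ≤ ‖toL2 u‖ ^ 2 := by
      refine (hR _).trans (le_of_eq ?_)
      rw [toL2_signDirac, norm_signL2, sq]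
    have e4 : ω * R (signDirac u) ≤ |ω| * ‖toL2 u‖ ^ 2 := by
      refine (le_abs_self _).trans ?_
      rw [abs_mul]
      gcongr
    rw [e1, e2, real_inner_self_eq_norm_sq]
    linarith

/-! ### Bounds for the Coulomb terms -/

theorem HypQ.nonneg {Q : R3 → ℝ} (hQ : HypQ Q) (x : R3) : 0 ≤ Q x := by
  have hc : IsClosed {x | 0 ≤ Q x} := isClosed_le continuous_const hQ.1.continuous
  have hd : Dense {x | 0 ≤ Q x} := Measure.dense_of_ae hQ.2.2
  exact hc.closure_subset (hd x)

theorem coulombKernel_nonneg {Q : R3 → ℝ} (hQ : HypQ Q) (ε : ℝ) (z : R3 × R3) : 0 ≤ coulombKernel Q ε z :=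
  mul_nonneg (mul_nonneg (sq_nonneg _) (mul_nonneg (hQ.nonneg _) (hQ.nonneg _))) (inv_nonneg.2 (norm_nonneg _))

theorem coulombForm_nonneg {Q : R3 → ℝ} (hQ : HypQ Q) (ε : ℝ) (u w : R3 → Spinor) :
    0 ≤ coulombForm Q ε u u w w :=
  integral_nonneg fun z => mul_nonneg (coulombKernel_nonneg hQ ε z) (currentForm_nonneg _ _)

/-- Integrates the pointwise inequality against the nonnegative kernel. The free parameter `s`
replaces square roots and is chosen proportional to `‖u‖²` later. -/
theorem coulombForm_cauchySchwarz {a : ℝ} (ha : 0 < a) {Q : R3 → ℝ} (hQ : HypQ Q) {ε : ℝ}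
    (hε : ε ∈ Set.Ioc (0 : ℝ) 1) (u w q : E a) (s : ℝ) :
    2 * s * coulombForm Q ε (toL2 u) (toL2 u) (toL2 w) (toL2 q) ≤
      s ^ 2 * coulombForm Q ε (toL2 u) (toL2 u) (toL2 w) (toL2 w) +
        coulombForm Q ε (toL2 u) (toL2 u) (toL2 q) (toL2 q) := by
  obtain ⟨C, hC, h⟩ := exists_abs_coulombForm_le ha hQ
  have i1 := (h ε hε u u w q).1
  have i2 := (h ε hε u u w w).1
  have i3 := (h ε hε u u q q).1
  rw [coulombForm, coulombForm, coulombForm, ← integral_const_mul, ← integral_const_mul,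
    ← integral_add (i2.const_mul _) i3]
  refine integral_mono (i1.const_mul _) ((i2.const_mul _).add i3) fun z => ?_
  have h1 := mul_le_mul_of_nonneg_left (currentForm_cauchySchwarz (toL2 u z.1) (toL2 w z.2) (toL2 q z.2) s)
    (coulombKernel_nonneg hQ ε z)
  dsimp only
  linarith

theorem exists_coulombForm_le_of_lintegral_le {a : ℝ} (ha : 0 < a) {Q : R3 → ℝ} (hQ : HypQ Q) :
    ∃ D : ℝ, 0 < D ∧ ∀ ε ∈ Set.Ioc (0 : ℝ) 1, ∀ (u w : E a) (C : ℝ), 0 ≤ C →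
      ∫⁻ z : R3 × R3, ENNReal.ofReal ‖z.1 - z.2‖⁻¹ * (‖toL2 u z.1‖ₑ ^ 2 * ‖toL2 w z.2‖ₑ ^ 2) ≤ ENNReal.ofReal C →
      coulombForm Q ε (toL2 u) (toL2 u) (toL2 w) (toL2 w) ≤ D * C := by
  obtain ⟨M, hM⟩ := hQ.2.1
  have hM0 : 0 ≤ M := (abs_nonneg _).trans (hM 0)
  obtain ⟨N, hN, hform⟩ := exists_abs_currentForm_le
  obtain ⟨_, -, hint⟩ := exists_abs_coulombForm_le ha hQ
  refine ⟨(M ^ 2 + 1) * N, by positivity, fun ε hε u w C hC hle => ?_⟩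
  rw [coulombForm, integral_eq_lintegral_of_nonneg_ae (ae_of_all _ fun z => mul_nonneg
    (coulombKernel_nonneg hQ ε z) (currentForm_nonneg _ _)) (hint ε hε u u w w).1.aestronglyMeasurable]
  refine ENNReal.toReal_le_of_le_ofReal (by positivity) ?_
  rw [ENNReal.ofReal_mul (by positivity)]
  refine le_trans ?_ (mul_le_mul_right hle _)
  rw [← lintegral_const_mul' _ _ ENNReal.ofReal_ne_top]
  refine lintegral_mono fun z => ?_
  simp only [← ofReal_norm, ← ENNReal.ofReal_pow (norm_nonneg _)]
  rw [← ENNReal.ofReal_mul (by positivity), ← ENNReal.ofReal_mul (by positivity), ← ENNReal.ofReal_mul (by positivity)]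
  refine ENNReal.ofReal_le_ofReal ?_
  have h1 : coulombKernel Q ε z ≤ (M ^ 2 + 1) * ‖z.1 - z.2‖⁻¹ :=
    ((le_abs_self _).trans (abs_coulombKernel_le hM hε z)).trans (by gcongr; linarith)
  have h2 := (le_abs_self _).trans (hform (toL2 u z.1) (toL2 u z.1) (toL2 w z.2) (toL2 w z.2))
  refine (mul_le_mul h1 h2 (currentForm_nonneg _ _) (by positivity)).trans (le_of_eq ?_)
  ring

theorem lintegral_coulomb_le_of_le {F : Type*} [NormedAddCommGroup F] {f h : R3 → F}
    (hf : AEStronglyMeasurable f volume) (hh : AEStronglyMeasurable h volume) {τ μ R F₂ F₃ H₂ H₃ K : ℝ}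
    (hτ : 0 < τ) (hμ : 0 < μ) (hR : 0 < R) (hF₂ : 0 ≤ F₂) (hF₃ : 0 ≤ F₃) (hH₂ : 0 ≤ H₂) (hH₃ : 0 ≤ H₃) (hK : 0 ≤ K)
    (h₁ : ∫⁻ x, ‖f x‖ₑ ^ 2 ≤ ENNReal.ofReal F₂) (h₂ : ∫⁻ x, ‖f x‖ₑ ^ 3 ≤ ENNReal.ofReal F₃)
    (h₃ : ∫⁻ x, ‖h x‖ₑ ^ 2 ≤ ENNReal.ofReal H₂) (h₄ : ∫⁻ x, ‖h x‖ₑ ^ 3 ≤ ENNReal.ofReal H₃)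
    (h₅ : ∫⁻ x in Metric.ball (0 : R3) R, ENNReal.ofReal (‖x‖⁻¹ ^ 2) ≤ ENNReal.ofReal K) :
    ∫⁻ z : R3 × R3, ENNReal.ofReal ‖z.1 - z.2‖⁻¹ * (‖f z.1‖ₑ ^ 2 * ‖h z.2‖ₑ ^ 2) ≤
      ENNReal.ofReal (τ / 2 * (F₃ * H₃) + (4 * τ)⁻¹ * (μ⁻¹ * (F₂ * K) + μ * (H₂ * K)) + R⁻¹ * (F₂ * H₂)) := by
  refine (lintegral_coulomb_le hf hh hτ hμ hR).trans ?_
  rw [ENNReal.ofReal_add (by positivity) (by positivity), ENNReal.ofReal_add (by positivity) (by positivity),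
    ENNReal.ofReal_mul (p := (4 * τ)⁻¹) (by positivity), ENNReal.ofReal_add (by positivity) (by positivity)]
  repeat rw [ENNReal.ofReal_mul (by positivity)]
  gcongr

/-- Each of the two cut parts receives `η t⁴ / 2`. The terms with the fixed bound `A` grow only like
`t²`, and `T ≤ t²` absorbs them. -/
theorem coulomb_constants_le {η C B A R τ₁ m τ₂ μ T t : ℝ} (hη : 0 < η) (hC : 0 < C) (hB : 0 < B) (hA : 0 ≤ A)
    (hR : R = 6 * C ^ 2 / η) (hτ₁ : τ₁ = 3 * B * C / η) (hm : m = η / (3 * τ₁ * C ^ 2)) (hτ₂ : τ₂ = η / (3 * C ^ 2))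
    (hμ : μ = η * τ₂ / (3 * B * C)) (hT : T = 1 + 3 * (μ⁻¹ * A * B) / (τ₂ * η) + A / C) (hT1 : 1 ≤ T) (htu : T ≤ t) :
    τ₁ / t ^ 2 / 2 * (m * C * t ^ 3 * (C * t ^ 3)) + (4 * (τ₁ / t ^ 2))⁻¹ * (1⁻¹ * (C * t ^ 2 * B) +
      1 * (C * t ^ 2 * B)) + R⁻¹ * (C * t ^ 2 * (C * t ^ 2)) +
      (τ₂ / t ^ 2 / 2 * (C * t ^ 3 * (C * t ^ 3)) + (4 * (τ₂ / t ^ 2))⁻¹ * (μ⁻¹ * (A * B) +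
      μ * (C * t ^ 2 * B)) + R⁻¹ * (A * (C * t ^ 2))) ≤ η * t ^ 4 := by
  have ht1 : 1 ≤ t := hT1.trans htu
  have ht0 : 0 < t := by linarith
  have hτ₁0 : 0 < τ₁ := by rw [hτ₁]; positivity
  have hτ₂0 : 0 < τ₂ := by rw [hτ₂]; positivity
  have hμ0 : 0 < μ := by rw [hμ]; positivity
  have e1 : τ₁ / t ^ 2 / 2 * (m * C * t ^ 3 * (C * t ^ 3)) + (4 * (τ₁ / t ^ 2))⁻¹ * (1⁻¹ * (C * t ^ 2 * B) +
      1 * (C * t ^ 2 * B)) + R⁻¹ * (C * t ^ 2 * (C * t ^ 2)) = η / 2 * t ^ 4 := by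
    rw [hm, hR, hτ₁]
    field_simp
    ring
  have e2 : τ₂ / t ^ 2 / 2 * (C * t ^ 3 * (C * t ^ 3)) + (4 * (τ₂ / t ^ 2))⁻¹ * (μ⁻¹ * (A * B) +
      μ * (C * t ^ 2 * B)) + R⁻¹ * (A * (C * t ^ 2)) =
      η / 6 * t ^ 4 + μ⁻¹ * A * B / (4 * τ₂) * t ^ 2 + η / 12 * t ^ 4 + A / C * (η / 6) * t ^ 2 := by
    have h1 : μ * (C * t ^ 2 * B) = η * τ₂ / 3 * t ^ 2 := by
      rw [hμ]
      field_simp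
    have h2 : τ₂ / t ^ 2 / 2 * (C * t ^ 3 * (C * t ^ 3)) = η / 6 * t ^ 4 := by
      rw [hτ₂]
      field_simp
      ring
    rw [h1, h2, hR]
    field_simp
    ring
  have h3 : 0 ≤ 3 * (μ⁻¹ * A * B) / (τ₂ * η) := by positivity
  have h4 : 0 ≤ A / C := by positivity
  have h5 : T ≤ t ^ 2 := htu.trans (by nlinarith)
  have h6 : μ⁻¹ * A * B / (4 * τ₂) = 3 * (μ⁻¹ * A * B) / (τ₂ * η) * (η / 12) := by
    field_simp
    ring
  have h7 : 3 * (μ⁻¹ * A * B) / (τ₂ * η) * (η / 12) * t ^ 2 ≤ t ^ 2 * (η / 12) * t ^ 2 := by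
    gcongr
    linarith
  have h8 : A / C * (η / 6) * t ^ 2 ≤ t ^ 2 * (η / 6) * t ^ 2 := by
    gcongr
    linarith
  rw [e1, e2, h6]
  linarith

/-- If `∫ |u|^σ` is bounded for some `σ > 2`, then `∬ |u(x)|² |w(y)|² / |x - y| = o(‖u‖⁴)`
for `‖w‖ ≤ ‖u‖`. -/
theorem exists_lintegral_coulomb_le_mul {a : ℝ} (ha : 0 < a) {σ K η : ℝ} (hσ : 2 < σ) (hK : 0 ≤ K) (hη : 0 < η) :
    ∃ T : ℝ, 1 ≤ T ∧ ∀ u w : E a, T ≤ ‖u‖ → ‖w‖ ≤ ‖u‖ →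
      ∫⁻ x, ENNReal.ofReal (‖toL2 u x‖ ^ σ) ≤ ENNReal.ofReal K →
      ∫⁻ z : R3 × R3, ENNReal.ofReal ‖z.1 - z.2‖⁻¹ * (‖toL2 u z.1‖ₑ ^ 2 * ‖toL2 w z.2‖ₑ ^ 2) ≤
        ENNReal.ofReal (η * ‖u‖ ^ 4) := by
  obtain ⟨S, hS, hcube⟩ := exists_lintegral_toL2_cube_le a
  obtain ⟨C, hC⟩ : ∃ C : ℝ, C = S + a⁻¹ := ⟨_, rfl⟩
  have hC0 : 0 < C := by rw [hC]; positivity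
  obtain ⟨R, hR⟩ : ∃ R : ℝ, R = 6 * C ^ 2 / η := ⟨_, rfl⟩
  have hR0 : 0 < R := by rw [hR]; positivity
  obtain ⟨B, hB, hBle⟩ : ∃ B : ℝ, 0 < B ∧
      ∫⁻ x in Metric.ball (0 : R3) R, ENNReal.ofReal (‖x‖⁻¹ ^ 2) ≤ ENNReal.ofReal B := by
    refine ⟨(∫⁻ x in Metric.ball (0 : R3) R, ENNReal.ofReal (‖x‖⁻¹ ^ 2)).toReal + 1, by positivity, ?_⟩
    rw [← ENNReal.ofReal_toReal (lintegral_norm_inv_sq_ball_lt_top R).ne]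
    refine ENNReal.ofReal_le_ofReal ?_
    rw [ENNReal.ofReal_toReal (lintegral_norm_inv_sq_ball_lt_top R).ne]
    linarith
  obtain ⟨τ₁, hτ₁⟩ : ∃ τ : ℝ, τ = 3 * B * C / η := ⟨_, rfl⟩
  have hτ₁0 : 0 < τ₁ := by rw [hτ₁]; positivity
  obtain ⟨m, hm⟩ : ∃ m : ℝ, m = η / (3 * τ₁ * C ^ 2) := ⟨_, rfl⟩
  have hm0 : 0 < m := by rw [hm]; positivity
  obtain ⟨τ₂, hτ₂⟩ : ∃ τ : ℝ, τ = η / (3 * C ^ 2) := ⟨_, rfl⟩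
  have hτ₂0 : 0 < τ₂ := by rw [hτ₂]; positivity
  obtain ⟨μ, hμ⟩ : ∃ μ : ℝ, μ = η * τ₂ / (3 * B * C) := ⟨_, rfl⟩
  have hμ0 : 0 < μ := by rw [hμ]; positivity
  obtain ⟨A, hA⟩ : ∃ A : ℝ, A = m ^ (2 - σ) * K := ⟨_, rfl⟩
  have hA0 : 0 ≤ A := by rw [hA]; positivity
  obtain ⟨T, hT⟩ : ∃ T : ℝ, T = 1 + 3 * (μ⁻¹ * A * B) / (τ₂ * η) + A / C := ⟨_, rfl⟩
  have hT1 : 1 ≤ T := by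
    rw [hT]
    have h1 : 0 ≤ 3 * (μ⁻¹ * A * B) / (τ₂ * η) := by positivity
    have h2 : 0 ≤ A / C := by positivity
    linarith
  refine ⟨T, hT1, fun u w htu hwu hu => ?_⟩
  obtain ⟨t, ht⟩ : ∃ t : ℝ, t = ‖u‖ := ⟨_, rfl⟩
  rw [← ht] at htu hwu ⊢
  have ht1 : 1 ≤ t := hT1.trans htu
  have ht0 : 0 < t := by linarith
  have hb2 : ∀ v : E a, ‖v‖ ≤ t → ∫⁻ x, ‖toL2 v x‖ₑ ^ 2 ≤ ENNReal.ofReal (C * t ^ 2) := fun v hv => by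
    refine (lintegral_toL2_sq_le ha v).trans (ENNReal.ofReal_le_ofReal ?_)
    have : a⁻¹ ≤ C := by rw [hC]; linarith
    gcongr
  have hb3 : ∀ v : E a, ‖v‖ ≤ t → ∫⁻ x, ‖toL2 v x‖ₑ ^ 3 ≤ ENNReal.ofReal (C * t ^ 3) := fun v hv => by
    refine (hcube v).trans (ENNReal.ofReal_le_ofReal ?_)
    have : S ≤ C := by rw [hC]; linarith [inv_pos.2 ha]
    gcongr
  -- A strongly measurable representative makes the level set below measurable.
  obtain ⟨v, hvm, huv⟩ : ∃ v : R3 → Spinor, StronglyMeasurable v ∧ (toL2 u : R3 → Spinor) =ᵐ[volume] v :=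
    Lp.aestronglyMeasurable (toL2 u)
  have hwm := Lp.aestronglyMeasurable (toL2 w)
  set s : Set R3 := {x | ‖v x‖ < m * t} with hs
  have hsm : MeasurableSet s := measurableSet_lt hvm.norm.measurable measurable_const
  have hv2 : ∫⁻ x, ‖v x‖ₑ ^ 2 ≤ ENNReal.ofReal (C * t ^ 2) := by
    refine (lintegral_congr_ae (huv.mono fun x hx => ?_)).trans_le (hb2 u ht.ge)
    rw [hx]
  have hv3 : ∫⁻ x, ‖v x‖ₑ ^ 3 ≤ ENNReal.ofReal (C * t ^ 3) := by
    refine (lintegral_congr_ae (huv.mono fun x hx => ?_)).trans_le (hb3 u ht.ge)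
    rw [hx]
  have hvσ : ∫⁻ x, ENNReal.ofReal (‖v x‖ ^ σ) ≤ ENNReal.ofReal K := by
    refine (lintegral_congr_ae (huv.mono fun x hx => ?_)).trans_le hu
    rw [hx]
  have hind : ∀ (j : ℕ) (s' : Set R3) x, j ≠ 0 → ‖s'.indicator v x‖ₑ ^ j ≤ ‖v x‖ₑ ^ j := fun j s' x _ =>
    pow_le_pow_left' (enorm_indicator_le_enorm_self _ _) j
  -- Below the cut one factor `|v|` is at most `m t`, so the cube gains the small factor `m` over
  -- the Sobolev bound.
  have hsmall : ∫⁻ x, ‖s.indicator v x‖ₑ ^ 3 ≤ ENNReal.ofReal (m * C * t ^ 3) := by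
    calc _ ≤ ∫⁻ x, ENNReal.ofReal (m * t) * ‖v x‖ₑ ^ 2 := by
          refine lintegral_mono fun x => ?_
          by_cases hx : x ∈ s
          · rw [Set.indicator_of_mem hx, pow_succ', ← ofReal_norm]
            gcongr
            exact le_of_lt hx
          · rw [Set.indicator_of_notMem hx]
            simp
      _ ≤ ENNReal.ofReal (m * t) * ENNReal.ofReal (C * t ^ 2) := by
          rw [lintegral_const_mul' _ _ ENNReal.ofReal_ne_top]
          gcongr
      _ = _ := by
          rw [← ENNReal.ofReal_mul (by positivity)]
          congr 1
          ring
  -- Above the cut `|v| ≥ m t ≥ m`, hence `|v|² ≤ m^(2-σ) |v|^σ`: this is where `σ > 2` enters, and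
  -- the bound does not grow with `t`.
  have hlarge : ∫⁻ x, ‖sᶜ.indicator v x‖ₑ ^ 2 ≤ ENNReal.ofReal A := by
    calc _ ≤ ∫⁻ x, ENNReal.ofReal (m ^ (2 - σ)) * ENNReal.ofReal (‖v x‖ ^ σ) := by
          refine lintegral_mono fun x => ?_
          by_cases hx : x ∈ sᶜ
          · rw [Set.indicator_of_mem hx, ← ofReal_norm, ← ENNReal.ofReal_pow (norm_nonneg _),
              ← ENNReal.ofReal_mul (by positivity)]
            refine ENNReal.ofReal_le_ofReal ?_
            have hx' : m ≤ ‖v x‖ := by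
              have h1 : m * t ≤ ‖v x‖ := not_lt.1 hx
              nlinarith
            have hvx : 0 < ‖v x‖ := hm0.trans_le hx'
            have h2 : ‖v x‖ ^ (2 - σ) ≤ m ^ (2 - σ) :=
              Real.rpow_le_rpow_of_nonpos hm0 hx' (by linarith)
            calc ‖v x‖ ^ 2 = ‖v x‖ ^ (2 - σ) * ‖v x‖ ^ σ := by
                  rw [← Real.rpow_add hvx, sub_add_cancel, Real.rpow_two]
              _ ≤ _ := by gcongr
          · rw [Set.indicator_of_notMem hx]
            simp
      _ ≤ ENNReal.ofReal (m ^ (2 - σ)) * ENNReal.ofReal K := by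
          rw [lintegral_const_mul' _ _ ENNReal.ofReal_ne_top]
          gcongr
      _ = _ := by rw [← ENNReal.ofReal_mul (by positivity), hA]
  have hI₁ := lintegral_coulomb_le_of_le (f := s.indicator v) (h := toL2 w) (τ := τ₁ / t ^ 2) (μ := 1) (R := R)
    (hvm.indicator hsm).aestronglyMeasurable hwm (by positivity) one_pos hR0 (by positivity) (by positivity)
    (by positivity) (by positivity) hB.le
    ((lintegral_mono fun x => hind 2 s x two_ne_zero).trans hv2) hsmall (hb2 w hwu) (hb3 w hwu) hBle
  -- Only the upper part has a bounded `L²` norm, so here a small `μ` reduces the weight on `∫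
  -- |w|²`, which may grow like `t²`.
  have hI₂ := lintegral_coulomb_le_of_le (f := sᶜ.indicator v) (h := toL2 w) (τ := τ₂ / t ^ 2) (μ := μ) (R := R)
    (hvm.indicator hsm.compl).aestronglyMeasurable hwm (by positivity) hμ0 hR0 hA0 (by positivity)
    (by positivity) (by positivity) hB.le
    hlarge ((lintegral_mono fun x => hind 3 sᶜ x three_ne_zero).trans hv3) (hb2 w hwu) (hb3 w hwu) hBle
  have hsplit : ∀ x, ‖v x‖ₑ ^ 2 = ‖s.indicator v x‖ₑ ^ 2 + ‖sᶜ.indicator v x‖ₑ ^ 2 := fun x => by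
    by_cases hx : x ∈ s
    · simp [hx]
    · simp [hx]
  have hsum : ∫⁻ z : R3 × R3, ENNReal.ofReal ‖z.1 - z.2‖⁻¹ * (‖toL2 u z.1‖ₑ ^ 2 * ‖toL2 w z.2‖ₑ ^ 2) =
      (∫⁻ z : R3 × R3, ENNReal.ofReal ‖z.1 - z.2‖⁻¹ * (‖s.indicator v z.1‖ₑ ^ 2 * ‖toL2 w z.2‖ₑ ^ 2)) +
      ∫⁻ z : R3 × R3, ENNReal.ofReal ‖z.1 - z.2‖⁻¹ * (‖sᶜ.indicator v z.1‖ₑ ^ 2 * ‖toL2 w z.2‖ₑ ^ 2) := by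
    rw [← lintegral_add_left']
    · refine lintegral_congr_ae ?_
      filter_upwards [ae_prod_fst huv] with z hz
      rw [hz, hsplit]
      ring
    · have h1 : AEMeasurable (fun z : R3 × R3 => ‖s.indicator v z.1‖ₑ ^ 2) volume :=
        (((hvm.indicator hsm).measurable.enorm.pow_const 2).comp measurable_fst).aemeasurable
      exact (Measurable.ennreal_ofReal (by fun_prop)).aemeasurable.mul
        (h1.mul ((aestronglyMeasurable_snd (toL2 w)).enorm.pow_const 2))
  rw [hsum]
  refine (add_le_add hI₁ hI₂).trans ?_
  rw [← ENNReal.ofReal_add (by positivity) (by positivity)]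
  refine ENNReal.ofReal_le_ofReal ?_
  exact coulomb_constants_le hη hC0 hB hA0 hR hτ₁ hm hτ₂ hμ hT hT1 htu

/-! ### Energy bounds and the a priori estimate. -/

theorem HypP.iInf_le {P : R3 → ℝ} (hP : HypP P) (x : R3) : ⨅ x, P x ≤ P x := by
  obtain ⟨M, hM⟩ := hP.2.1
  exact ciInf_le ⟨-M, by rintro _ ⟨y, rfl⟩; exact neg_le_of_abs_le (hM y)⟩ x

/-- The bounds that follow from a bound for `Φ_ε(u) - ½ Φ_ε'(u) u`. -/
theorem exists_energy_bounds {a : ℝ} (ha : 0 < a) {g : ℝ → ℝ} (hg : HypG1 g) (hg' : HypG2 g)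
    {Q P : R3 → ℝ} (hQ : HypQ Q) (hP : HypP P) {c : ℝ} (hc : 0 < c) :
    ∃ σ K : ℝ, 2 < σ ∧ 0 < K ∧ ∀ (ε : ℝ) (u : E a),
      1 / 4 * coulombForm Q ε (toL2 u) (toL2 u) (toL2 u) (toL2 u) +
          (1 / 2 * (∫ x, P (ε • x) * (g ‖toL2 u x‖ * ‖toL2 u x‖ ^ 2)) - Psi g P ε (toL2 u)) ≤ c →
      coulombForm Q ε (toL2 u) (toL2 u) (toL2 u) (toL2 u) ≤ K ∧
        ∫ x, g ‖toL2 u x‖ * ‖toL2 u x‖ ^ 2 ≤ K ∧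
        ∫⁻ x, ENNReal.ofReal (‖toL2 u x‖ ^ σ) ≤ ENNReal.ofReal K := by
  obtain ⟨σ, θ, c₀, hσ, hθ, hc₀, h⟩ := id hg'
  have hP0 := hP.2.2.1
  set p := ⨅ x, P x with hp
  have hθ' : 0 < 1 / 2 - 1 / θ := by
    rw [sub_pos]
    exact one_div_lt_one_div_of_lt (by norm_num) hθ
  obtain ⟨K₁, hK₁⟩ : ∃ K₁ : ℝ, K₁ = c / ((1 / 2 - 1 / θ) * p) := ⟨_, rfl⟩
  have hK₁0 : 0 < K₁ := by rw [hK₁]; positivity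
  -- The summands bound, in this order, the Coulomb form, `∫ g(|u|) |u|²` and `∫ |u|^σ`.
  refine ⟨σ, 4 * c + K₁ + (c₀ * θ)⁻¹ * K₁, hσ, by positivity, fun ε u hu => ?_⟩
  have hB := coulombForm_nonneg hQ ε (toL2 u) (toL2 u)
  obtain ⟨i1, i2⟩ := integrable_mul_primitive ha hg hg' hP ε u
  obtain ⟨i3, i4⟩ := integrable_primitive ha hg hg' u
  have hgs : ∀ x, 0 ≤ g ‖toL2 u x‖ * ‖toL2 u x‖ ^ 2 := fun x =>
    mul_nonneg (hg.nonneg hg' (norm_nonneg _)) (sq_nonneg _)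
  have hPp : ∀ x, p ≤ P (ε • x) := fun x => hP.iInf_le _
  have hpsi : Psi g P ε (toL2 u) ≤ 1 / θ * ∫ x, P (ε • x) * (g ‖toL2 u x‖ * ‖toL2 u x‖ ^ 2) := by
    rw [Psi, ← integral_const_mul]
    refine integral_mono i2 (i1.const_mul _) fun x => ?_
    dsimp only
    rw [mul_left_comm]
    refine mul_le_mul_of_nonneg_left ?_ (hP0.le.trans (hPp x))
    rcases (norm_nonneg (toL2 u x)).eq_or_lt with h0 | h0
    · rw [← h0, primitive_zero]
      simp
    · exact (h _ h0).2
  have hge : p * (∫ x, g ‖toL2 u x‖ * ‖toL2 u x‖ ^ 2) ≤ ∫ x, P (ε • x) * (g ‖toL2 u x‖ * ‖toL2 u x‖ ^ 2) := by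
    rw [← integral_const_mul]
    exact integral_mono (i3.const_mul _) i1 fun x => mul_le_mul_of_nonneg_right (hPp x) (hgs x)
  have hg0 : 0 ≤ ∫ x, g ‖toL2 u x‖ * ‖toL2 u x‖ ^ 2 := integral_nonneg hgs
  have hle : (1 / 2 - 1 / θ) * (p * ∫ x, g ‖toL2 u x‖ * ‖toL2 u x‖ ^ 2) ≤
      c - 1 / 4 * coulombForm Q ε (toL2 u) (toL2 u) (toL2 u) (toL2 u) := by
    refine (mul_le_mul_of_nonneg_left hge hθ'.le).trans ?_
    linarith
  have hnn : 0 ≤ (1 / 2 - 1 / θ) * (p * ∫ x, g ‖toL2 u x‖ * ‖toL2 u x‖ ^ 2) := by positivity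
  have hK : ∫ x, g ‖toL2 u x‖ * ‖toL2 u x‖ ^ 2 ≤ K₁ := by
    rw [hK₁, le_div_iff₀ (by positivity)]
    linarith
  have hK2 : 0 ≤ (c₀ * θ)⁻¹ * K₁ := by positivity
  refine ⟨by linarith, by linarith, ?_⟩
  calc _ ≤ ∫⁻ x, ENNReal.ofReal ((c₀ * θ)⁻¹ * (g ‖toL2 u x‖ * ‖toL2 u x‖ ^ 2)) := by
        refine lintegral_mono fun x => ENNReal.ofReal_le_ofReal ?_
        rw [inv_mul_eq_div, le_div_iff₀ (by positivity)]
        rcases (norm_nonneg (toL2 u x)).eq_or_lt with h0 | h0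
        · rw [← h0, Real.zero_rpow (by linarith)]
          simp
        · have h1 := (h _ h0).1.trans (h _ h0).2
          have h2 : 1 / θ * (g ‖toL2 u x‖ * ‖toL2 u x‖ ^ 2) = g ‖toL2 u x‖ * ‖toL2 u x‖ ^ 2 / θ := by ring
          rw [h2, le_div_iff₀ (by linarith)] at h1
          linarith
    _ = ENNReal.ofReal ((c₀ * θ)⁻¹ * ∫ x, g ‖toL2 u x‖ * ‖toL2 u x‖ ^ 2) := by
        rw [← integral_const_mul, ofReal_integral_eq_lintegral_ofReal (i3.const_mul _)
          (ae_of_all _ fun x => mul_nonneg (by positivity) (hgs x))]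
    _ ≤ _ := by
        refine ENNReal.ofReal_le_ofReal ?_
        have : (c₀ * θ)⁻¹ * ∫ x, g ‖toL2 u x‖ * ‖toL2 u x‖ ^ 2 ≤ (c₀ * θ)⁻¹ * K₁ := by gcongr
        linarith

/-- The bound for `Ψ_ε'(u) w`. -/
theorem exists_Psi_deriv_le {a : ℝ} (ha : 0 < a) {g : ℝ → ℝ} (hg : HypG1 g) (hg' : HypG2 g)
    {P : R3 → ℝ} (hP : HypP P) : ∃ D : ℝ, 0 < D ∧ ∀ (ε b K : ℝ) (u w : E a), 0 < b → 1 ≤ ‖u‖ → ‖w‖ ≤ ‖u‖ →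
      ∫ x, g ‖toL2 u x‖ * ‖toL2 u x‖ ^ 2 ≤ K →
      ∫ x, P (ε • x) * (g ‖toL2 u x‖ * (inner ℂ (toL2 u x) (toL2 w x)).re) ≤
        D * (b * K * ‖u‖ + b⁻¹ * ‖u‖ ^ 2) := by
  obtain ⟨M, hM⟩ := hP.2.1
  have hM0 : 0 ≤ M := (abs_nonneg _).trans (hM 0)
  obtain ⟨C, hC, hgC⟩ := hg.exists_le_linear
  obtain ⟨S, hS, hint⟩ := exists_integral_mul_le ha
  obtain ⟨S', hS', hint'⟩ := exists_integral_sq_cube_le ha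
  refine ⟨M * (1 + C * (S' + S)) + 1, by positivity, fun ε b K u w hb hu hwu hK => ?_⟩
  obtain ⟨t, ht⟩ : ∃ t : ℝ, t = ‖u‖ := ⟨_, rfl⟩
  obtain ⟨r, hr⟩ : ∃ r : ℝ, r = ‖w‖ := ⟨_, rfl⟩
  obtain ⟨i3, -⟩ := integrable_primitive ha hg hg' u
  obtain ⟨-, j1, j1'⟩ := hint w u
  obtain ⟨⟨j2, j2'⟩, -⟩ := hint' w
  rw [← hr] at hwu j1' j2'
  rw [← ht] at hu hwu j1' ⊢
  have hr0 : 0 ≤ r := by rw [hr]; exact norm_nonneg _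
  have ht0 : 0 < t := by linarith
  -- With Young weight `b t`, the first half costs `b t K` and the second at most `(b t)⁻¹` times a
  -- multiple of `t³`, that is of order `b⁻¹ t²`.
  have hs : 0 < b * t := by positivity
  have j12 : Integrable (fun x => ‖toL2 w x‖ ^ 2 + ‖toL2 w x‖ ^ 2 * ‖toL2 u x‖) := j2.add j1
  have hg0 : 0 ≤ ∫ x, g ‖toL2 u x‖ * ‖toL2 u x‖ ^ 2 :=
    integral_nonneg fun x => mul_nonneg (hg.nonneg hg' (norm_nonneg _)) (sq_nonneg _)
  have hpt : ∀ x, |g ‖toL2 u x‖ * (inner ℂ (toL2 u x) (toL2 w x)).re| ≤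
      b * t * (g ‖toL2 u x‖ * ‖toL2 u x‖ ^ 2) +
        (b * t)⁻¹ * C * (‖toL2 w x‖ ^ 2 + ‖toL2 w x‖ ^ 2 * ‖toL2 u x‖) := fun x => by
    have h0 := hg.nonneg hg' (norm_nonneg (toL2 u x))
    have h1 : |(inner ℂ (toL2 u x) (toL2 w x)).re| ≤ ‖toL2 u x‖ * ‖toL2 w x‖ :=
      (Complex.abs_re_le_norm _).trans (norm_inner_le_norm _ _)
    have h2 := h1.trans (mul_le_weighted hs)
    rw [abs_mul, abs_of_nonneg h0]
    refine (mul_le_mul_of_nonneg_left h2 h0).trans ?_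
    have h3 := mul_le_mul_of_nonneg_right (hgC _ (norm_nonneg (toL2 u x)))
      (by positivity : 0 ≤ (b * t)⁻¹ * ‖toL2 w x‖ ^ 2)
    linarith
  have hbd := (integrable_weight_mul hP ε ((aestronglyMeasurable_g_norm hg hg' (toL2 u)).mul
    (aestronglyMeasurable_re_inner (toL2 u) (toL2 w))) ((i3.const_mul (b * t)).add
      (j12.const_mul ((b * t)⁻¹ * C))) hpt hM).2
  refine (le_abs_self _).trans (hbd.trans ?_)
  simp only [Pi.add_apply]
  rw [integral_add (i3.const_mul _) (j12.const_mul _), integral_const_mul, integral_const_mul, integral_add j2 j1]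
  have hK0 : 0 ≤ K := hg0.trans hK
  have e1 : S' * r ^ 2 + S * (r ^ 2 * t) ≤ (S' + S) * t ^ 3 := by
    have h1 : r ^ 2 ≤ t ^ 2 := by gcongr
    have h2 : t ^ 2 ≤ t ^ 3 := by gcongr; linarith
    have h3 : r ^ 2 * t ≤ t ^ 3 := by
      calc r ^ 2 * t ≤ t ^ 2 * t := by gcongr
        _ = t ^ 3 := by ring
    nlinarith
  calc _ ≤ M * (b * t * K + (b * t)⁻¹ * C * ((S' + S) * t ^ 3)) := by
        gcongr
        exact (add_le_add j2' j1').trans e1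
    _ = M * (b * K * t) + M * (C * (S' + S)) * (b⁻¹ * t ^ 2) := by
        field_simp
    _ ≤ _ := by
        have h1 : 0 ≤ b * K * t := by positivity
        have h2 : 0 ≤ b⁻¹ * t ^ 2 := by positivity
        have h3 : 0 ≤ M * (C * (S' + S)) := by positivity
        nlinarith [mul_nonneg h3 h1, mul_nonneg hM0 h2]

/-- The a priori bound behind the boundedness of Cerami sequences. -/
theorem exists_norm_le_of_almost_critical {a ω : ℝ} (ha : 0 < a) (hω : ω ∈ Set.Ioo (-a) a)
    {g : ℝ → ℝ} (hg : HypG1 g) (hg' : HypG2 g) {Q P : R3 → ℝ} (hQ : HypQ Q) (hP : HypP P) {c : ℝ} (hc : 0 < c) :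
    ∃ Λ : ℝ, 0 < Λ ∧ ∀ ε ∈ Set.Ioc (0 : ℝ) 1, ∀ u : E a, Phi a ω g Q P ε u ≤ c →
      ‖(1 + ‖u‖) • fderiv ℝ (Phi a ω g Q P ε) u‖ ≤ 1 → ‖u‖ ≤ Λ := by
  obtain ⟨σ, K, hσ, hK, henergy⟩ := exists_energy_bounds ha hg hg' hQ hP (c := c + 1) (by linarith)
  obtain ⟨D, hD, hcoul⟩ := exists_coulombForm_le_of_lintegral_le ha hQ
  obtain ⟨D', hD', hpsi⟩ := exists_Psi_deriv_le ha hg hg' hP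
  -- The coercivity left after the frequency term, positive because `ω` lies in the spectral gap.
  -- The constants `ρ` and `b` below give the Coulomb term and the nonlinear term `κ / 4` each.
  obtain ⟨κ, hκ⟩ : ∃ κ : ℝ, κ = 1 - |ω| / a := ⟨_, rfl⟩
  have hκ0 : 0 < κ := by
    rw [hκ, sub_pos, div_lt_one ha]
    exact abs_lt.2 hω
  obtain ⟨ρ, hρ⟩ : ∃ ρ : ℝ, ρ = κ / (2 * (K + D)) := ⟨_, rfl⟩
  have hρ0 : 0 < ρ := by rw [hρ]; positivity
  obtain ⟨b, hb⟩ : ∃ b : ℝ, b = 4 * D' / κ := ⟨_, rfl⟩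
  have hb0 : 0 < b := by rw [hb]; positivity
  obtain ⟨T, hT1, hT⟩ := exists_lintegral_coulomb_le_mul ha hσ hK.le (η := ρ ^ 2) (by positivity)
  refine ⟨T + 2 * (1 + D' * b * K) / κ, by positivity, fun ε hε u hΦ hΦ' => ?_⟩
  have hfrac : 0 ≤ 2 * (1 + D' * b * K) / κ := by positivity
  rcases le_total ‖u‖ T with hu | hu
  · linarith
  obtain ⟨hd1, hd2⟩ := Phi_derivative ha ω hg hg' hQ hP hε u
  rw [norm_smul, Real.norm_of_nonneg (by positivity)] at hΦ'
  have hsgn := norm_signDirac u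
  -- The weight `1 + ‖u‖` of the Cerami condition makes the derivative bounded in directions as long
  -- as `u`.
  have hop : ∀ v : E a, ‖v‖ = ‖u‖ → |fderiv ℝ (Phi a ω g Q P ε) u v| ≤ 1 := fun v hv => by
    rw [← Real.norm_eq_abs]
    refine (ContinuousLinearMap.le_opNorm _ _).trans ?_
    rw [hv]
    nlinarith [norm_nonneg (fderiv ℝ (Phi a ω g Q P ε) u)]
  have h1 := abs_le.1 (hop u rfl)
  have h2 := abs_le.1 (hop (signDirac u) hsgn)
  obtain ⟨hB4, hG, hLσ⟩ := henergy ε u (by linarith [h1.1])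
  have hB := hcoul ε hε u (signDirac u) _ (by positivity) (hT u (signDirac u) hu hsgn.le hLσ)
  have hPsi := hpsi ε b K u (signDirac u) hb0 (hT1.trans hu) hsgn.le hG
  have hL2 := mul_norm_toL2_sq_le ha.le u
  obtain ⟨t, ht⟩ : ∃ t : ℝ, t = ‖u‖ := ⟨_, rfl⟩
  -- This weight balances the bounded form at `u` with the form at `(sgn H₀) u`, which is at most `D
  -- ρ² t⁴`.
  have hCS := coulombForm_cauchySchwarz ha hQ hε u u (signDirac u) (ρ * t ^ 2)
  rw [← ht] at hu hB hPsi hL2 hd2 ⊢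
  have ht0 : 0 < t := by linarith
  set B := coulombForm Q ε (toL2 u) (toL2 u) (toL2 u) (toL2 (signDirac u)) with hBdef
  have hBle : B ≤ κ / 4 * t ^ 2 := by
    have h3 : 2 * (ρ * t ^ 2) * B ≤ (ρ * t ^ 2) ^ 2 * K + D * (ρ ^ 2 * t ^ 4) :=
      hCS.trans (add_le_add (mul_le_mul_of_nonneg_left hB4 (by positivity)) hB)
    have h4 : (ρ * t ^ 2) ^ 2 * K + D * (ρ ^ 2 * t ^ 4) = 2 * (ρ * t ^ 2) * (ρ * (K + D) / 2 * t ^ 2) := by ring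
    have h5 : ρ * (K + D) / 2 = κ / 4 := by
      rw [hρ]
      field_simp
      norm_num
    rw [h4, h5] at h3
    exact le_of_mul_le_mul_left h3 (by positivity)
  have hP2 : D' * (b * K * t + b⁻¹ * t ^ 2) = D' * b * K * t + κ / 4 * t ^ 2 := by
    have h3 : D' * b⁻¹ = κ / 4 := by
      rw [hb]
      field_simp
    linear_combination t ^ 2 * h3
  have hω2 : |ω| * ‖toL2 u‖ ^ 2 ≤ (1 - κ) * t ^ 2 := by
    have h3 : (1 - κ) * t ^ 2 = |ω| / a * t ^ 2 := by rw [hκ]; ring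
    rw [h3]
    calc |ω| * ‖toL2 u‖ ^ 2 = |ω| / a * (a * ‖toL2 u‖ ^ 2) := by field_simp
      _ ≤ _ := by gcongr
  have hfin : κ / 2 * t ^ 2 ≤ 1 + D' * b * K * t := by
    rw [hP2] at hPsi
    linarith [h2.2]
  have hfin2 : κ / 2 * t ≤ 1 + D' * b * K := by
    have h3 : κ / 2 * t * t ≤ (1 + D' * b * K) * t := by nlinarith
    exact le_of_mul_le_mul_right h3 ht0
  have h6 : t ≤ 2 * (1 + D' * b * K) / κ := by
    rw [le_div_iff₀ hκ0]
    linarith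
  linarith

end MaxwellDirac

end

theorem lemma2p5 (a ω : ℝ) (ha : 0 < a) (hω : ω ∈ Set.Ioo (-a) a)
    (g : ℝ → ℝ) (hg₁ : MaxwellDirac.HypG1 g) (hg₂ : MaxwellDirac.HypG2 g)
    (Q : MaxwellDirac.R3 → ℝ) (hQ : MaxwellDirac.HypQ Q)
    (P : MaxwellDirac.R3 → ℝ) (hP : MaxwellDirac.HypP P)
    (lam : ℝ) (hlam : 0 < lam) :
    ∃ Λ : ℝ, 0 < Λ ∧ ∀ ε ∈ Set.Ioc (0 : ℝ) 1, ∀ c ∈ Set.Icc (0 : ℝ) lam,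
      ∀ u : ℕ → MaxwellDirac.E a,
        MaxwellDirac.IsCeramiSeq (MaxwellDirac.Phi a ω g Q P ε) c u →
          ∃ φ : ℕ → ℕ, StrictMono φ ∧ ∀ n, ‖u (φ n)‖ ≤ Λ := by
  -- The level `lam + 1` leaves room for energies that converge to `c ≤ lam` from above.
  obtain ⟨Λ, hΛ, h⟩ := MaxwellDirac.exists_norm_le_of_almost_critical ha hω hg₁ hg₂ hQ hP
    (c := lam + 1) (by linarith)
  refine ⟨Λ, hΛ, fun ε hε c hc u hu => ?_⟩
  have h1 : ∀ᶠ n in atTop, MaxwellDirac.Phi a ω g Q P ε (u n) ≤ lam + 1 :=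
    (hu.1.eventually_lt_const (by linarith [hc.2] : c < lam + 1)).mono fun n hn => hn.le
  have h2 : ∀ᶠ n in atTop, ‖(1 + ‖u n‖) • fderiv ℝ (MaxwellDirac.Phi a ω g Q P ε) (u n)‖ ≤ 1 := by
    have h3 := hu.2.norm
    rw [norm_zero] at h3
    exact (h3.eventually_lt_const one_pos).mono fun n hn => hn.le
  -- The whole tail is bounded, so the subsequence is a shift.
  obtain ⟨N, hN⟩ := eventually_atTop.1 (h1.and h2)
  exact ⟨fun n => n + N, fun m n hmn => Nat.add_lt_add_right hmn N, fun n =>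
    h ε hε _ (hN _ (Nat.le_add_left N n)).1 (hN _ (Nat.le_add_left N n)).2⟩
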